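/- Let $T>0$, $\beta\in(0,1)$, $x^0<0$ and $C_0>0$, let $\psi(t,x)=|x-x^0|^2-\beta t^2+C_0$, assume that $\psi\ge 1$ on $[-T,T]\times[0,1]$, and for $\lambda>0$ let $\varphi(t,x)=e^{\lambda\psi(t,x)}$. For $N\in\mathbb N$ let $h=1/(N+1)$ and $x_j=jh$ for $0\le j\le N+1$. For a discrete function $f=(f_j)_{0\le j\le N+1}$ put $$\int_{(0,1)}f=h\sum_{j=1}^{N}f_j,\qquad \int_{[0,1)}f=h\sum_{j=0}^{N}f_j,$$ $$(\partial_h^+f)_j=\frac{f_{j+1}-f_j}{h},\quad (\partial_h^-f)_j=\frac{f_j-f_{j-1}}{h},\quad (\partial_hf)_j=\frac{f_{j+1}-f_{j-1}}{2h},\quad (\Delta_hf)_j=\frac{f_{j+1}-2f_j+f_{j-1}}{h^2}.$$ For $s>0$ let $\rho=e^{-s\varphi}$ and define the coefficients $$A_1(t,x)=\frac12\int_{-1}^1[\varphi\,\partial_x\psi](t,x+\sigma h)\,\frac{\rho(t,x+\sigma h)}{\rho(t,x)}\,d\sigma,$$ $$A_k(t,x)=\int_{-1}^1(1-|\sigma|)\,f_k(t,x+\sigma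 h)\,\frac{\rho(t,x+\sigma h)}{\rho(t,x)}\,d\sigma\quad(k=2,3,4),$$ with $f_2=\varphi^2(\partial_x\psi)^2$, $f_3=\varphi(\partial_x\psi)^2$, $f_4=\varphi\,\partial_{xx}\psi$, and $$A_0=\frac{h^2}{2}\left(s^2\lambda^2A_2-s\lambda^2A_3-s\lambda A_4\right).$$ For a semi-discrete real function $v=(v_j(t))_{0\le j\le N+1}$, $t\in[-T,T]$, define at the points $x_j$, $1\le j\le N$, $$P_hv=\frac1\rho(\partial_{tt}-\Delta_h)(\rho v),$$ $$P_{h,1}v=\partial_{tt}v-(1+A_0)\Delta_hv+s^2\lambda^2\left[\varphi^2(\partial_t\psi)^2-A_2\right]v,$$ $$P_{h,2}v=-s\lambda^2\left[\varphi|\partial_t\psi|^2-A_3\right]v-2s\lambda\left[\varphi\,\partial_t\psi\,\partial_tv-A_1\,\partial_hv\right].$$ Then there exist $\lambda>0$, $s_0>0$, $\varepsilon_0>0$ and $M_0>0$, depending only on $T,\beta,x^0,C_0$, such that for all $N\in\mathbb N$ (with $h=1/(N+1)$), all $s\in(s_0,\varepsilon_0/h)$ and all $v$ with $v_j\in H^2(-T,T)$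 for $1\le j\le N$, $v_0=v_{N+1}=0$ on $(-T,T)$, and $v_j(\pm T)=\partial_tv_j(\pm T)=0$ for $1\le j\le N$, $$\begin{aligned} &s\int_{-T}^{T}\!\int_{(0,1)}|\partial_tv|^2\,dt+s\int_{-T}^{T}\!\int_{[0,1)}|\partial_h^+v|^2\,dt+s^3\int_{-T}^{T}\!\int_{(0,1)}|v|^2\,dt\\ &\quad+\int_{-T}^{T}\!\int_{(0,1)}|P_{h,1}v|^2\,dt+\int_{-T}^{T}\!\int_{(0,1)}|P_{h,2}v|^2\,dt\\ &\le M_0\int_{-T}^{T}\!\int_{(0,1)}|P_hv|^2\,dt+M_0\,s\int_{-T}^{T}\left|(\partial_h^-v)_{N+1}\right|^2dt+M_0\,s\int_{-T}^{T}\!\int_{[0,1)}|h\,\partial_h^+\partial_tv|^2\,dt. \end{aligned}$$ -/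

import Mathlib

open Set MeasureTheory

namespace DiscreteCarleman

noncomputable section

/-! Mesh, discrete integrals and difference operators. A discrete function is a map `ℕ → ℝ`, of which
only the values at the indices `0, …, N + 1` of the grid points `x_j = j h` are ever used. -/

/-- The mesh size `h = 1 / (N + 1)`. -/
def mesh (N : ℕ) : ℝ := 1 / ((N : ℝ) + 1)

/-- The discrete integral over `(0,1)`: `h ∑_{j=1}^{N} f_j`. -/
def intOpen (N : ℕ) (f : ℕ → ℝ) : ℝ := mesh N * ∑ j ∈ Finset.Icc 1 N, f j

/-- The discrete integral over `[0,1)`: `h ∑_{j=0}^{N} f_j`. -/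
def intLeft (N : ℕ) (f : ℕ → ℝ) : ℝ := mesh N * ∑ j ∈ Finset.Icc 0 N, f j

/-- Forward difference `(∂_h^+ f)_j = (f_{j+1} - f_j) / h`. -/
def dPlus (h : ℝ) (f : ℕ → ℝ) (j : ℕ) : ℝ := (f (j + 1) - f j) / h

/-- Backward difference `(∂_h^- f)_j = (f_j - f_{j-1}) / h`, used at `j ≥ 1` only. -/
def dMinus (h : ℝ) (f : ℕ → ℝ) (j : ℕ) : ℝ := (f j - f (j - 1)) / h

/-- Centered difference `(∂_h f)_j = (f_{j+1} - f_{j-1}) / (2h)`, used at `j ≥ 1` only. -/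
def dCent (h : ℝ) (f : ℕ → ℝ) (j : ℕ) : ℝ := (f (j + 1) - f (j - 1)) / (2 * h)

/-- Discrete Laplacian `(Δ_h f)_j = (f_{j+1} - 2 f_j + f_{j-1}) / h²`, used at `j ≥ 1` only. -/
def lapl (h : ℝ) (f : ℕ → ℝ) (j : ℕ) : ℝ := (f (j + 1) - 2 * f j + f (j - 1)) / h ^ 2

/-! Time derivatives on `[-T, T]` (one-sided at `±T`) and the regularity class in time. -/

/-- First time derivative on `[-T, T]`. -/
def dt (T : ℝ) (u : ℝ → ℝ) (t : ℝ) : ℝ := derivWithin u (Icc (-T) T) t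

/-- Second time derivative on `[-T, T]`. -/
def dtt (T : ℝ) (u : ℝ → ℝ) (t : ℝ) : ℝ := dt T (dt T u) t

/-- `u` is (the continuously differentiable representative of) an element of the Sobolev space
`H²(-T, T)`: `u'` exists everywhere and is absolutely continuous on `[-T, T]`, and `u'' ∈ L²(-T, T)`. -/
def IsH2 (T : ℝ) (u : ℝ → ℝ) : Prop :=
  DifferentiableOn ℝ u (Icc (-T) T) ∧
  AbsolutelyContinuousOnInterval (dt T u) (-T) T ∧
  MemLp (dtt T u) 2 (volume.restrict (Ioo (-T) T))

/-! The Carleman weights; below, `ψ φ : ℝ → ℝ → ℝ` are functions of `(t, x)`. -/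

/-- `ψ(t,x) = |x - x⁰|² - β t² + C₀`. -/
def psi (β x₀ C₀ : ℝ) (t x : ℝ) : ℝ := |x - x₀| ^ 2 - β * t ^ 2 + C₀

/-- `φ(t,x) = exp(λ ψ(t,x))`. -/
def phi (β x₀ C₀ lam : ℝ) (t x : ℝ) : ℝ := Real.exp (lam * psi β x₀ C₀ t x)

/-- `∂_t ψ`. -/
def pt (ψ : ℝ → ℝ → ℝ) (t x : ℝ) : ℝ := deriv (fun τ => ψ τ x) t

/-- `∂_x ψ`. -/
def px (ψ : ℝ → ℝ → ℝ) (t x : ℝ) : ℝ := deriv (fun y => ψ t y) x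

/-- `∂_{xx} ψ`. -/
def pxx (ψ : ℝ → ℝ → ℝ) (t x : ℝ) : ℝ := deriv (fun y => px ψ t y) x

/-- `ρ = exp(-s φ)`. -/
def rho (φ : ℝ → ℝ → ℝ) (s t x : ℝ) : ℝ := Real.exp (-(s * φ t x))

/-! The coefficients of the conjugated operator. -/

/-- `A₁ = ½ ∫_{-1}^{1} [φ ∂_xψ](t, x+σh) ρ(t, x+σh)/ρ(t,x) dσ`. -/
def A1 (ψ φ : ℝ → ℝ → ℝ) (s h t x : ℝ) : ℝ :=
  1 / 2 * ∫ σ in (-1 : ℝ)..1,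
    φ t (x + σ * h) * px ψ t (x + σ * h) * (rho φ s t (x + σ * h) / rho φ s t x)

/-- `A₂ = ∫_{-1}^{1} (1-|σ|) [φ² (∂_xψ)²](t, x+σh) ρ(t, x+σh)/ρ(t,x) dσ`. -/
def A2 (ψ φ : ℝ → ℝ → ℝ) (s h t x : ℝ) : ℝ :=
  ∫ σ in (-1 : ℝ)..1, (1 - |σ|) *
    (φ t (x + σ * h) ^ 2 * px ψ t (x + σ * h) ^ 2) * (rho φ s t (x + σ * h) / rho φ s t x)

/-- `A₃ = ∫_{-1}^{1} (1-|σ|) [φ (∂_xψ)²](t, x+σh) ρ(t, x+σh)/ρ(t,x) dσ`. -/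
def A3 (ψ φ : ℝ → ℝ → ℝ) (s h t x : ℝ) : ℝ :=
  ∫ σ in (-1 : ℝ)..1, (1 - |σ|) *
    (φ t (x + σ * h) * px ψ t (x + σ * h) ^ 2) * (rho φ s t (x + σ * h) / rho φ s t x)

/-- `A₄ = ∫_{-1}^{1} (1-|σ|) [φ ∂_{xx}ψ](t, x+σh) ρ(t, x+σh)/ρ(t,x) dσ`. -/
def A4 (ψ φ : ℝ → ℝ → ℝ) (s h t x : ℝ) : ℝ :=
  ∫ σ in (-1 : ℝ)..1, (1 - |σ|) *
    (φ t (x + σ * h) * pxx ψ t (x + σ * h)) * (rho φ s t (x + σ * h) / rho φ s t x)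

/-- `A₀ = (h²/2) (s²λ² A₂ - sλ² A₃ - sλ A₄)`. -/
def A0 (ψ φ : ℝ → ℝ → ℝ) (lam s h t x : ℝ) : ℝ :=
  h ^ 2 / 2 * (s ^ 2 * lam ^ 2 * A2 ψ φ s h t x - s * lam ^ 2 * A3 ψ φ s h t x
    - s * lam * A4 ψ φ s h t x)

/-! The conjugated operator and its two parts, for `v j t = v_j(t)`, at the grid point `x_j = j h`. -/

/-- `P_h v = ρ⁻¹ (∂_{tt} - Δ_h)(ρ v)`. -/
def Ph (T : ℝ) (φ : ℝ → ℝ → ℝ) (s h : ℝ) (v : ℕ → ℝ → ℝ) (j : ℕ) (t : ℝ) : ℝ :=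
  1 / rho φ s t (j * h) *
    (dtt T (fun τ => rho φ s τ (j * h) * v j τ) t
      - lapl h (fun i => rho φ s t (i * h) * v i t) j)

/-- `P_{h,1} v = ∂_{tt} v - (1 + A₀) Δ_h v + s²λ² [φ² (∂_tψ)² - A₂] v`. -/
def Ph1 (T : ℝ) (ψ φ : ℝ → ℝ → ℝ) (lam s h : ℝ) (v : ℕ → ℝ → ℝ) (j : ℕ) (t : ℝ) : ℝ :=
  dtt T (v j) t
    - lapl h (fun i => v i t) j * (1 + A0 ψ φ lam s h t (j * h))
    + s ^ 2 * lam ^ 2 *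
      (φ t (j * h) ^ 2 * pt ψ t (j * h) ^ 2 - A2 ψ φ s h t (j * h)) * v j t

/-- `P_{h,2} v = - sλ² [φ |∂_tψ|² - A₃] v - 2sλ [φ ∂_tψ ∂_t v - A₁ ∂_h v]`. -/
def Ph2 (T : ℝ) (ψ φ : ℝ → ℝ → ℝ) (lam s h : ℝ) (v : ℕ → ℝ → ℝ) (j : ℕ) (t : ℝ) : ℝ :=
  - (s * lam ^ 2 *
      (φ t (j * h) * |pt ψ t (j * h)| ^ 2 - A3 ψ φ s h t (j * h)) * v j t)
    - 2 * s * lam *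
      (φ t (j * h) * pt ψ t (j * h) * dt T (v j) t
        - A1 ψ φ s h t (j * h) * dCent h (fun i => v i t) j)

end

end DiscreteCarleman

/-! Conjugation by ρ gives exactly P_h v = P₁v + P₂v - sRv with R bounded (`Ph_eq`, `nR_bounded`).
Hence |P₁v|² + |P₂v|² + 2 P₁v·P₂v ≤ 2|P_h v|² + O(s²)|v|², and everything rests on a lower bound for
the cross product.

Write P₁v = v_tt - cΔ_h v + bv and P₂v = -dv - 2e v_t + 2a ∂_h v. Exact summation by parts
(`cross_product_identity`) turns the sum of P₁v·P₂v into a time derivative, one boundary term at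
each end of [0,1], and a sum over mesh cells of a quadratic form in v_t, p = ∂_h⁺v and v. The time
derivative integrates to zero because v and v_t vanish at ±T (`integral_weightedEnergyDot`). Since
∂_xψ = 2(x - x⁰) > 0, the boundary term at x = 0 has the good sign, and the one at x = 1 is the
observed normal derivative.

The A_k are averages over a distance h against a weight ratio e^{O(sh)}. So the coefficients,
normalised by powers of s, are within O(sh) of their continuous limits, together with their time
derivatives and difference quotients (`Approx`). In the limit the first-order part of the cell form
is 2sλ²φ(ψ_t v_t - ψ_x p)² + 2s(1-β)λφ(v_t² + p²), and the coefficient of v² is s³λ³φ³(2λq² -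
(2+6β)q + 4(1-β)ψ_x²) with q = ψ_t² - ψ_x². As ψ_x² ≥ 4|x⁰|², the choice λ(1-β)|x⁰|² = 1 bounds the
latter below by 8λ²s³ (`zero_order_lower_bound`); λ need not be large. The errors are absorbed for s
large and sh small (`edge_quadratic_lower_bound`, `edgeForm_lower_bound`).

One discrete error is not small: summation by parts produces products w_j w_{j+1} of w = v_t instead
of squares. The defect (w_{j+1} - w_j)² = |h ∂_h⁺∂_t v|² is the last term of the estimate. -/

open Set MeasureTheory

namespace DiscreteCarleman

/-! ### Calculus of coefficients that are O(sh)-close to a limit. -/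

/-- A family `f s h t x` of coefficients is, together with its time derivative and its forward
difference quotient of step `h` in space, within `O(s h)` of `g`, `gt`, `gx` on
`[-T, T] × [0, 1]`. -/
def Approx (T : ℝ) (f : ℝ → ℝ → ℝ → ℝ → ℝ) (g gt gx : ℝ → ℝ → ℝ) : Prop :=
  ∃ C, 0 ≤ C ∧ ∀ s h t x, 1 ≤ s → 0 < h → s * h ≤ 1 → t ∈ Icc (-T) T → x ∈ Icc (0 : ℝ) 1 →
    DifferentiableAt ℝ (fun τ => f s h τ x) t ∧
    |f s h t x - g t x| ≤ C * (s * h) ∧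
    |deriv (fun τ => f s h τ x) t - gt t x| ≤ C * (s * h) ∧
    (x + h ≤ 1 → |(f s h t (x + h) - f s h t x) / h - gx t x| ≤ C * (s * h)) ∧
    |g t x| ≤ C ∧ |gt t x| ≤ C ∧ |gx t x| ≤ C

lemma abs_mul_sub_mul_le {a b a' b' C D δ : ℝ} (ha : |a - a'| ≤ C * δ) (hb : |b - b'| ≤ D * δ)
    (ha' : |a'| ≤ C) (hb' : |b'| ≤ D) (hδ0 : 0 ≤ δ) (hδ : δ ≤ 1) (hC : 0 ≤ C) (hD : 0 ≤ D) :
    |a * b - a' * b'| ≤ 3 * (C * D) * δ := by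
  have e : a * b - a' * b' = (a - a') * (b - b') + (a - a') * b' + a' * (b - b') := by ring
  rw [e]
  have h1 : |(a - a') * (b - b')| ≤ C * D * δ := by
    rw [abs_mul]
    calc |a - a'| * |b - b'| ≤ (C * δ) * (D * 1) := by
          gcongr
          exact hb.trans (by gcongr)
      _ = C * D * δ := by ring
  have h2 : |(a - a') * b'| ≤ C * D * δ := by
    rw [abs_mul]
    calc |a - a'| * |b'| ≤ (C * δ) * D := by gcongr
      _ = C * D * δ := by ring
  have h3 : |a' * (b - b')| ≤ C * D * δ := by
    rw [abs_mul]
    calc |a'| * |b - b'| ≤ C * (D * δ) := by gcongr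
      _ = C * D * δ := by ring
  calc _ ≤ |(a - a') * (b - b')| + |(a - a') * b'| + |a' * (b - b')| := abs_add_three _ _ _
    _ ≤ _ := by linarith

lemma Approx.add {T : ℝ} {f₁ f₂ : ℝ → ℝ → ℝ → ℝ → ℝ} {g₁ gt₁ gx₁ g₂ gt₂ gx₂ : ℝ → ℝ → ℝ}
    (H₁ : Approx T f₁ g₁ gt₁ gx₁) (H₂ : Approx T f₂ g₂ gt₂ gx₂) :
    Approx T (fun s h t x => f₁ s h t x + f₂ s h t x) (fun t x => g₁ t x + g₂ t x)
      (fun t x => gt₁ t x + gt₂ t x) (fun t x => gx₁ t x + gx₂ t x) := by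
  obtain ⟨C, hC, H₁⟩ := H₁
  obtain ⟨D, hD, H₂⟩ := H₂
  refine ⟨C + D, by positivity, fun s h t x hs hh hsh ht hx => ?_⟩
  obtain ⟨a1, a2, a3, a4, a5, a6, a7⟩ := H₁ s h t x hs hh hsh ht hx
  obtain ⟨b1, b2, b3, b4, b5, b6, b7⟩ := H₂ s h t x hs hh hsh ht hx
  refine ⟨a1.add b1, ?_, ?_, ?_, ?_, ?_, ?_⟩
  · rw [add_sub_add_comm, add_mul]; exact (abs_add_le _ _).trans (add_le_add a2 b2)
  · rw [deriv_fun_add a1 b1, add_sub_add_comm, add_mul]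
    exact (abs_add_le _ _).trans (add_le_add a3 b3)
  · intro hxh
    rw [add_sub_add_comm, add_div, add_sub_add_comm, add_mul]
    exact (abs_add_le _ _).trans (add_le_add (a4 hxh) (b4 hxh))
  · exact (abs_add_le _ _).trans (add_le_add a5 b5)
  · exact (abs_add_le _ _).trans (add_le_add a6 b6)
  · exact (abs_add_le _ _).trans (add_le_add a7 b7)

lemma Approx.mul {T : ℝ} {f₁ f₂ : ℝ → ℝ → ℝ → ℝ → ℝ} {g₁ gt₁ gx₁ g₂ gt₂ gx₂ : ℝ → ℝ → ℝ}
    (H₁ : Approx T f₁ g₁ gt₁ gx₁) (H₂ : Approx T f₂ g₂ gt₂ gx₂) :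
    Approx T (fun s h t x => f₁ s h t x * f₂ s h t x) (fun t x => g₁ t x * g₂ t x)
      (fun t x => gt₁ t x * g₂ t x + g₁ t x * gt₂ t x)
      (fun t x => gx₁ t x * g₂ t x + g₁ t x * gx₂ t x) := by
  obtain ⟨C, hC, H₁⟩ := H₁
  obtain ⟨D, hD, H₂⟩ := H₂
  refine ⟨12 * (C * D), by positivity, fun s h t x hs hh hsh ht hx => ?_⟩
  obtain ⟨a1, a2, a3, a4, a5, a6, a7⟩ := H₁ s h t x hs hh hsh ht hx
  obtain ⟨b1, b2, b3, b4, b5, b6, b7⟩ := H₂ s h t x hs hh hsh ht hx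
  have hδ : 0 ≤ s * h := by positivity
  have hCD : 0 ≤ C * D := by positivity
  have hCDδ : 0 ≤ C * D * (s * h) := by positivity
  have bd : ∀ p q : ℝ, |p| ≤ C → |q| ≤ D → |p * q| ≤ C * D := fun p q hp hq => by
    rw [abs_mul]; gcongr
  refine ⟨a1.mul b1, ?_, ?_, ?_, ?_, ?_, ?_⟩
  · exact (abs_mul_sub_mul_le a2 b2 a5 b5 hδ hsh hC hD).trans (by linarith)
  · rw [deriv_fun_mul a1 b1, add_sub_add_comm]
    refine (abs_add_le _ _).trans ((add_le_add
      (abs_mul_sub_mul_le a3 b2 a6 b5 hδ hsh hC hD)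
      (abs_mul_sub_mul_le a2 b3 a5 b6 hδ hsh hC hD)).trans (by linarith))
  · intro hxh
    have e : (f₁ s h t (x + h) * f₂ s h t (x + h) - f₁ s h t x * f₂ s h t x) / h
        - (gx₁ t x * g₂ t x + g₁ t x * gx₂ t x)
        = ((f₁ s h t (x + h) - f₁ s h t x) / h * f₂ s h t (x + h) - gx₁ t x * g₂ t x)
          + (f₁ s h t x * ((f₂ s h t (x + h) - f₂ s h t x) / h) - g₁ t x * gx₂ t x) := by
      field_simp; ring
    have hh' : h ≤ s * h := by nlinarith
    -- The discrete Leibniz rule evaluates `f₂` at x + h. Moving back to x costs h times a bounded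
    -- difference quotient, and h ≤ sh.
    have b8 : |f₂ s h t (x + h) - g₂ t x| ≤ 3 * D * (s * h) := by
      have e2 : f₂ s h t (x + h) - g₂ t x
        = h * ((f₂ s h t (x + h) - f₂ s h t x) / h - gx₂ t x) + h * gx₂ t x
          + (f₂ s h t x - g₂ t x) := by field_simp; ring
      rw [e2]
      refine (abs_add_three _ _ _).trans ?_
      rw [abs_mul, abs_mul, abs_of_pos hh]
      have i1 : h * |(f₂ s h t (x + h) - f₂ s h t x) / h - gx₂ t x| ≤ 1 * (D * (s * h)) := by
        gcongr
        · linarith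
        · exact b4 hxh
      have i2 : h * |gx₂ t x| ≤ (s * h) * D := by gcongr
      linarith
    rw [e]
    refine (abs_add_le _ _).trans ((add_le_add
      (abs_mul_sub_mul_le (D := 3 * D) (a4 hxh) b8 a7 (b5.trans (by linarith)) hδ hsh hC
        (by positivity))
      (abs_mul_sub_mul_le a2 (b4 hxh) a5 b7 hδ hsh hC hD)).trans (by linarith))
  · exact (bd _ _ a5 b5).trans (by linarith)
  · refine (abs_add_le _ _).trans ?_
    linarith [bd _ _ a6 b5, bd _ _ a5 b6]
  · refine (abs_add_le _ _).trans ?_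
    linarith [bd _ _ a7 b5, bd _ _ a5 b7]

lemma Approx.const (T c : ℝ) :
    Approx T (fun _ _ _ _ => c) (fun _ _ => c) (fun _ _ => 0) (fun _ _ => 0) := by
  refine ⟨|c|, abs_nonneg c, fun s h t x hs hh hsh ht hx => ?_⟩
  have : 0 ≤ |c| * (s * h) := by positivity
  simp [this]

lemma Approx.congr {T : ℝ} {f f' : ℝ → ℝ → ℝ → ℝ → ℝ} {g gt gx g' gt' gx' : ℝ → ℝ → ℝ}
    (H : Approx T f g gt gx) (hf : ∀ s h t x, f' s h t x = f s h t x)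
    (hg : ∀ t x, g' t x = g t x) (hgt : ∀ t x, gt' t x = gt t x) (hgx : ∀ t x, gx' t x = gx t x) :
    Approx T f' g' gt' gx' := by
  obtain rfl : f' = f := by funext s h t x; exact hf s h t x
  obtain rfl : g' = g := by funext t x; exact hg t x
  obtain rfl : gt' = gt := by funext t x; exact hgt t x
  obtain rfl : gx' = gx := by funext t x; exact hgx t x
  exact H

lemma Approx.const_mul {T : ℝ} {f : ℝ → ℝ → ℝ → ℝ → ℝ} {g gt gx : ℝ → ℝ → ℝ} (c : ℝ)
    (H : Approx T f g gt gx) :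
    Approx T (fun s h t x => c * f s h t x) (fun t x => c * g t x)
      (fun t x => c * gt t x) (fun t x => c * gx t x) :=
  ((Approx.const T c).mul H).congr (fun _ _ _ _ => rfl) (fun _ _ => rfl)
    (fun _ _ => by ring) (fun _ _ => by ring)

lemma Approx.sub {T : ℝ} {f₁ f₂ : ℝ → ℝ → ℝ → ℝ → ℝ} {g₁ gt₁ gx₁ g₂ gt₂ gx₂ : ℝ → ℝ → ℝ}
    (H₁ : Approx T f₁ g₁ gt₁ gx₁) (H₂ : Approx T f₂ g₂ gt₂ gx₂) :
    Approx T (fun s h t x => f₁ s h t x - f₂ s h t x) (fun t x => g₁ t x - g₂ t x)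
      (fun t x => gt₁ t x - gt₂ t x) (fun t x => gx₁ t x - gx₂ t x) :=
  (H₁.add (H₂.const_mul (-1))).congr (fun _ _ _ _ => by ring) (fun _ _ => by ring)
    (fun _ _ => by ring) (fun _ _ => by ring)

/-- Made for `A0`, whose prefactors s²h² and sh² are at most sh. The factor k does not depend on (t,
x), so it passes through both derivatives and all three limits vanish. -/
lemma Approx.mul_small {T : ℝ} {f : ℝ → ℝ → ℝ → ℝ → ℝ} {g gt gx : ℝ → ℝ → ℝ} {k : ℝ → ℝ → ℝ}
    (H : Approx T f g gt gx)
    (hk : ∀ s h, 1 ≤ s → 0 < h → s * h ≤ 1 → |k s h| ≤ s * h) :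
    Approx T (fun s h t x => k s h * f s h t x) (fun _ _ => 0) (fun _ _ => 0) (fun _ _ => 0) := by
  obtain ⟨C, hC, H⟩ := H
  refine ⟨2 * C, by positivity, fun s h t x hs hh hsh ht hx => ?_⟩
  obtain ⟨a1, a2, a3, a4, a5, a6, a7⟩ := H s h t x hs hh hsh ht hx
  have hk := hk s h hs hh hsh
  have hδ : 0 ≤ s * h := by positivity
  have key : ∀ p q : ℝ, |p - q| ≤ C * (s * h) → |q| ≤ C → |k s h * p - 0| ≤ 2 * C * (s * h) := by
    intro p q hpq hq
    have hp : |p| ≤ 2 * C := by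
      have : |p| ≤ |p - q| + |q| := by simpa using abs_add_le (p - q) q
      nlinarith
    rw [sub_zero, abs_mul]
    calc |k s h| * |p| ≤ (s * h) * (2 * C) := by gcongr
      _ = _ := by ring
  refine ⟨a1.const_mul _, key _ _ a2 a5, ?_, ?_, ?_, ?_, ?_⟩
  · rw [deriv_const_mul _ a1]; exact key _ _ a3 a6
  · intro hxh
    rw [← mul_sub, mul_div_assoc]; exact key _ _ (a4 hxh) a7
  all_goals simpa using hC

/-! ### Smooth functions of (t, x) and their uniform bounds. -/

open scoped ContDiff in
/-- Joint smoothness of a function of `(t, x)`. -/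
def Smooth₂ (g : ℝ → ℝ → ℝ) : Prop := ContDiff ℝ ∞ (fun p : ℝ × ℝ => g p.1 p.2)

lemma Smooth₂.hasDerivAt_fst {g : ℝ → ℝ → ℝ} (hg : Smooth₂ g) (t x : ℝ) :
    HasDerivAt (fun τ => g τ x) (fderiv ℝ (fun p : ℝ × ℝ => g p.1 p.2) (t, x) (1, 0)) t := by
  have h1 := (hg.differentiable (by simp) (t, x)).hasFDerivAt
  have h2 : HasDerivAt (fun τ : ℝ => (τ, x)) ((1 : ℝ), (0 : ℝ)) t :=
    (hasDerivAt_id t).prodMk (hasDerivAt_const t x)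
  exact h1.comp_hasDerivAt t h2

lemma Smooth₂.hasDerivAt_snd {g : ℝ → ℝ → ℝ} (hg : Smooth₂ g) (t x : ℝ) :
    HasDerivAt (fun y => g t y) (fderiv ℝ (fun p : ℝ × ℝ => g p.1 p.2) (t, x) (0, 1)) x := by
  have h1 := (hg.differentiable (by simp) (t, x)).hasFDerivAt
  have h2 : HasDerivAt (fun y : ℝ => (t, y)) ((0 : ℝ), (1 : ℝ)) x :=
    (hasDerivAt_const x t).prodMk (hasDerivAt_id x)
  exact h1.comp_hasDerivAt x h2

lemma Smooth₂.hasDerivAt_pt {g : ℝ → ℝ → ℝ} (hg : Smooth₂ g) (t x : ℝ) :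
    HasDerivAt (fun τ => g τ x) (pt g t x) t :=
  (hg.hasDerivAt_fst t x).differentiableAt.hasDerivAt

lemma Smooth₂.hasDerivAt_px {g : ℝ → ℝ → ℝ} (hg : Smooth₂ g) (t x : ℝ) :
    HasDerivAt (fun y => g t y) (px g t x) x :=
  (hg.hasDerivAt_snd t x).differentiableAt.hasDerivAt

lemma Smooth₂.pt {g : ℝ → ℝ → ℝ} (hg : Smooth₂ g) : Smooth₂ (pt g) := by
  have e : (fun p : ℝ × ℝ => DiscreteCarleman.pt g p.1 p.2)
      = fun p : ℝ × ℝ => fderiv ℝ (fun p : ℝ × ℝ => g p.1 p.2) p (1, 0) := by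
    funext p; exact (hg.hasDerivAt_fst p.1 p.2).deriv
  unfold Smooth₂
  rw [e]
  exact (ContDiff.fderiv_right hg (by simp)).clm_apply contDiff_const

lemma Smooth₂.px {g : ℝ → ℝ → ℝ} (hg : Smooth₂ g) : Smooth₂ (px g) := by
  have e : (fun p : ℝ × ℝ => DiscreteCarleman.px g p.1 p.2)
      = fun p : ℝ × ℝ => fderiv ℝ (fun p : ℝ × ℝ => g p.1 p.2) p (0, 1) := by
    funext p; exact (hg.hasDerivAt_snd p.1 p.2).deriv
  unfold Smooth₂
  rw [e]
  exact (ContDiff.fderiv_right hg (by simp)).clm_apply contDiff_const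

lemma Smooth₂.continuous {g : ℝ → ℝ → ℝ} (hg : Smooth₂ g) :
    Continuous (fun p : ℝ × ℝ => g p.1 p.2) := ContDiff.continuous hg

lemma Smooth₂.bounded {g : ℝ → ℝ → ℝ} (hg : Smooth₂ g) (a b c d : ℝ) :
    ∃ B, 0 ≤ B ∧ ∀ t ∈ Icc a b, ∀ x ∈ Icc c d, |g t x| ≤ B := by
  obtain ⟨B, hB⟩ := (isCompact_Icc.prod isCompact_Icc : IsCompact (Icc a b ×ˢ Icc c d)).exists_bound_of_continuousOn
    hg.continuous.continuousOn
  exact ⟨max B 0, le_max_right _ _, fun t ht x hx => (hB (t, x) ⟨ht, hx⟩).trans (le_max_left _ _)⟩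

lemma abs_sub_le_of_abs_deriv_le {f f' : ℝ → ℝ} {B x y : ℝ}
    (hf : ∀ z ∈ uIcc x y, HasDerivAt f (f' z) z) (hB : ∀ z ∈ uIcc x y, |f' z| ≤ B) :
    |f y - f x| ≤ B * |y - x| :=
  (convex_uIcc x y).norm_image_sub_le_of_norm_hasDerivWithin_le
    (fun z hz => (hf z hz).hasDerivWithinAt) hB left_mem_uIcc right_mem_uIcc

lemma Smooth₂.lipschitz_snd {g : ℝ → ℝ → ℝ} (hg : Smooth₂ g) (a b c d : ℝ) :
    ∃ B, 0 ≤ B ∧ ∀ t ∈ Icc a b, ∀ x ∈ Icc c d, ∀ y ∈ Icc c d,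
      |g t y - g t x| ≤ B * |y - x| := by
  obtain ⟨B, hB0, hB⟩ := hg.px.bounded a b c d
  refine ⟨B, hB0, fun t ht x hx y hy => abs_sub_le_of_abs_deriv_le
    (fun z _ => hg.hasDerivAt_px t z) (fun z hz => hB t ht z ?_)⟩
  exact uIcc_subset_Icc hx hy hz

/-- All bounds on a smooth function that enter the error estimates. -/
lemma Smooth₂.bounds {g : ℝ → ℝ → ℝ} (hg : Smooth₂ g) (T : ℝ) :
    ∃ B, 0 ≤ B ∧ ∀ t ∈ Icc (-T) T, ∀ x ∈ Icc (-1 : ℝ) 2,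
      (|g t x| ≤ B ∧ |DiscreteCarleman.pt g t x| ≤ B ∧ |DiscreteCarleman.px g t x| ≤ B) ∧
      ∀ y ∈ Icc (-1 : ℝ) 2, |g t y - g t x| ≤ B * |y - x| ∧
        |DiscreteCarleman.pt g t y - DiscreteCarleman.pt g t x| ≤ B * |y - x| ∧
        |DiscreteCarleman.px g t y - DiscreteCarleman.px g t x| ≤ B * |y - x| := by
  obtain ⟨B1, h1, k1⟩ := hg.bounded (-T) T (-1) 2
  obtain ⟨B2, h2, k2⟩ := hg.pt.bounded (-T) T (-1) 2
  obtain ⟨B3, h3, k3⟩ := hg.px.bounded (-T) T (-1) 2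
  obtain ⟨B4, h4, k4⟩ := hg.lipschitz_snd (-T) T (-1) 2
  obtain ⟨B5, h5, k5⟩ := hg.pt.lipschitz_snd (-T) T (-1) 2
  obtain ⟨B6, h6, k6⟩ := hg.px.lipschitz_snd (-T) T (-1) 2
  refine ⟨B1 + B2 + B3 + B4 + B5 + B6, by positivity, fun t ht x hx =>
    ⟨⟨?_, ?_, ?_⟩, fun y hy => ⟨?_, ?_, ?_⟩⟩⟩
  · linarith [k1 t ht x hx]
  · linarith [k2 t ht x hx]
  · linarith [k3 t ht x hx]
  · refine (k4 t ht x hx y hy).trans ?_; gcongr; linarith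
  · refine (k5 t ht x hx y hy).trans ?_; gcongr; linarith
  · refine (k6 t ht x hx y hy).trans ?_; gcongr; linarith

lemma Smooth₂.abs_dPlus_sub_px_le {g : ℝ → ℝ → ℝ} (hg : Smooth₂ g) {B t x h : ℝ} (hh : 0 < h)
    (hB : ∀ y ∈ Icc x (x + h), |DiscreteCarleman.px g t y - DiscreteCarleman.px g t x| ≤ B * |y - x|)
    (hB0 : 0 ≤ B) :
    |(g t (x + h) - g t x) / h - DiscreteCarleman.px g t x| ≤ B * h := by
  have := abs_sub_le_of_abs_deriv_le (x := x) (y := x + h) (B := B * h)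
    (f := fun y => g t y - DiscreteCarleman.px g t x * y)
    (f' := fun y => DiscreteCarleman.px g t y - DiscreteCarleman.px g t x * 1)
    (fun z _ => (hg.hasDerivAt_px t z).sub ((hasDerivAt_id z).const_mul _)) ?_
  · have e : (g t (x + h) - g t x) / h - DiscreteCarleman.px g t x
      = ((g t (x + h) - DiscreteCarleman.px g t x * (x + h))
        - (g t x - DiscreteCarleman.px g t x * x)) / h := by field_simp; ring
    rw [e, abs_div, abs_of_pos hh, div_le_iff₀ hh]
    simpa [abs_of_pos hh] using this
  · intro z hz
    rw [uIcc_of_le (by linarith)] at hz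
    rw [mul_one]
    refine (hB z hz).trans ?_
    rw [abs_of_nonneg (by linarith [hz.1])]
    gcongr
    linarith [hz.2]

lemma Smooth₂.approx {g : ℝ → ℝ → ℝ} (hg : Smooth₂ g) (T : ℝ) :
    Approx T (fun _ _ t x => g t x) g (DiscreteCarleman.pt g) (DiscreteCarleman.px g) := by
  obtain ⟨B, hB, H⟩ := hg.bounds T
  refine ⟨B, hB, fun s h t x hs hh hsh ht hx => ?_⟩
  have hx' : x ∈ Icc (-1 : ℝ) 2 := ⟨by linarith [hx.1], by linarith [hx.2]⟩
  have hh' : h ≤ s * h := by nlinarith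
  have h0 : 0 ≤ B * (s * h) := by positivity
  obtain ⟨⟨b1, b2, b3⟩, H⟩ := H t ht x hx'
  refine ⟨(hg.hasDerivAt_pt t x).differentiableAt, by simpa using h0, ?_, fun hxh => ?_, b1, b2, b3⟩
  · have : deriv (fun τ => g τ x) t = DiscreteCarleman.pt g t x := rfl
    simpa [this] using h0
  · refine (hg.abs_dPlus_sub_px_le hh (fun y hy => (H y ⟨?_, ?_⟩).2.2) hB).trans (by gcongr)
    · linarith [hy.1, hx.1]
    · linarith [hy.2]

/-! ### Averages of smooth functions against the weight ratio ρ(t, x+σh)/ρ(t, x). -/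

lemma abs_exp_sub_one_le_of_abs_le {y B : ℝ} (hy : |y| ≤ B) :
    |Real.exp y - 1| ≤ |y| * Real.exp B := by
  have h1 := Real.add_one_le_exp y
  have h2 := Real.add_one_le_exp (-y)
  have h3 : Real.exp (-y) * Real.exp y = 1 := by rw [← Real.exp_add]; simp
  have h4 : Real.exp y ≤ Real.exp B := Real.exp_le_exp.2 ((le_abs_self y).trans hy)
  have h5 : 1 ≤ Real.exp B := Real.one_le_exp ((abs_nonneg y).trans hy)
  have h6 := Real.exp_pos y
  have h7 : Real.exp y - 1 ≤ y * Real.exp y := by nlinarith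
  rw [abs_le]
  constructor
  · have : -|y| ≤ y := neg_abs_le y
    nlinarith [abs_nonneg y]
  · refine h7.trans ?_
    calc y * Real.exp y ≤ |y| * Real.exp y := by gcongr; exact le_abs_self y
      _ ≤ _ := by gcongr

/-- The integrand of the averaged coefficients, at distance `y = x + σ h` from `x`. -/
noncomputable def shiftWeight (g φ : ℝ → ℝ → ℝ) (s t x y : ℝ) : ℝ :=
  g t y * Real.exp (-(s * (φ t y - φ t x)))

lemma exp_weight_error {B s h Δ : ℝ} (hB : 0 ≤ B) (hs : 1 ≤ s) (hsh : s * h ≤ 1)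
    (hΔ : |Δ| ≤ B * h) :
    |Real.exp (-(s * Δ)) - 1| ≤ B * Real.exp B * (s * h) ∧ Real.exp (-(s * Δ)) ≤ Real.exp B := by
  have h1 : |-(s * Δ)| ≤ B * (s * h) := by
    rw [abs_neg, abs_mul, abs_of_pos (by linarith : 0 < s)]
    calc s * |Δ| ≤ s * (B * h) := by gcongr
      _ = _ := by ring
  have h2 : |-(s * Δ)| ≤ B := h1.trans (by nlinarith)
  refine ⟨(abs_exp_sub_one_le_of_abs_le h2).trans ?_,
    Real.exp_le_exp.2 ((le_abs_self _).trans h2)⟩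
  calc |-(s * Δ)| * Real.exp B ≤ B * (s * h) * Real.exp B := by gcongr
    _ = _ := by ring

lemma weight_value_error {B s h g₁ g₀ Δ : ℝ} (hB : 0 ≤ B) (hs : 1 ≤ s) (hh : 0 < h)
    (hsh : s * h ≤ 1) (hg₁ : |g₁| ≤ B) (hg : |g₁ - g₀| ≤ B * h) (hΔ : |Δ| ≤ B * h) :
    |g₁ * Real.exp (-(s * Δ)) - g₀| ≤ (B * (B * Real.exp B) + B) * (s * h) := by
  obtain ⟨e1, e2⟩ := exp_weight_error hB hs hsh hΔ
  have hh' : h ≤ s * h := by nlinarith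
  have e : g₁ * Real.exp (-(s * Δ)) - g₀
    = g₁ * (Real.exp (-(s * Δ)) - 1) + (g₁ - g₀) := by ring
  rw [e]
  refine (abs_add_le _ _).trans ?_
  rw [abs_mul]
  have i1 : |g₁| * |Real.exp (-(s * Δ)) - 1| ≤ B * (B * Real.exp B * (s * h)) := by gcongr
  have i2 : |g₁ - g₀| ≤ B * (s * h) := hg.trans (by gcongr)
  linarith

/-- Differentiating the exponential produces a factor s, but multiplied by Δd, the increment of a
derivative of φ over a distance at most h. The extra term is therefore O(sh) and not O(s). -/
lemma weight_deriv_error {B s h g₁ gd₁ gd₀ Δ Δd : ℝ} (hB : 0 ≤ B) (hs : 1 ≤ s) (hh : 0 < h)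
    (hsh : s * h ≤ 1) (hg₁ : |g₁| ≤ B) (hgd₁ : |gd₁| ≤ B) (hgd : |gd₁ - gd₀| ≤ B * h)
    (hΔ : |Δ| ≤ B * h) (hΔd : |Δd| ≤ B * h) :
    |(gd₁ - s * g₁ * Δd) * Real.exp (-(s * Δ)) - gd₀|
      ≤ (B * (B * Real.exp B) + B + B * B * Real.exp B) * (s * h) := by
  have i0 := weight_value_error hB hs hh hsh hgd₁ hgd hΔ
  obtain ⟨e1, e2⟩ := exp_weight_error hB hs hsh hΔ
  have e : (gd₁ - s * g₁ * Δd) * Real.exp (-(s * Δ)) - gd₀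
    = (gd₁ * Real.exp (-(s * Δ)) - gd₀) - s * (g₁ * Δd * Real.exp (-(s * Δ))) := by ring
  rw [e]
  refine (abs_sub _ _).trans ?_
  have i1 : |s * (g₁ * Δd * Real.exp (-(s * Δ)))| ≤ s * (B * (B * h) * Real.exp B) := by
    rw [abs_mul, abs_mul, abs_mul, abs_of_pos (by linarith : 0 < s), abs_of_pos (Real.exp_pos _)]
    gcongr
  linarith

section kernel

variable {g φ : ℝ → ℝ → ℝ}

lemma hasDerivAt_shiftWeight_fst (hg : Smooth₂ g) (hφ : Smooth₂ φ) (s t x y : ℝ) :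
    HasDerivAt (fun τ => shiftWeight g φ s τ x y)
      ((pt g t y - s * g t y * (pt φ t y - pt φ t x)) *
        Real.exp (-(s * (φ t y - φ t x)))) t := by
  have h := (hg.hasDerivAt_pt t y).mul
    (((((hφ.hasDerivAt_pt t y).sub (hφ.hasDerivAt_pt t x)).const_mul s).neg).exp)
  refine h.congr_deriv ?_
  simp only [Pi.sub_apply, Pi.neg_apply]
  ring

lemma hasDerivAt_shiftWeight_snd (hg : Smooth₂ g) (hφ : Smooth₂ φ) (s t x k : ℝ) :
    HasDerivAt (fun x => shiftWeight g φ s t x (x + k))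
      ((px g t (x + k) - s * g t (x + k) * (px φ t (x + k) - px φ t x)) *
        Real.exp (-(s * (φ t (x + k) - φ t x)))) x := by
  have h1 : HasDerivAt (fun x => g t (x + k)) (px g t (x + k)) x :=
    (hg.hasDerivAt_px t (x + k)).comp_add_const x k
  have h2 : HasDerivAt (fun x => φ t (x + k)) (px φ t (x + k)) x :=
    (hφ.hasDerivAt_px t (x + k)).comp_add_const x k
  have h := h1.mul ((((h2.sub (hφ.hasDerivAt_px t x)).const_mul s).neg).exp)
  refine h.congr_deriv ?_
  simp only [Pi.sub_apply, Pi.neg_apply]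
  ring

lemma continuous_shiftWeight (hg : Smooth₂ g) (hφ : Smooth₂ φ) (s x h : ℝ) :
    Continuous (fun p : ℝ × ℝ => shiftWeight g φ s p.1 x (x + p.2 * h)) := by
  have c1 : Continuous (fun p : ℝ × ℝ => g p.1 (x + p.2 * h)) :=
    hg.continuous.comp (by fun_prop : Continuous fun p : ℝ × ℝ => (p.1, x + p.2 * h))
  have c2 : Continuous (fun p : ℝ × ℝ => φ p.1 (x + p.2 * h)) :=
    hφ.continuous.comp (by fun_prop : Continuous fun p : ℝ × ℝ => (p.1, x + p.2 * h))
  have c3 : Continuous (fun p : ℝ × ℝ => φ p.1 x) :=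
    hφ.continuous.comp (by fun_prop : Continuous fun p : ℝ × ℝ => (p.1, x))
  exact c1.mul (Real.continuous_exp.comp ((continuous_const.mul (c2.sub c3)).neg))

lemma continuous_deriv_shiftWeight (hg : Smooth₂ g) (hφ : Smooth₂ φ) (s x h : ℝ) :
    Continuous (fun p : ℝ × ℝ => (pt g p.1 (x + p.2 * h) - s * g p.1 (x + p.2 * h) *
      (pt φ p.1 (x + p.2 * h) - pt φ p.1 x)) *
        Real.exp (-(s * (φ p.1 (x + p.2 * h) - φ p.1 x)))) := by
  have hc : Continuous fun p : ℝ × ℝ => (p.1, x + p.2 * h) := by fun_prop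
  have hc' : Continuous fun p : ℝ × ℝ => (p.1, x) := by fun_prop
  have c1 := hg.continuous.comp hc
  have c2 := hφ.continuous.comp hc
  have c3 := hφ.continuous.comp hc'
  have c4 := hg.pt.continuous.comp hc
  have c5 := hφ.pt.continuous.comp hc
  have c6 := hφ.pt.continuous.comp hc'
  exact (c4.sub ((continuous_const.mul c1).mul (c5.sub c6))).mul
    (Real.continuous_exp.comp ((continuous_const.mul (c2.sub c3)).neg))

end kernel

/-- The constant is uniform in σ, so the estimates survive averaging. As h ≤ 1, all points x + σh
lie in [-1, 2], where the bounds on g and φ are taken. -/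
lemma shiftWeight_estimates {g φ : ℝ → ℝ → ℝ} (hg : Smooth₂ g) (hφ : Smooth₂ φ) (T : ℝ) :
    ∃ C, 0 ≤ C ∧ ∀ s h t σ, 1 ≤ s → 0 < h → s * h ≤ 1 → t ∈ Icc (-T) T → σ ∈ Icc (-1 : ℝ) 1 →
      ∀ x ∈ Icc (0 : ℝ) 1,
      |shiftWeight g φ s t x (x + σ * h) - g t x| ≤ C * (s * h) ∧
      |(pt g t (x + σ * h) - s * g t (x + σ * h) * (pt φ t (x + σ * h) - pt φ t x)) *
        Real.exp (-(s * (φ t (x + σ * h) - φ t x))) - pt g t x| ≤ C * (s * h) ∧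
      (x + h ≤ 1 → |(shiftWeight g φ s t (x + h) (x + h + σ * h)
        - shiftWeight g φ s t x (x + σ * h)) / h - px g t x| ≤ C * (s * h)) ∧
      |g t x| ≤ C ∧ |pt g t x| ≤ C ∧ |px g t x| ≤ C := by
  obtain ⟨B₁, hB₁, H₁⟩ := hg.bounds T
  obtain ⟨B₂, hB₂, H₂⟩ := hφ.bounds T
  set B := B₁ + B₂
  have hB : 0 ≤ B := by positivity
  set C₁ := B * (B * Real.exp B) + B + B * B * Real.exp B
  have hC₁ : 0 ≤ C₁ := by positivity
  have hBC : B ≤ C₁ := by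
    have : 0 ≤ B * (B * Real.exp B) + B * B * Real.exp B := by positivity
    simp only [C₁]; linarith
  refine ⟨C₁ + B, by positivity, fun s h t σ hs hh hsh ht hσ => ?_⟩
  have hh1 : h ≤ 1 := by nlinarith
  have hh' : h ≤ s * h := by nlinarith
  have hδ : 0 ≤ s * h := by positivity
  have hBδ : 0 ≤ B * (s * h) := by positivity
  have hσh : |σ * h| ≤ h := by
    rw [abs_mul, abs_of_pos hh]; nlinarith [abs_le.2 hσ]
  have hσh' := abs_le.1 hσh
  have base : ∀ x ∈ Icc (0 : ℝ) 1, x ∈ Icc (-1 : ℝ) 2 ∧ x + σ * h ∈ Icc (-1 : ℝ) 2 := by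
    intro x hx
    exact ⟨⟨by linarith [hx.1], by linarith [hx.2]⟩,
      ⟨by linarith [hx.1, hσh'.1], by linarith [hx.2, hσh'.2]⟩⟩
  have lip : ∀ {C : ℝ} {x p q : ℝ}, 0 ≤ C → C ≤ B → |p - q| ≤ C * |x + σ * h - x| →
      |p - q| ≤ B * h := by
    intro C x p q hC hCB hpq
    refine hpq.trans ?_
    rw [add_sub_cancel_left]
    gcongr
  have hb1 : B₁ ≤ B := by linarith
  have hb2 : B₂ ≤ B := by linarith
  have dx : ∀ x ∈ Icc (0 : ℝ) 1,
      |(px g t (x + σ * h) - s * g t (x + σ * h) * (px φ t (x + σ * h) - px φ t x)) *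
        Real.exp (-(s * (φ t (x + σ * h) - φ t x))) - px g t x| ≤ C₁ * (s * h) := by
    intro x hx
    obtain ⟨hx1, hx2⟩ := base x hx
    obtain ⟨⟨a1, a2, a3⟩, -⟩ := H₁ t ht _ hx2
    obtain ⟨b1, b2, b3⟩ := (H₁ t ht _ hx1).2 _ hx2
    obtain ⟨c1, c2, c3⟩ := (H₂ t ht _ hx1).2 _ hx2
    exact weight_deriv_error hB hs hh hsh (a1.trans hb1) (a3.trans hb1) (lip hB₁ hb1 b3)
      (lip hB₂ hb2 c1) (lip hB₂ hb2 c3)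
  intro x hx
  obtain ⟨hx1, hx2⟩ := base x hx
  obtain ⟨⟨a1, a2, a3⟩, -⟩ := H₁ t ht _ hx2
  obtain ⟨⟨a1', a2', a3'⟩, b⟩ := H₁ t ht _ hx1
  obtain ⟨b1, b2, b3⟩ := b _ hx2
  obtain ⟨c1, c2, c3⟩ := (H₂ t ht _ hx1).2 _ hx2
  refine ⟨?_, ?_, fun hxh => ?_, by linarith, by linarith, by linarith⟩
  · refine (weight_value_error hB hs hh hsh (a1.trans hb1) (lip hB₁ hb1 b1)
      (lip hB₂ hb2 c1)).trans ?_
    have : 0 ≤ B * B * Real.exp B := by positivity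
    refine mul_le_mul_of_nonneg_right ?_ hδ
    simp only [C₁]; linarith
  · refine (weight_deriv_error hB hs hh hsh (a1.trans hb1) (a2.trans hb1) (lip hB₁ hb1 b2)
      (lip hB₂ hb2 c1) (lip hB₂ hb2 c2)).trans
      (mul_le_mul_of_nonneg_right (by linarith) hδ)
  -- The difference quotient is not estimated from the values, which would lose a factor 1/h. The
  -- mean value inequality is applied to shifted weight minus g, whose x-derivative is already O(sh)
  -- by `dx`.
  · have m := abs_sub_le_of_abs_deriv_le (x := x) (y := x + h) (B := C₁ * (s * h))
      (fun z _ => (hasDerivAt_shiftWeight_snd hg hφ s t z (σ * h)).sub (hg.hasDerivAt_px t z))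
      (fun z hz => dx z (by
        rw [uIcc_of_le (by linarith)] at hz
        exact ⟨hx.1.trans hz.1, hz.2.trans hxh⟩))
    rw [add_sub_cancel_left, abs_of_pos hh] at m
    have m2 : |(g t (x + h) - g t x) / h - px g t x| ≤ B * h :=
      hg.abs_dPlus_sub_px_le hh (fun y hy => ((H₁ t ht _ hx1).2 y
        ⟨by linarith [hy.1, hx.1], by linarith [hy.2]⟩).2.2.trans (by gcongr)) hB
    have e : (shiftWeight g φ s t (x + h) (x + h + σ * h)
        - shiftWeight g φ s t x (x + σ * h)) / h - px g t x
        = ((shiftWeight g φ s t (x + h) (x + h + σ * h) - g t (x + h))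
          - (shiftWeight g φ s t x (x + σ * h) - g t x)) / h
          + ((g t (x + h) - g t x) / h - px g t x) := by ring
    rw [e]
    refine (abs_add_le _ _).trans ?_
    rw [abs_div, abs_of_pos hh]
    have : |(shiftWeight g φ s t (x + h) (x + h + σ * h) - g t (x + h))
          - (shiftWeight g φ s t x (x + σ * h) - g t x)| / h ≤ C₁ * (s * h) := by
      rw [div_le_iff₀ hh]; exact m
    have : B * h ≤ B * (s * h) := by gcongr
    linarith

/-- The weighted average of `g` with kernel `κ` over the mesh cell around `x`. -/
noncomputable def kernelAvg (κ : ℝ → ℝ) (g φ : ℝ → ℝ → ℝ) (s h t x : ℝ) : ℝ :=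
  ∫ σ in (-1 : ℝ)..1, κ σ * shiftWeight g φ s t x (x + σ * h)

/-- A probability density on [-1, 1] preserves a uniform bound on the distance to a constant. Both
kernels, 1/2 and 1 - |σ|, are of this kind. -/
lemma abs_integral_kernel_sub_le {κ f : ℝ → ℝ} (hκ : Continuous κ)
    (hκ0 : ∀ σ ∈ Icc (-1 : ℝ) 1, 0 ≤ κ σ) (hκ1 : ∫ σ in (-1 : ℝ)..1, κ σ = 1)
    (hf : Continuous f) {c E : ℝ} (h : ∀ σ ∈ Icc (-1 : ℝ) 1, |f σ - c| ≤ E) :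
    |(∫ σ in (-1 : ℝ)..1, κ σ * f σ) - c| ≤ E := by
  have e : (∫ σ in (-1 : ℝ)..1, κ σ * f σ) - c = ∫ σ in (-1 : ℝ)..1, κ σ * (f σ - c) := by
    simp_rw [mul_sub]
    have i1 : IntervalIntegrable (fun σ => κ σ * f σ) volume (-1) 1 :=
      (hκ.mul hf).intervalIntegrable _ _
    have i2 : IntervalIntegrable (fun σ => κ σ * c) volume (-1) 1 :=
      (hκ.mul continuous_const).intervalIntegrable _ _
    rw [intervalIntegral.integral_sub i1 i2, intervalIntegral.integral_mul_const, hκ1, one_mul]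
  rw [e]
  calc |∫ σ in (-1 : ℝ)..1, κ σ * (f σ - c)|
      ≤ ∫ σ in (-1 : ℝ)..1, |κ σ * (f σ - c)| :=
        intervalIntegral.abs_integral_le_integral_abs (by norm_num)
    _ ≤ ∫ σ in (-1 : ℝ)..1, κ σ * E := by
        apply intervalIntegral.integral_mono_on (by norm_num)
        · exact ((hκ.mul (hf.sub continuous_const)).abs).intervalIntegrable _ _
        · exact (hκ.mul continuous_const).intervalIntegrable _ _
        · intro σ hσ
          rw [abs_mul, abs_of_nonneg (hκ0 σ hσ)]
          exact mul_le_mul_of_nonneg_left (h σ hσ) (hκ0 σ hσ)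
    _ = E := by rw [intervalIntegral.integral_mul_const, hκ1, one_mul]

lemma hasDerivAt_kernelAvg {κ : ℝ → ℝ} (hκ : Continuous κ) {g φ : ℝ → ℝ → ℝ} (hg : Smooth₂ g)
    (hφ : Smooth₂ φ) (s h t x : ℝ) :
    HasDerivAt (fun τ => kernelAvg κ g φ s h τ x)
      (∫ σ in (-1 : ℝ)..1, κ σ * ((pt g t (x + σ * h) - s * g t (x + σ * h) *
        (pt φ t (x + σ * h) - pt φ t x)) * Real.exp (-(s * (φ t (x + σ * h) - φ t x))))) t := by
  have hc := continuous_shiftWeight hg hφ s x h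
  have hc' := continuous_deriv_shiftWeight hg hφ s x h
  have hF : ∀ τ, Continuous fun σ => κ σ * shiftWeight g φ s τ x (x + σ * h) := fun τ =>
    hκ.mul (hc.comp (by fun_prop : Continuous fun σ : ℝ => (τ, σ)))
  have hF'2 := (hκ.comp continuous_snd).mul hc'
  -- Joint continuity in (τ, σ) on a compact set supplies a constant dominating function.
  obtain ⟨K, hK⟩ := (isCompact_Icc.prod isCompact_Icc :
    IsCompact (Icc (t - 1) (t + 1) ×ˢ Icc (-1 : ℝ) 1)).exists_bound_of_continuousOn
      hF'2.continuousOn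
  refine (intervalIntegral.hasDerivAt_integral_of_dominated_loc_of_deriv_le
    (F := fun τ σ => κ σ * shiftWeight g φ s τ x (x + σ * h))
    (F' := fun τ σ => κ σ * ((pt g τ (x + σ * h) - s * g τ (x + σ * h) *
        (pt φ τ (x + σ * h) - pt φ τ x)) * Real.exp (-(s * (φ τ (x + σ * h) - φ τ x)))))
    (bound := fun _ => K) (s := Icc (t - 1) (t + 1)) (Icc_mem_nhds (by linarith) (by linarith))
    (Filter.Eventually.of_forall fun τ => (hF τ).aestronglyMeasurable)
    ((hF t).intervalIntegrable _ _) ?_ ?_ (by simp) ?_).2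
  · exact (hF'2.comp (by fun_prop : Continuous fun σ : ℝ => (t, σ))).aestronglyMeasurable
  · refine Filter.Eventually.of_forall fun σ hσ τ hτ => ?_
    rw [uIoc_of_le (by norm_num)] at hσ
    exact hK (τ, σ) ⟨hτ, hσ.1.le, hσ.2⟩
  · exact Filter.Eventually.of_forall fun σ _ τ _ =>
      (hasDerivAt_shiftWeight_fst hg hφ s τ x (x + σ * h)).const_mul (κ σ)

lemma approx_kernelAvg {κ : ℝ → ℝ} (hκ : Continuous κ)
    (hκ0 : ∀ σ ∈ Icc (-1 : ℝ) 1, 0 ≤ κ σ) (hκ1 : ∫ σ in (-1 : ℝ)..1, κ σ = 1)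
    {g φ : ℝ → ℝ → ℝ} (hg : Smooth₂ g) (hφ : Smooth₂ φ) (T : ℝ) :
    Approx T (kernelAvg κ g φ) g (pt g) (px g) := by
  obtain ⟨C, hC, H⟩ := shiftWeight_estimates hg hφ T
  refine ⟨C, hC, fun s h t x hs hh hsh ht hx => ?_⟩
  have hd := hasDerivAt_kernelAvg hκ hg hφ s h t x
  have hF : ∀ x, Continuous fun σ => shiftWeight g φ s t x (x + σ * h) := fun x =>
    (continuous_shiftWeight hg hφ s x h).comp (by fun_prop : Continuous fun σ : ℝ => (t, σ))
  have H' := fun σ hσ => H s h t σ hs hh hsh ht hσ x hx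
  refine ⟨hd.differentiableAt, ?_, ?_, fun hxh => ?_, ?_⟩
  · exact abs_integral_kernel_sub_le hκ hκ0 hκ1 (hF x) fun σ hσ => (H' σ hσ).1
  · rw [hd.deriv]
    exact abs_integral_kernel_sub_le hκ hκ0 hκ1
      ((continuous_deriv_shiftWeight hg hφ s x h).comp
        (by fun_prop : Continuous fun σ : ℝ => (t, σ))) fun σ hσ => (H' σ hσ).2.1
  · have e : (kernelAvg κ g φ s h t (x + h) - kernelAvg κ g φ s h t x) / h
        = ∫ σ in (-1 : ℝ)..1, κ σ * ((shiftWeight g φ s t (x + h) (x + h + σ * h)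
        - shiftWeight g φ s t x (x + σ * h)) / h) := by
      have i : ∀ y, IntervalIntegrable (fun σ => κ σ * shiftWeight g φ s t y (y + σ * h))
          volume (-1) 1 := fun y => (hκ.mul (hF y)).intervalIntegrable _ _
      unfold kernelAvg
      rw [← intervalIntegral.integral_sub (i _) (i _), ← intervalIntegral.integral_div]
      congr 1; funext σ; ring
    rw [e]
    exact abs_integral_kernel_sub_le hκ hκ0 hκ1 (((hF _).sub (hF _)).div_const h)
      fun σ hσ => (H' σ hσ).2.2.1 hxh
  · exact (H' 0 (by norm_num)).2.2.2

/-! ### Summation by parts on the mesh. -/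

/-- Each interior node is shared equally by its two adjacent cells; the two end nodes are then
counted by half and must be removed. -/
lemma sum_node_eq_edge (N : ℕ) (f : ℕ → ℝ) :
    ∑ j ∈ Finset.Icc 1 N, f j
      = ∑ j ∈ Finset.Icc 0 N, (f j + f (j + 1)) / 2 - (f 0 + f (N + 1)) / 2 := by
  induction N with
  | zero => simp
  | succ n ih =>
    rw [Finset.sum_Icc_succ_top (by omega), Finset.sum_Icc_succ_top (by omega), ih]; ring

lemma sum_mul_sub_prev (N : ℕ) (g q : ℕ → ℝ) :
    ∑ j ∈ Finset.Icc 1 N, g j * (q j - q (j - 1))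
      = -∑ j ∈ Finset.Icc 0 N, (g (j + 1) - g j) * q j + g (N + 1) * q N - g 0 * q 0 := by
  induction N with
  | zero => simp; ring
  | succ n ih =>
    rw [Finset.sum_Icc_succ_top (by omega), Finset.sum_Icc_succ_top (by omega), ih,
      Nat.add_sub_cancel]; ring

lemma sum_mul_add_prev (N : ℕ) (g q : ℕ → ℝ) :
    ∑ j ∈ Finset.Icc 1 N, g j * (q j + q (j - 1))
      = ∑ j ∈ Finset.Icc 0 N, (g (j + 1) + g j) * q j - g (N + 1) * q N - g 0 * q 0 := by
  induction N with
  | zero => simp; ring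
  | succ n ih =>
    rw [Finset.sum_Icc_succ_top (by omega), Finset.sum_Icc_succ_top (by omega), ih,
      Nat.add_sub_cancel]; ring

/-- The product w_j(w_{j+1} - w_{j-1}) is the backward difference of w_j w_{j+1}. This is why
neighbouring products, and not squares, appear in the cell form. -/
lemma sum_mul_mul_centered (N : ℕ) (g w : ℕ → ℝ) :
    ∑ j ∈ Finset.Icc 1 N, g j * w j * (w (j + 1) - w (j - 1))
      = -∑ j ∈ Finset.Icc 0 N, (g (j + 1) - g j) * (w j * w (j + 1))
        + g (N + 1) * (w N * w (N + 1)) - g 0 * (w 0 * w 1) := by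
  rw [← sum_mul_sub_prev N g (fun j => w j * w (j + 1))]
  refine Finset.sum_congr rfl fun j hj => ?_
  have : j - 1 + 1 = j := Nat.sub_add_cancel (Finset.mem_Icc.1 hj).1
  simp only [this]; ring

lemma dPlus_prev {h : ℝ} {v : ℕ → ℝ} {j : ℕ} (hj : 1 ≤ j) :
    dPlus h v (j - 1) = (v j - v (j - 1)) / h := by
  simp [dPlus, Nat.sub_add_cancel hj]

lemma lapl_eq {h : ℝ} {v : ℕ → ℝ} {j : ℕ} (hj : 1 ≤ j) :
    lapl h v j = (dPlus h v j - dPlus h v (j - 1)) / h := by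
  rw [dPlus_prev hj, lapl, dPlus]
  by_cases h0 : h = 0
  · simp [h0]
  · field_simp; ring

lemma dCent_eq {h : ℝ} {v : ℕ → ℝ} {j : ℕ} (hj : 1 ≤ j) :
    dCent h v j = (dPlus h v j + dPlus h v (j - 1)) / 2 := by
  rw [dPlus_prev hj, dCent, dPlus]
  by_cases h0 : h = 0
  · simp [h0]
  · field_simp; ring

/-- Time derivative of the boundary-in-time functional, in terms of nodal values. -/
noncomputable def energyDot (N : ℕ) (h : ℝ) (a a' b b' c c' d d' e e' v w z : ℕ → ℝ) : ℝ :=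
  h * ∑ j ∈ Finset.Icc 1 N,
      (-(d' j * (v j * w j) + d j * (w j * w j + v j * z j))
        - (e' j * (w j * w j) + e j * (z j * w j + w j * z j))
        + 2 * (a' j * (w j * dCent h v j) + a j * (z j * dCent h v j + w j * dCent h w j))
        - ((b' j * e j + b j * e' j) * (v j * v j) + b j * e j * (w j * v j + v j * w j)))
    - h * ∑ j ∈ Finset.Icc 0 N,
      (((c' j * e j + c j * e' j) + (c' (j + 1) * e (j + 1) + c (j + 1) * e' (j + 1))) / 2
          * (dPlus h v j * dPlus h v j)
        + (c j * e j + c (j + 1) * e (j + 1)) / 2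
          * (dPlus h w j * dPlus h v j + dPlus h v j * dPlus h w j))

/-- The quadratic form carried by the mesh cell `[x_j, x_{j+1}]`. -/
noncomputable def edgeForm (h : ℝ) (a a' b b' c c' d d' e e' v w : ℕ → ℝ) (j : ℕ) : ℝ :=
  ((d j + e' j) * w j ^ 2 + (d (j + 1) + e' (j + 1)) * w (j + 1) ^ 2) / 2
    + dPlus h a j * (w j * w (j + 1))
    - (a' j * w j + a' (j + 1) * w (j + 1)) * dPlus h v j
    - dPlus h (fun i => c i * e i) j * (w j + w (j + 1)) * dPlus h v j
    + (-((c j * d j + c (j + 1) * d (j + 1)) / 2)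
        + ((c' j * e j + c j * e' j) + (c' (j + 1) * e (j + 1) + c (j + 1) * e' (j + 1))) / 2
        + dPlus h (fun i => c i * a i) j) * dPlus h v j ^ 2
    + (d' j * (v j * w j) + d' (j + 1) * (v (j + 1) * w (j + 1))) / 2
    - dPlus h (fun i => c i * d i) j * ((v j + v (j + 1)) / 2) * dPlus h v j
    + ((-(b j * d j) + (b' j * e j + b j * e' j)) * v j ^ 2
      + (-(b (j + 1) * d (j + 1))
        + (b' (j + 1) * e (j + 1) + b (j + 1) * e' (j + 1))) * v (j + 1) ^ 2) / 2
    - dPlus h (fun i => b i * a i) j * (v j * v (j + 1))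

/-- Abel summation, followed by the exact discrete product rule for g·u: mean times difference plus
difference times mean. -/
lemma sum_mul_mul_lapl (N : ℕ) {h : ℝ} (g u v : ℕ → ℝ)
    (u0 : u 0 = 0) (uN : u (N + 1) = 0) :
    ∑ j ∈ Finset.Icc 1 N, g j * u j * lapl h v j
      = -∑ j ∈ Finset.Icc 0 N, ((g j + g (j + 1)) / 2 * dPlus h u j
          + dPlus h g j * ((u j + u (j + 1)) / 2)) * dPlus h v j := by
  have key := sum_mul_sub_prev N (fun j => g j * u j / h) (dPlus h v)
  have : ∑ j ∈ Finset.Icc 1 N, g j * u j * lapl h v j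
      = ∑ j ∈ Finset.Icc 1 N, g j * u j / h * (dPlus h v j - dPlus h v (j - 1)) := by
    refine Finset.sum_congr rfl fun j hj => ?_
    rw [lapl_eq (Finset.mem_Icc.1 hj).1]; ring
  rw [this, key]
  simp only [u0, uN]
  rw [← Finset.sum_neg_distrib, ← Finset.sum_neg_distrib]
  have e : ∀ x : ℝ, x + g (N + 1) * 0 / h * dPlus h v N - g 0 * 0 / h * dPlus h v 0 = x := by
    intro x; ring
  rw [e]
  refine Finset.sum_congr rfl fun j _ => ?_
  have : g (j + 1) * u (j + 1) / h - g j * u j / h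
      = (g j + g (j + 1)) / 2 * dPlus h u j + dPlus h g j * ((u j + u (j + 1)) / 2) := by
    simp only [dPlus]; ring
  rw [this]

lemma sum_mul_mul_dCent (N : ℕ) {h : ℝ} (g w : ℕ → ℝ)
    (w0 : w 0 = 0) (wN : w (N + 1) = 0) :
    ∑ j ∈ Finset.Icc 1 N, g j * w j * (2 * dCent h w j)
      = -∑ j ∈ Finset.Icc 0 N, dPlus h g j * (w j * w (j + 1)) := by
  have key := sum_mul_mul_centered N g w
  rw [w0, wN] at key
  have e1 : ∑ j ∈ Finset.Icc 1 N, g j * w j * (2 * dCent h w j)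
      = (∑ j ∈ Finset.Icc 1 N, g j * w j * (w (j + 1) - w (j - 1))) / h := by
    rw [Finset.sum_div]
    refine Finset.sum_congr rfl fun j _ => ?_
    rw [dCent, div_eq_mul_inv, mul_inv]; ring
  rw [e1, key]
  simp only [dPlus, mul_zero, zero_mul, add_zero, sub_zero]
  rw [neg_div, Finset.sum_div]
  congr 1
  refine Finset.sum_congr rfl fun j _ => ?_
  ring

/-- Discrete form of 2 v_xx v_x = (v_x²)_x. It is exact, because Δ_h is a difference and 2∂_h a sum
of the same two one-sided slopes. No boundary condition is used, so both end terms survive. -/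
lemma sum_mul_lapl_mul_dCent (N : ℕ) {h : ℝ} (hh : h ≠ 0) (g v : ℕ → ℝ) :
    h * ∑ j ∈ Finset.Icc 1 N, g j * lapl h v j * (2 * dCent h v j)
      = -(h * ∑ j ∈ Finset.Icc 0 N, dPlus h g j * dPlus h v j ^ 2)
        + g (N + 1) * dPlus h v N ^ 2 - g 0 * dPlus h v 0 ^ 2 := by
  have key := sum_mul_sub_prev N g (fun j => dPlus h v j ^ 2)
  have e1 : h * ∑ j ∈ Finset.Icc 1 N, g j * lapl h v j * (2 * dCent h v j)
      = ∑ j ∈ Finset.Icc 1 N, g j * (dPlus h v j ^ 2 - dPlus h v (j - 1) ^ 2) := by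
    rw [Finset.mul_sum]
    refine Finset.sum_congr rfl fun j hj => ?_
    rw [lapl_eq (Finset.mem_Icc.1 hj).1, dCent_eq (Finset.mem_Icc.1 hj).1]
    field_simp; ring
  have e2 : h * ∑ j ∈ Finset.Icc 0 N, dPlus h g j * dPlus h v j ^ 2
      = ∑ j ∈ Finset.Icc 0 N, (g (j + 1) - g j) * dPlus h v j ^ 2 := by
    rw [Finset.mul_sum]
    refine Finset.sum_congr rfl fun j _ => ?_
    simp only [dPlus]
    field_simp
  rw [e1, e2, key]

lemma sum_mul_dCent (N : ℕ) {h : ℝ} (g v : ℕ → ℝ) (g0 : g 0 = 0) (gN : g (N + 1) = 0) :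
    ∑ j ∈ Finset.Icc 1 N, g j * (2 * dCent h v j)
      = ∑ j ∈ Finset.Icc 0 N, (g j + g (j + 1)) * dPlus h v j := by
  have key := sum_mul_add_prev N g (dPlus h v)
  rw [g0, gN] at key
  simp only [zero_mul, sub_zero] at key
  have e1 : ∑ j ∈ Finset.Icc 1 N, g j * (2 * dCent h v j)
      = ∑ j ∈ Finset.Icc 1 N, g j * (dPlus h v j + dPlus h v (j - 1)) := by
    refine Finset.sum_congr rfl fun j hj => ?_
    rw [dCent_eq (Finset.mem_Icc.1 hj).1]; ring
  rw [e1, key]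
  refine Finset.sum_congr rfl fun j _ => ?_
  ring

/-- Here w and z stand for v_t and v_tt, and primes for time derivatives of the coefficients. Every
term containing z goes into `energyDot` by the product rule, so the cell form involves only v and w.
The remaining spatial products are summed by parts, and the nodal ones are distributed over the
adjacent cells. -/
lemma cross_product_identity (N : ℕ) {h : ℝ} (hh : h ≠ 0)
    (a a' b b' c c' d d' e e' v w z : ℕ → ℝ)
    (v0 : v 0 = 0) (vN : v (N + 1) = 0) (w0 : w 0 = 0) (wN : w (N + 1) = 0) :
    h * ∑ j ∈ Finset.Icc 1 N, (z j - c j * lapl h v j + b j * v j)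
        * (-(d j * v j) - 2 * e j * w j + 2 * a j * dCent h v j)
      = energyDot N h a a' b b' c c' d d' e e' v w z
        + h * ∑ j ∈ Finset.Icc 0 N, edgeForm h a a' b b' c c' d d' e e' v w j
        + c 0 * a 0 * dPlus h v 0 ^ 2 - c (N + 1) * a (N + 1) * dPlus h v N ^ 2 := by
  have t3 := sum_mul_mul_dCent N (h := h) a w w0 wN
  have t3' := sum_mul_dCent N (h := h) (fun j => a' j * w j) v (by simp [w0]) (by simp [wN])
  have t4 := sum_mul_mul_lapl N (h := h) (fun j => c j * d j) v v v0 vN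
  have t5 := sum_mul_mul_lapl N (h := h) (fun j => c j * e j) w v w0 wN
  have t6 := sum_mul_lapl_mul_dCent N hh (fun j => c j * a j) v
  have t9 := sum_mul_mul_dCent N (h := h) (fun j => b j * a j) v v0 vN
  have tn := sum_node_eq_edge N (fun j => (d j + e' j) * w j ^ 2 + d' j * (v j * w j)
    + (-(b j * d j) + (b' j * e j + b j * e' j)) * v j ^ 2)
  simp only [v0, vN, w0, wN] at tn
  have node : ∑ j ∈ Finset.Icc 1 N, (z j - c j * lapl h v j + b j * v j)
        * (-(d j * v j) - 2 * e j * w j + 2 * a j * dCent h v j)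
      = ∑ j ∈ Finset.Icc 1 N,
      (-(d' j * (v j * w j) + d j * (w j * w j + v j * z j))
        - (e' j * (w j * w j) + e j * (z j * w j + w j * z j))
        + 2 * (a' j * (w j * dCent h v j) + a j * (z j * dCent h v j + w j * dCent h w j))
        - ((b' j * e j + b j * e' j) * (v j * v j) + b j * e j * (w j * v j + v j * w j)))
      - ∑ j ∈ Finset.Icc 1 N, a j * w j * (2 * dCent h w j)
      - ∑ j ∈ Finset.Icc 1 N, a' j * w j * (2 * dCent h v j)
      + ∑ j ∈ Finset.Icc 1 N, c j * d j * v j * lapl h v j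
      + 2 * ∑ j ∈ Finset.Icc 1 N, c j * e j * w j * lapl h v j
      - ∑ j ∈ Finset.Icc 1 N, c j * a j * lapl h v j * (2 * dCent h v j)
      + ∑ j ∈ Finset.Icc 1 N, b j * a j * v j * (2 * dCent h v j)
      + ∑ j ∈ Finset.Icc 1 N, ((d j + e' j) * w j ^ 2 + d' j * (v j * w j)
          + (-(b j * d j) + (b' j * e j + b j * e' j)) * v j ^ 2) := by
    rw [Finset.mul_sum]
    simp only [← Finset.sum_add_distrib, ← Finset.sum_sub_distrib]
    refine Finset.sum_congr rfl fun j _ => ?_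
    ring
  have edge : ∑ j ∈ Finset.Icc 0 N, edgeForm h a a' b b' c c' d d' e e' v w j
      = ∑ j ∈ Finset.Icc 0 N,
      (((c' j * e j + c j * e' j) + (c' (j + 1) * e (j + 1) + c (j + 1) * e' (j + 1))) / 2
          * (dPlus h v j * dPlus h v j)
        + (c j * e j + c (j + 1) * e (j + 1)) / 2
          * (dPlus h w j * dPlus h v j + dPlus h v j * dPlus h w j))
      + ∑ j ∈ Finset.Icc 0 N, dPlus h a j * (w j * w (j + 1))
      - ∑ j ∈ Finset.Icc 0 N, (a' j * w j + a' (j + 1) * w (j + 1)) * dPlus h v j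
      - ∑ j ∈ Finset.Icc 0 N, ((c j * d j + c (j + 1) * d (j + 1)) / 2 * dPlus h v j
          + dPlus h (fun j => c j * d j) j * ((v j + v (j + 1)) / 2)) * dPlus h v j
      - 2 * ∑ j ∈ Finset.Icc 0 N, ((c j * e j + c (j + 1) * e (j + 1)) / 2 * dPlus h w j
          + dPlus h (fun j => c j * e j) j * ((w j + w (j + 1)) / 2)) * dPlus h v j
      + ∑ j ∈ Finset.Icc 0 N, dPlus h (fun j => c j * a j) j * dPlus h v j ^ 2
      - ∑ j ∈ Finset.Icc 0 N, dPlus h (fun j => b j * a j) j * (v j * v (j + 1))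
      + ∑ j ∈ Finset.Icc 0 N, ((d j + e' j) * w j ^ 2 + d' j * (v j * w j)
          + (-(b j * d j) + (b' j * e j + b j * e' j)) * v j ^ 2
        + ((d (j + 1) + e' (j + 1)) * w (j + 1) ^ 2 + d' (j + 1) * (v (j + 1) * w (j + 1))
          + (-(b (j + 1) * d (j + 1)) + (b' (j + 1) * e (j + 1) + b (j + 1) * e' (j + 1)))
            * v (j + 1) ^ 2)) / 2 := by
    rw [Finset.mul_sum]
    simp only [← Finset.sum_add_distrib, ← Finset.sum_sub_distrib]
    refine Finset.sum_congr rfl fun j _ => ?_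
    unfold edgeForm
    ring
  rw [node, edge, energyDot, t3, t3', t4, t5, t9, tn]
  linear_combination -t6

/-! ### Positivity of the quadratic form on one cell. -/

lemma mul_ge_of_abs_sub_le {x r E y Y : ℝ} (h : |x - r| ≤ E) (hy : |y| ≤ Y) :
    r * y - E * Y ≤ x * y := by
  have h1 : |(x - r) * y| ≤ E * Y := by
    rw [abs_mul]; exact mul_le_mul h hy (abs_nonneg _) ((abs_nonneg _).trans h)
  have := (abs_le.1 h1).1
  linarith [sub_mul x r y]

lemma mul_le_of_abs_sub_le {x r E y Y : ℝ} (h : |x - r| ≤ E) (hy : |y| ≤ Y) :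
    x * y ≤ r * y + E * Y := by
  have h1 : |(x - r) * y| ≤ E * Y := by
    rw [abs_mul]; exact mul_le_mul h hy (abs_nonneg _) ((abs_nonneg _).trans h)
  have := (abs_le.1 h1).2
  linarith [sub_mul x r y]

lemma abs_mul_le_half_sq (x y : ℝ) : |x * y| ≤ (x ^ 2 + y ^ 2) / 2 := by
  rw [abs_le]; constructor <;> nlinarith [sq_nonneg (x + y), sq_nonneg (x - y)]

-- The letters `ka`, `kd`, `ke`, `kx`, `kz`, `kb` are limit coefficients at one point. The relations
-- `k1`, `k2`, `k3` say that the limit form in (w, p) is the square 2Θ(τw - ξp)² plus 2μ(w² + p²).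
-- Replacing the true coefficients by the limits costs sh relative to the leading power of s, and
-- the terms of lower order in s cost K(w² + p² + s²v²).
set_option maxHeartbeats 1000000 in
lemma edge_quadratic_lower_bound {s h K μ m Θ τ ξ ke ka kd kx kz kb : ℝ}
    {dL dR eL eR Da aL aR Dce cdL cdR ceL ceR Dca d'L d'R Dcd zL zR Dba : ℝ}
    {wL wR p vL vR : ℝ} (hs : 1 ≤ s) (hh : 0 < h) (hη : s * h ≤ 1) (hΘ : 0 ≤ Θ) (hμ : 0 ≤ μ)
    (k1 : kd + ke + ka = 2 * Θ * τ ^ 2 + 2 * μ) (k2 : -kd + ke + ka = 2 * Θ * ξ ^ 2 + 2 * μ)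
    (k3 : kx = Θ * τ * ξ) (k4 : m ≤ kz - kb) (k5 : |ka| ≤ K) (k6 : |kb| ≤ K)
    (hp : vR - vL = h * p)
    (h1 : |dL - s * kd| ≤ s * K * (s * h)) (h2 : |dR - s * kd| ≤ s * K * (s * h))
    (h3 : |eL - s * ke| ≤ s * K * (s * h)) (h4 : |eR - s * ke| ≤ s * K * (s * h))
    (h5 : |Da - s * ka| ≤ s * K * (s * h))
    (h6 : |aL - s * kx| ≤ s * K * (s * h)) (h7 : |aR - s * kx| ≤ s * K * (s * h))
    (h8 : |Dce - s * kx| ≤ s * K * (s * h))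
    (h9 : |cdL - s * kd| ≤ s * K * (s * h)) (h10 : |cdR - s * kd| ≤ s * K * (s * h))
    (h11 : |ceL - s * ke| ≤ s * K * (s * h)) (h12 : |ceR - s * ke| ≤ s * K * (s * h))
    (h13 : |Dca - s * ka| ≤ s * K * (s * h))
    (h14 : |d'L| ≤ s * K) (h15 : |d'R| ≤ s * K) (h16 : |Dcd| ≤ s * K)
    (h17 : |zL - s ^ 3 * kz| ≤ s ^ 3 * K * (s * h))
    (h18 : |zR - s ^ 3 * kz| ≤ s ^ 3 * K * (s * h))
    (h19 : |Dba - s ^ 3 * kb| ≤ s ^ 3 * K * (s * h)) :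
    (s * μ - 10 * K * (s * (s * h) + 1)) * (wL ^ 2 + wR ^ 2 + p ^ 2)
      + (s ^ 3 * m / 2 - 10 * K * (s ^ 3 * (s * h) + s ^ 2)) * (vL ^ 2 + vR ^ 2)
      - s * K * (wR - wL) ^ 2 ≤
    ((dL + eL) * wL ^ 2 + (dR + eR) * wR ^ 2) / 2 + Da * (wL * wR) - (aL * wL + aR * wR) * p
    - Dce * (wL + wR) * p + (-((cdL + cdR) / 2) + (ceL + ceR) / 2 + Dca) * p ^ 2
    + (d'L * (vL * wL) + d'R * (vR * wR)) / 2 - Dcd * ((vL + vR) / 2) * p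
    + (zL * vL ^ 2 + zR * vR ^ 2) / 2 - Dba * (vL * vR) := by
  have hs0 : 0 < s := by linarith
  have hK : 0 ≤ K := (abs_nonneg _).trans k5
  have sq : ∀ x : ℝ, |x ^ 2| ≤ x ^ 2 := fun x => (abs_of_nonneg (sq_nonneg x)).le
  have a1 := mul_ge_of_abs_sub_le h1 (sq wL)
  have a2 := mul_ge_of_abs_sub_le h2 (sq wR)
  have a3 := mul_ge_of_abs_sub_le h3 (sq wL)
  have a4 := mul_ge_of_abs_sub_le h4 (sq wR)
  have a5 := mul_ge_of_abs_sub_le h5 (abs_mul_le_half_sq wL wR)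
  have a6 := mul_le_of_abs_sub_le h6 (abs_mul_le_half_sq wL p)
  have a7 := mul_le_of_abs_sub_le h7 (abs_mul_le_half_sq wR p)
  have a8 := mul_le_of_abs_sub_le h8 (abs_mul_le_half_sq wL p)
  have a8' := mul_le_of_abs_sub_le h8 (abs_mul_le_half_sq wR p)
  have a9 := mul_le_of_abs_sub_le h9 (sq p)
  have a10 := mul_le_of_abs_sub_le h10 (sq p)
  have a11 := mul_ge_of_abs_sub_le h11 (sq p)
  have a12 := mul_ge_of_abs_sub_le h12 (sq p)
  have a13 := mul_ge_of_abs_sub_le h13 (sq p)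
  have a17 := mul_ge_of_abs_sub_le h17 (sq vL)
  have a18 := mul_ge_of_abs_sub_le h18 (sq vR)
  have a19 := mul_le_of_abs_sub_le h19 (abs_mul_le_half_sq vL vR)
  -- Mixed terms of size s are split by Young's inequality with v weighted by s, so that they cost
  -- only O(1) in w² and O(s²) in v², one power of s below the main terms.
  have low : ∀ x v w : ℝ, |x| ≤ s * K → |x * (v * w)| ≤ K / 2 * (w ^ 2 + s ^ 2 * v ^ 2) := by
    intro x v w hx
    have e : x * (v * w) = (x / s) * ((s * v) * w) := by field_simp
    have hx' : |x / s| ≤ K := by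
      rw [abs_div, abs_of_pos hs0, div_le_iff₀ hs0]; linarith
    rw [e, abs_mul]
    calc |x / s| * |(s * v) * w| ≤ K * (((s * v) ^ 2 + w ^ 2) / 2) :=
          mul_le_mul hx' (abs_mul_le_half_sq _ _) (abs_nonneg _) hK
      _ = _ := by ring
  have b14 := (abs_le.1 (low _ vL wL h14)).1
  have b15 := (abs_le.1 (low _ vR wR h15)).1
  have b16 := (abs_le.1 (low _ vL p h16)).2
  have b16' := (abs_le.1 (low _ vR p h16)).2
  -- Since wL·wR is the mean of the squares minus (wR - wL)²/2, the defect is kept as a separate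
  -- term. It has the same order s as the main terms and cannot be absorbed.
  have q1 : -(s * K) * (wR - wL) ^ 2 ≤ -(s * ka / 2) * (wR - wL) ^ 2 := by
    apply mul_le_mul_of_nonneg_right _ (sq_nonneg _)
    have i1 : s * ka ≤ s * K := mul_le_mul_of_nonneg_left ((le_abs_self ka).trans k5) hs0.le
    have i2 : 0 ≤ s * K := mul_nonneg hs0.le hK
    clear * - i1 i2
    linarith
  -- The same defect for v is harmless: vR - vL = hp, so s³(vR - vL)² = s(sh)²p².
  have q2 : -(K * (s * (s * h)) * p ^ 2) ≤ s ^ 3 * (kb / 2) * (vR - vL) ^ 2 := by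
    have e : s ^ 3 * (kb / 2) * (vR - vL) ^ 2 = kb / 2 * (s * h) * (s * (s * h) * p ^ 2) := by
      rw [hp]; ring
    have nn : 0 ≤ s * (s * h) * p ^ 2 := by positivity
    have : -K ≤ kb / 2 * (s * h) := by
      have hsh : 0 ≤ s * h := by positivity
      have i1 := mul_le_mul k6 hη hsh hK
      have i2 := neg_abs_le kb
      have i3 := mul_le_mul_of_nonneg_right i2 hsh
      clear * - i1 i3 hK
      linarith
    rw [e]
    calc -(K * (s * (s * h)) * p ^ 2) = -K * (s * (s * h) * p ^ 2) := by ring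
      _ ≤ _ := mul_le_mul_of_nonneg_right this nn
  have q3 : s ^ 3 * m / 2 * (vL ^ 2 + vR ^ 2) ≤ s ^ 3 * (kz - kb) / 2 * (vL ^ 2 + vR ^ 2) := by
    exact mul_le_mul_of_nonneg_right (by linarith [mul_le_mul_of_nonneg_left k4 (by positivity : 0 ≤ s ^ 3)]) (by positivity)
  -- The perfect square, taken at each of the two nodes with half weight; `f1` and `f2` rewrite `kd`
  -- and `ke` so that it becomes visible.
  have q4 : 0 ≤ s * Θ * (τ * wL - ξ * p) ^ 2 := by positivity
  have q5 : 0 ≤ s * Θ * (τ * wR - ξ * p) ^ 2 := by positivity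
  have f1 : kd = Θ * τ ^ 2 - Θ * ξ ^ 2 := by linarith
  have f2 : ke = Θ * τ ^ 2 + Θ * ξ ^ 2 + 2 * μ - ka := by linarith
  subst f1 f2 k3
  have n1 : 0 ≤ K * (s * (s * h)) * wL ^ 2 := by positivity
  have n2 : 0 ≤ K * (s * (s * h)) * wR ^ 2 := by positivity
  have n3 : 0 ≤ K * (s * (s * h)) * p ^ 2 := by positivity
  have n4 : 0 ≤ K * (s ^ 3 * (s * h)) * vL ^ 2 := by positivity
  have n5 : 0 ≤ K * (s ^ 3 * (s * h)) * vR ^ 2 := by positivity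
  have n6 : 0 ≤ K * wL ^ 2 := by positivity
  have n7 : 0 ≤ K * wR ^ 2 := by positivity
  have n8 : 0 ≤ K * p ^ 2 := by positivity
  have n9 : 0 ≤ K * s ^ 2 * vL ^ 2 := by positivity
  have n10 : 0 ≤ K * s ^ 2 * vR ^ 2 := by positivity
  have n11 : 0 ≤ s * μ * p ^ 2 := by positivity
  clear h1 h2 h3 h4 h5 h6 h7 h8 h9 h10 h11 h12 h13 h14 h15 h16 h17 h18 h19 k1 k2 k4 k5 k6 sq low hp
  linarith

/-! ### The weights ψ and φ, and the limits of A₀, …, A₄. -/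

section weights

variable (β x₀ C₀ lam : ℝ)

lemma px_psi (t x : ℝ) : px (psi β x₀ C₀) t x = 2 * (x - x₀) := by
  simp [px, psi, sq_abs]

lemma pt_psi (t x : ℝ) : pt (psi β x₀ C₀) t x = -2 * β * t := by
  simp [pt, psi, sq_abs]; ring

lemma pxx_psi (t x : ℝ) : pxx (psi β x₀ C₀) t x = 2 := by
  simp [pxx, px_psi]

lemma smooth_psi : Smooth₂ (psi β x₀ C₀) := by
  unfold Smooth₂ psi
  simp only [sq_abs]
  fun_prop

lemma smooth_phi : Smooth₂ (phi β x₀ C₀ lam) := by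
  unfold Smooth₂ phi
  exact Real.contDiff_exp.comp (contDiff_const.mul (smooth_psi β x₀ C₀))

lemma hasDerivAt_phi_fst (t x : ℝ) :
    HasDerivAt (fun τ => phi β x₀ C₀ lam τ x) (lam * (-2 * β * t) * phi β x₀ C₀ lam t x) t := by
  have h := (smooth_psi β x₀ C₀).hasDerivAt_pt t x
  rw [pt_psi] at h
  exact (h.const_mul lam).exp.congr_deriv (by simp only [phi]; ring)

lemma hasDerivAt_phi_snd (t x : ℝ) :
    HasDerivAt (fun y => phi β x₀ C₀ lam t y)
      (lam * (2 * (x - x₀)) * phi β x₀ C₀ lam t x) x := by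
  have h := (smooth_psi β x₀ C₀).hasDerivAt_px t x
  rw [px_psi] at h
  exact (h.const_mul lam).exp.congr_deriv (by simp only [phi]; ring)

lemma rho_div_rho (φ : ℝ → ℝ → ℝ) (s t x y : ℝ) :
    rho φ s t y / rho φ s t x = Real.exp (-(s * (φ t y - φ t x))) := by
  rw [rho, rho, ← Real.exp_sub]; congr 1; ring

lemma integral_half : ∫ _σ in (-1 : ℝ)..1, (1 / 2 : ℝ) = 1 := by
  rw [intervalIntegral.integral_const]; norm_num

lemma hasDerivAt_tent_pos (σ : ℝ) : HasDerivAt (fun x : ℝ => x - x ^ 2 / 2) (1 - σ) σ := by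
  have := (hasDerivAt_id σ).sub (((hasDerivAt_id σ).pow 2).div_const 2)
  exact this.congr_deriv (by simp)

lemma hasDerivAt_tent_neg (σ : ℝ) : HasDerivAt (fun x : ℝ => x + x ^ 2 / 2) (1 + σ) σ := by
  have := (hasDerivAt_id σ).add (((hasDerivAt_id σ).pow 2).div_const 2)
  exact this.congr_deriv (by simp)

/-- Integration against the tent function, given primitives on both halves. -/
lemma integral_tent_mul {f F₁ F₂ : ℝ → ℝ} (hf : Continuous f)
    (h₁ : ∀ σ, HasDerivAt F₁ ((1 + σ) * f σ) σ) (h₂ : ∀ σ, HasDerivAt F₂ ((1 - σ) * f σ) σ) :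
    ∫ σ in (-1 : ℝ)..1, (1 - |σ|) * f σ = F₁ 0 - F₁ (-1) + (F₂ 1 - F₂ 0) := by
  have hc : Continuous fun σ : ℝ => (1 - |σ|) * f σ := by fun_prop
  rw [← intervalIntegral.integral_add_adjacent_intervals (b := 0) (hc.intervalIntegrable _ _)
    (hc.intervalIntegrable _ _)]
  congr 1
  · rw [← intervalIntegral.integral_eq_sub_of_hasDerivAt (fun σ _ => h₁ σ)
      ((by fun_prop : Continuous fun σ : ℝ => (1 + σ) * f σ).intervalIntegrable _ _)]
    apply intervalIntegral.integral_congr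
    intro σ hσ
    rw [uIcc_of_le (by norm_num)] at hσ
    simp only [abs_of_nonpos hσ.2, sub_neg_eq_add]
  · rw [← intervalIntegral.integral_eq_sub_of_hasDerivAt (fun σ _ => h₂ σ)
      ((by fun_prop : Continuous fun σ : ℝ => (1 - σ) * f σ).intervalIntegrable _ _)]
    apply intervalIntegral.integral_congr
    intro σ hσ
    rw [uIcc_of_le (by norm_num)] at hσ
    simp only [abs_of_nonneg hσ.1]

lemma integral_tent : ∫ σ in (-1 : ℝ)..1, (1 - |σ|) = 1 := by
  have := integral_tent_mul (f := fun _ => 1) continuous_const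
    (fun σ => by simpa using hasDerivAt_tent_neg σ) (fun σ => by simpa using hasDerivAt_tent_pos σ)
  simp only [mul_one] at this
  rw [this]; norm_num

variable {β x₀ C₀ lam}

lemma Smooth₂.mul {f g : ℝ → ℝ → ℝ} (hf : Smooth₂ f) (hg : Smooth₂ g) :
    Smooth₂ (fun t x => f t x * g t x) := ContDiff.mul hf hg

lemma smooth_poly_t : Smooth₂ (fun t _ => -2 * β * t) := by unfold Smooth₂; fun_prop

lemma smooth_poly_x : Smooth₂ (fun _ x => 2 * (x - x₀)) := by unfold Smooth₂; fun_prop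

lemma Approx.of_hasDerivAt {T : ℝ} {f : ℝ → ℝ → ℝ → ℝ → ℝ} {g gt gx : ℝ → ℝ → ℝ}
    (H : Approx T f g (pt g) (px g)) (ht : ∀ t x, HasDerivAt (fun τ => g τ x) (gt t x) t)
    (hx : ∀ t x, HasDerivAt (fun y => g t y) (gx t x) x) : Approx T f g gt gx :=
  H.congr (fun _ _ _ _ => rfl) (fun _ _ => rfl) (fun t x => (ht t x).deriv.symm)
    (fun t x => (hx t x).deriv.symm)

lemma tent_nonneg : ∀ σ ∈ Icc (-1 : ℝ) 1, 0 ≤ 1 - |σ| := fun σ hσ => by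
  linarith [abs_le.2 ⟨hσ.1, hσ.2⟩]

variable (β x₀ C₀ lam)

lemma approx_phi (T : ℝ) : Approx T (fun _ _ t x => phi β x₀ C₀ lam t x) (phi β x₀ C₀ lam)
    (fun t x => lam * (-2 * β * t) * phi β x₀ C₀ lam t x)
    (fun t x => lam * (2 * (x - x₀)) * phi β x₀ C₀ lam t x) :=
  ((smooth_phi β x₀ C₀ lam).approx T).of_hasDerivAt (hasDerivAt_phi_fst β x₀ C₀ lam)
    (hasDerivAt_phi_snd β x₀ C₀ lam)

lemma approx_pt_psi (T : ℝ) : Approx T (fun _ _ t x => pt (psi β x₀ C₀) t x)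
    (fun t _ => -2 * β * t) (fun _ _ => -2 * β) (fun _ _ => 0) := by
  have := (smooth_poly_t (β := β)).approx T
  refine (this.of_hasDerivAt (gt := fun _ _ => -2 * β) (gx := fun _ _ => 0)
    (fun t x => by simpa using (hasDerivAt_id t).const_mul (-2 * β))
    (fun t x => hasDerivAt_const _ _)).congr (fun _ _ t x => pt_psi β x₀ C₀ t x)
    (fun _ _ => rfl) (fun _ _ => rfl) (fun _ _ => rfl)

lemma hasDerivAt_xi (x : ℝ) : HasDerivAt (fun y => 2 * (y - x₀)) 2 x := by
  simpa using ((hasDerivAt_id x).sub_const x₀).const_mul 2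

lemma A1_eq (s h t x : ℝ) :
    A1 (psi β x₀ C₀) (phi β x₀ C₀ lam) s h t x = kernelAvg (fun _ => 1 / 2)
      (fun t x => phi β x₀ C₀ lam t x * (2 * (x - x₀))) (phi β x₀ C₀ lam) s h t x := by
  rw [A1, kernelAvg, intervalIntegral.integral_const_mul]
  simp only [shiftWeight, rho_div_rho, px_psi]

lemma A2_eq (s h t x : ℝ) :
    A2 (psi β x₀ C₀) (phi β x₀ C₀ lam) s h t x = kernelAvg (fun σ => 1 - |σ|)
      (fun t x => phi β x₀ C₀ lam t x ^ 2 * (2 * (x - x₀)) ^ 2) (phi β x₀ C₀ lam) s h t x := by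
  rw [A2, kernelAvg]
  simp only [shiftWeight, rho_div_rho, px_psi, mul_assoc]

lemma A3_eq (s h t x : ℝ) :
    A3 (psi β x₀ C₀) (phi β x₀ C₀ lam) s h t x = kernelAvg (fun σ => 1 - |σ|)
      (fun t x => phi β x₀ C₀ lam t x * (2 * (x - x₀)) ^ 2) (phi β x₀ C₀ lam) s h t x := by
  rw [A3, kernelAvg]
  simp only [shiftWeight, rho_div_rho, px_psi, mul_assoc]

lemma A4_eq (s h t x : ℝ) :
    A4 (psi β x₀ C₀) (phi β x₀ C₀ lam) s h t x = kernelAvg (fun σ => 1 - |σ|)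
      (fun t x => phi β x₀ C₀ lam t x * 2) (phi β x₀ C₀ lam) s h t x := by
  rw [A4, kernelAvg]
  simp only [shiftWeight, rho_div_rho, pxx_psi, mul_assoc]

lemma approx_A1 (T : ℝ) : Approx T (A1 (psi β x₀ C₀) (phi β x₀ C₀ lam))
    (fun t x => phi β x₀ C₀ lam t x * (2 * (x - x₀)))
    (fun t x => lam * phi β x₀ C₀ lam t x * (-2 * β * t) * (2 * (x - x₀)))
    (fun t x => lam * phi β x₀ C₀ lam t x * (2 * (x - x₀)) ^ 2 + 2 * phi β x₀ C₀ lam t x) := by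
  have hs : Smooth₂ (fun t x => phi β x₀ C₀ lam t x * (2 * (x - x₀))) :=
    (smooth_phi β x₀ C₀ lam).mul smooth_poly_x
  have := approx_kernelAvg (κ := fun _ => 1 / 2) continuous_const (fun _ _ => by norm_num)
    integral_half hs (smooth_phi β x₀ C₀ lam) T
  refine (this.of_hasDerivAt (fun t x => ?_) (fun t x => ?_)).congr (A1_eq β x₀ C₀ lam)
    (fun _ _ => rfl) (fun _ _ => rfl) (fun _ _ => rfl)
  · exact ((hasDerivAt_phi_fst β x₀ C₀ lam t x).mul_const (2 * (x - x₀))).congr_deriv (by ring)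
  · exact ((hasDerivAt_phi_snd β x₀ C₀ lam t x).mul (hasDerivAt_xi x₀ x)).congr_deriv (by ring)

lemma approx_A2 (T : ℝ) : Approx T (A2 (psi β x₀ C₀) (phi β x₀ C₀ lam))
    (fun t x => phi β x₀ C₀ lam t x ^ 2 * (2 * (x - x₀)) ^ 2)
    (fun t x => 2 * lam * phi β x₀ C₀ lam t x ^ 2 * (-2 * β * t) * (2 * (x - x₀)) ^ 2)
    (fun t x => 2 * lam * phi β x₀ C₀ lam t x ^ 2 * (2 * (x - x₀)) ^ 3
      + 4 * phi β x₀ C₀ lam t x ^ 2 * (2 * (x - x₀))) := by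
  have hs : Smooth₂ (fun t x => phi β x₀ C₀ lam t x ^ 2 * (2 * (x - x₀)) ^ 2) :=
    (ContDiff.pow (smooth_phi β x₀ C₀ lam) 2).mul (ContDiff.pow smooth_poly_x 2)
  have := approx_kernelAvg (κ := fun σ => 1 - |σ|) (by fun_prop) tent_nonneg
    integral_tent hs (smooth_phi β x₀ C₀ lam) T
  refine (this.of_hasDerivAt (fun t x => ?_) (fun t x => ?_)).congr (A2_eq β x₀ C₀ lam)
    (fun _ _ => rfl) (fun _ _ => rfl) (fun _ _ => rfl)
  · exact (((hasDerivAt_phi_fst β x₀ C₀ lam t x).pow 2).mul_const ((2 * (x - x₀)) ^ 2)).congr_deriv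
      (by push_cast; ring)
  · exact (((hasDerivAt_phi_snd β x₀ C₀ lam t x).pow 2).mul
      ((hasDerivAt_xi x₀ x).pow 2)).congr_deriv (by simp only [Pi.pow_apply]; push_cast; ring)

lemma approx_A3 (T : ℝ) : Approx T (A3 (psi β x₀ C₀) (phi β x₀ C₀ lam))
    (fun t x => phi β x₀ C₀ lam t x * (2 * (x - x₀)) ^ 2)
    (fun t x => lam * phi β x₀ C₀ lam t x * (-2 * β * t) * (2 * (x - x₀)) ^ 2)
    (fun t x => lam * phi β x₀ C₀ lam t x * (2 * (x - x₀)) ^ 3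
      + 4 * phi β x₀ C₀ lam t x * (2 * (x - x₀))) := by
  have hs : Smooth₂ (fun t x => phi β x₀ C₀ lam t x * (2 * (x - x₀)) ^ 2) :=
    ContDiff.mul (smooth_phi β x₀ C₀ lam) (ContDiff.pow smooth_poly_x 2)
  have := approx_kernelAvg (κ := fun σ => 1 - |σ|) (by fun_prop) tent_nonneg
    integral_tent hs (smooth_phi β x₀ C₀ lam) T
  refine (this.of_hasDerivAt (fun t x => ?_) (fun t x => ?_)).congr (A3_eq β x₀ C₀ lam)
    (fun _ _ => rfl) (fun _ _ => rfl) (fun _ _ => rfl)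
  · exact ((hasDerivAt_phi_fst β x₀ C₀ lam t x).mul_const ((2 * (x - x₀)) ^ 2)).congr_deriv
      (by ring)
  · exact ((hasDerivAt_phi_snd β x₀ C₀ lam t x).mul
      ((hasDerivAt_xi x₀ x).pow 2)).congr_deriv (by simp only [Pi.pow_apply]; push_cast; ring)

lemma approx_A4 (T : ℝ) : Approx T (A4 (psi β x₀ C₀) (phi β x₀ C₀ lam))
    (fun t x => phi β x₀ C₀ lam t x * 2)
    (pt fun t x => phi β x₀ C₀ lam t x * 2) (px fun t x => phi β x₀ C₀ lam t x * 2) := by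
  have hs : Smooth₂ (fun t x => phi β x₀ C₀ lam t x * 2) :=
    ContDiff.mul (smooth_phi β x₀ C₀ lam) contDiff_const
  exact (approx_kernelAvg (κ := fun σ => 1 - |σ|) (by fun_prop) tent_nonneg
    integral_tent hs (smooth_phi β x₀ C₀ lam) T).congr (A4_eq β x₀ C₀ lam)
    (fun _ _ => rfl) (fun _ _ => rfl) (fun _ _ => rfl)

lemma approx_one_add_A0 (T : ℝ) :
    Approx T (fun s h t x => 1 + A0 (psi β x₀ C₀) (phi β x₀ C₀ lam) lam s h t x)
      (fun _ _ => 1) (fun _ _ => 0) (fun _ _ => 0) := by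
  have hh1 : ∀ s h : ℝ, 1 ≤ s → 0 < h → s * h ≤ 1 → h ≤ 1 := fun s h hs hh hsh => by nlinarith
  have h2 := (approx_A2 β x₀ C₀ lam T).mul_small (k := fun s h => (s * h) ^ 2)
    (fun s h hs hh hsh => by
      have : 0 ≤ s * h := by positivity
      rw [abs_of_nonneg (by positivity)]; nlinarith)
  have hk : ∀ s h : ℝ, 1 ≤ s → 0 < h → s * h ≤ 1 → |s * h * h| ≤ s * h := fun s h hs hh hsh => by
    have : 0 ≤ s * h := by positivity
    rw [abs_of_nonneg (by positivity)]; nlinarith [hh1 s h hs hh hsh]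
  have h3 := (approx_A3 β x₀ C₀ lam T).mul_small (k := fun s h => s * h * h) hk
  have h4 := (approx_A4 β x₀ C₀ lam T).mul_small (k := fun s h => s * h * h) hk
  refine ((Approx.const T 1).add ((((h2.const_mul (lam ^ 2 / 2)).sub
    (h3.const_mul (lam ^ 2 / 2))).sub (h4.const_mul (lam / 2))))).congr (fun s h t x => ?_)
    (fun _ _ => by ring) (fun _ _ => by ring) (fun _ _ => by ring)
  simp only [A0]; ring

end weights

/-! ### Positivity at order zero and limits of the normalised coefficients. -/

/-- Zeroth-order factor of the commutator: a quadratic polynomial in `q = ψ_t² - ψ_x²`. -/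
lemma zero_order_lower_bound {β x₀ lam Φ τ ξ : ℝ} (hβ : β ∈ Ioo (0 : ℝ) 1) (hlam : 0 < lam)
    (hl : lam * ((1 - β) * x₀ ^ 2) = 1) (hξ : 4 * x₀ ^ 2 ≤ ξ ^ 2) (hΦ : 1 ≤ Φ) :
    8 * lam ^ 2 ≤ lam ^ 3 * Φ ^ 3 * (2 * lam * (τ ^ 2 - ξ ^ 2) ^ 2
      - (2 + 6 * β) * (τ ^ 2 - ξ ^ 2) + 4 * (1 - β) * ξ ^ 2) := by
  obtain ⟨h0, h1⟩ := hβ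
  set q := τ ^ 2 - ξ ^ 2
  -- With y = λq, the minimum of 2y² - (2+6β)y is -(2+6β)²/8 ≥ -8 because β < 1. The last term is at
  -- least 16 by `hl` and `hξ`.
  have e1 : 8 ≤ lam * (2 * lam * q ^ 2 - (2 + 6 * β) * q + 4 * (1 - β) * ξ ^ 2) := by
    have i1 : 16 ≤ lam * (4 * (1 - β) * ξ ^ 2) := by
      have : lam * (1 - β) * (4 * x₀ ^ 2) ≤ lam * (1 - β) * ξ ^ 2 :=
        mul_le_mul_of_nonneg_left hξ (mul_nonneg hlam.le (by linarith))
      nlinarith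
    have i2 : 0 ≤ 2 * (lam * q) ^ 2 - (2 + 6 * β) * (lam * q) + 8 := by
      nlinarith [sq_nonneg (lam * q - (2 + 6 * β) / 4)]
    nlinarith
  have e2 : 1 ≤ Φ ^ 3 := one_le_pow₀ hΦ
  have e3 : 0 < lam ^ 2 := by positivity
  calc 8 * lam ^ 2 = lam ^ 2 * 1 * 8 := by ring
    _ ≤ lam ^ 2 * Φ ^ 3 * (lam * (2 * lam * q ^ 2 - (2 + 6 * β) * q + 4 * (1 - β) * ξ ^ 2)) := by
      gcongr
    _ = _ := by ring

section coefficients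

variable (β x₀ C₀ lam : ℝ)

/-- Normalised coefficient of `∂_h v`. -/
noncomputable def nA (s h t x : ℝ) : ℝ := lam * A1 (psi β x₀ C₀) (phi β x₀ C₀ lam) s h t x

/-- Normalised coefficient of `v` in `P_{h,1}`. -/
noncomputable def nB (s h t x : ℝ) : ℝ :=
  lam ^ 2 * (phi β x₀ C₀ lam t x ^ 2 * pt (psi β x₀ C₀) t x ^ 2
    - A2 (psi β x₀ C₀) (phi β x₀ C₀ lam) s h t x)

/-- Coefficient of `Δ_h v`. -/
noncomputable def nC (s h t x : ℝ) : ℝ := 1 + A0 (psi β x₀ C₀) (phi β x₀ C₀ lam) lam s h t x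

/-- Normalised coefficient of `v` in `P_{h,2}`. -/
noncomputable def nD (s h t x : ℝ) : ℝ :=
  lam ^ 2 * (phi β x₀ C₀ lam t x * |pt (psi β x₀ C₀) t x| ^ 2
    - A3 (psi β x₀ C₀) (phi β x₀ C₀ lam) s h t x)

/-- Normalised coefficient of `∂_t v`. -/
noncomputable def nE (_s _h t x : ℝ) : ℝ := lam * (phi β x₀ C₀ lam t x * pt (psi β x₀ C₀) t x)

/-- Limit of the coefficient `d`. -/
noncomputable def limD (t x : ℝ) : ℝ :=
  lam ^ 2 * phi β x₀ C₀ lam t x * ((-2 * β * t) ^ 2 - (2 * (x - x₀)) ^ 2)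

/-- Limit of the time derivative of `e`. -/
noncomputable def limEt (t x : ℝ) : ℝ :=
  lam ^ 2 * phi β x₀ C₀ lam t x * (-2 * β * t) ^ 2 - 2 * β * lam * phi β x₀ C₀ lam t x

/-- Limit of the space derivative of `a`. -/
noncomputable def limAx (t x : ℝ) : ℝ :=
  lam ^ 2 * phi β x₀ C₀ lam t x * (2 * (x - x₀)) ^ 2 + 2 * lam * phi β x₀ C₀ lam t x

/-- Common limit of the time derivative of `a` and the space derivative of `e`. -/
noncomputable def limAt (t x : ℝ) : ℝ :=
  lam ^ 2 * phi β x₀ C₀ lam t x * (-2 * β * t) * (2 * (x - x₀))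

/-- Limit of `-b d + ∂_t (b e)`. -/
noncomputable def limZ (t x : ℝ) : ℝ :=
  phi β x₀ C₀ lam t x ^ 3 * (-(lam ^ 4 * ((-2 * β * t) ^ 2 - (2 * (x - x₀)) ^ 2) ^ 2)
    + lam ^ 3 * (3 * lam * ((-2 * β * t) ^ 2 - (2 * (x - x₀)) ^ 2) * (-2 * β * t) ^ 2
      - 4 * β * (-2 * β * t) ^ 2 - 2 * β * ((-2 * β * t) ^ 2 - (2 * (x - x₀)) ^ 2)))

/-- Limit of `∂_x (b a)`. -/
noncomputable def limBAx (t x : ℝ) : ℝ :=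
  lam ^ 3 * phi β x₀ C₀ lam t x ^ 3 *
    (3 * lam * ((-2 * β * t) ^ 2 - (2 * (x - x₀)) ^ 2) * (2 * (x - x₀)) ^ 2
      - 4 * (2 * (x - x₀)) ^ 2 + 2 * ((-2 * β * t) ^ 2 - (2 * (x - x₀)) ^ 2))

variable (T : ℝ)

lemma approx_nA : Approx T (nA β x₀ C₀ lam)
    (fun t x => lam * phi β x₀ C₀ lam t x * (2 * (x - x₀)))
    (limAt β x₀ C₀ lam) (limAx β x₀ C₀ lam) :=
  ((approx_A1 β x₀ C₀ lam T).const_mul lam).congr (fun _ _ _ _ => rfl) (fun _ _ => by ring)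
    (fun _ _ => by simp only [limAt]; ring) (fun _ _ => by simp only [limAx]; ring)

lemma approx_nC : Approx T (nC β x₀ C₀ lam) (fun _ _ => 1) (fun _ _ => 0) (fun _ _ => 0) :=
  approx_one_add_A0 β x₀ C₀ lam T

lemma approx_nE : Approx T (nE β x₀ C₀ lam)
    (fun t x => lam * phi β x₀ C₀ lam t x * (-2 * β * t))
    (limEt β x₀ C₀ lam) (limAt β x₀ C₀ lam) :=
  (((approx_phi β x₀ C₀ lam T).mul (approx_pt_psi β x₀ C₀ T)).const_mul lam).congr
    (fun _ _ _ _ => rfl) (fun _ _ => by ring)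
    (fun _ _ => by simp only [limEt]; ring) (fun _ _ => by simp only [limAt]; ring)

lemma approx_nD : Approx T (nD β x₀ C₀ lam) (limD β x₀ C₀ lam)
    (fun t x => lam ^ 3 * phi β x₀ C₀ lam t x * (-2 * β * t) *
      ((-2 * β * t) ^ 2 - (2 * (x - x₀)) ^ 2)
      - 4 * β * lam ^ 2 * phi β x₀ C₀ lam t x * (-2 * β * t))
    (fun t x => lam ^ 3 * phi β x₀ C₀ lam t x * (2 * (x - x₀)) *
      ((-2 * β * t) ^ 2 - (2 * (x - x₀)) ^ 2)
      - 4 * lam ^ 2 * phi β x₀ C₀ lam t x * (2 * (x - x₀))) :=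
  ((((approx_phi β x₀ C₀ lam T).mul ((approx_pt_psi β x₀ C₀ T).mul (approx_pt_psi β x₀ C₀ T))).sub
    (approx_A3 β x₀ C₀ lam T)).const_mul (lam ^ 2)).congr
    (fun _ _ _ _ => by simp only [nD, sq_abs]; ring) (fun _ _ => by simp only [limD]; ring)
    (fun _ _ => by ring) (fun _ _ => by ring)

lemma approx_nB : Approx T (nB β x₀ C₀ lam)
    (fun t x => lam ^ 2 * phi β x₀ C₀ lam t x ^ 2 * ((-2 * β * t) ^ 2 - (2 * (x - x₀)) ^ 2))
    (fun t x => lam ^ 2 * phi β x₀ C₀ lam t x ^ 2 * (2 * lam * (-2 * β * t) *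
      ((-2 * β * t) ^ 2 - (2 * (x - x₀)) ^ 2) - 4 * β * (-2 * β * t)))
    (fun t x => lam ^ 2 * phi β x₀ C₀ lam t x ^ 2 * (2 * lam * (2 * (x - x₀)) *
      ((-2 * β * t) ^ 2 - (2 * (x - x₀)) ^ 2) - 4 * (2 * (x - x₀)))) :=
  (((((approx_phi β x₀ C₀ lam T).mul (approx_phi β x₀ C₀ lam T)).mul
      ((approx_pt_psi β x₀ C₀ T).mul (approx_pt_psi β x₀ C₀ T))).sub
    (approx_A2 β x₀ C₀ lam T)).const_mul (lam ^ 2)).congr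
    (fun _ _ _ _ => by simp only [nB]; ring) (fun _ _ => by ring)
    (fun _ _ => by ring) (fun _ _ => by ring)

lemma approx_nC_mul {f : ℝ → ℝ → ℝ → ℝ → ℝ} {g gt gx : ℝ → ℝ → ℝ} (H : Approx T f g gt gx) :
    Approx T (fun s h t x => nC β x₀ C₀ lam s h t x * f s h t x) g gt gx :=
  ((approx_nC β x₀ C₀ lam T).mul H).congr (fun _ _ _ _ => rfl) (fun _ _ => by ring)
    (fun _ _ => by ring) (fun _ _ => by ring)

/-- The coefficient `-b d + ∂_t (b e)` at a point. -/
lemma nZ_estimate : ∃ C, 0 ≤ C ∧ ∀ s h t x, 1 ≤ s → 0 < h → s * h ≤ 1 → t ∈ Icc (-T) T →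
    x ∈ Icc (0 : ℝ) 1 →
    |-(nB β x₀ C₀ lam s h t x * nD β x₀ C₀ lam s h t x)
      + (pt (nB β x₀ C₀ lam s h) t x * nE β x₀ C₀ lam s h t x
        + nB β x₀ C₀ lam s h t x * pt (nE β x₀ C₀ lam s h) t x) - limZ β x₀ C₀ lam t x|
      ≤ C * (s * h) := by
  -- No derivative of -bd + ∂_t(be) is needed, only its value. It is read off from the value
  -- estimate for bd and the time-derivative estimate for be.
  obtain ⟨C, hC, H⟩ := (approx_nB β x₀ C₀ lam T).mul (approx_nD β x₀ C₀ lam T)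
  obtain ⟨D, hD, K⟩ := (approx_nB β x₀ C₀ lam T).mul (approx_nE β x₀ C₀ lam T)
  obtain ⟨E, hE, HB⟩ := approx_nB β x₀ C₀ lam T
  obtain ⟨F, hF, HE⟩ := approx_nE β x₀ C₀ lam T
  refine ⟨C + D, by positivity, fun s h t x hs hh hsh ht hx => ?_⟩
  have e1 := (H s h t x hs hh hsh ht hx).2.1
  have e2 := (K s h t x hs hh hsh ht hx).2.2.1
  have d1 := (HB s h t x hs hh hsh ht hx).1
  have d2 := (HE s h t x hs hh hsh ht hx).1
  rw [deriv_fun_mul d1 d2] at e2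
  have := (abs_sub _ _).trans (add_le_add e2 e1)
  rw [← add_mul, add_comm D C] at this
  refine le_trans (le_of_eq ?_) this
  congr 1
  simp only [limZ, limD, limEt, pt]
  ring

lemma approx_nBA : Approx T (fun s h t x => nB β x₀ C₀ lam s h t x * nA β x₀ C₀ lam s h t x)
    (fun t x => lam ^ 2 * phi β x₀ C₀ lam t x ^ 2 * ((-2 * β * t) ^ 2 - (2 * (x - x₀)) ^ 2)
      * (lam * phi β x₀ C₀ lam t x * (2 * (x - x₀))))
    (fun t x => lam ^ 2 * phi β x₀ C₀ lam t x ^ 2 * (2 * lam * (-2 * β * t) *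
      ((-2 * β * t) ^ 2 - (2 * (x - x₀)) ^ 2) - 4 * β * (-2 * β * t))
      * (lam * phi β x₀ C₀ lam t x * (2 * (x - x₀))) +
      lam ^ 2 * phi β x₀ C₀ lam t x ^ 2 * ((-2 * β * t) ^ 2 - (2 * (x - x₀)) ^ 2)
      * limAt β x₀ C₀ lam t x)
    (limBAx β x₀ C₀ lam) :=
  ((approx_nB β x₀ C₀ lam T).mul (approx_nA β x₀ C₀ lam T)).congr (fun _ _ _ _ => rfl)
    (fun _ _ => rfl) (fun _ _ => rfl) (fun _ _ => by simp only [limBAx, limAx]; ring)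

lemma limZ_sub_limBAx (t x : ℝ) : limZ β x₀ C₀ lam t x - limBAx β x₀ C₀ lam t x
    = lam ^ 3 * phi β x₀ C₀ lam t x ^ 3 *
      (2 * lam * ((-2 * β * t) ^ 2 - (2 * (x - x₀)) ^ 2) ^ 2
      - (2 + 6 * β) * ((-2 * β * t) ^ 2 - (2 * (x - x₀)) ^ 2)
      + 4 * (1 - β) * (2 * (x - x₀)) ^ 2) := by
  simp only [limZ, limBAx]; ring

/-- Serves to compare the coefficients at x_{j+1} with the limit at x_j, so that the whole cell
refers to a single point. -/
lemma Smooth₂.shift {g : ℝ → ℝ → ℝ} (hg : Smooth₂ g) (T : ℝ) :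
    ∃ C, 0 ≤ C ∧ ∀ s h t x, 1 ≤ s → 0 < h → s * h ≤ 1 → t ∈ Icc (-T) T →
      x ∈ Icc (0 : ℝ) 1 → x + h ≤ 1 → |g t (x + h) - g t x| ≤ C * (s * h) := by
  obtain ⟨B, hB, H⟩ := hg.lipschitz_snd (-T) T 0 1
  refine ⟨B, hB, fun s h t x hs hh hsh ht hx hxh => ?_⟩
  refine (H t ht x hx (x + h) ⟨by linarith [hx.1], hxh⟩).trans ?_
  rw [add_sub_cancel_left, abs_of_pos hh]
  gcongr
  nlinarith

lemma contDiff_phi :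
    ContDiff ℝ (⊤ : ℕ∞) (fun p : ℝ × ℝ => phi β x₀ C₀ lam p.1 p.2) := smooth_phi β x₀ C₀ lam

lemma smooth_limD : Smooth₂ (limD β x₀ C₀ lam) := by
  have := contDiff_phi β x₀ C₀ lam
  unfold Smooth₂ limD; fun_prop

lemma smooth_limEt : Smooth₂ (limEt β x₀ C₀ lam) := by
  have := contDiff_phi β x₀ C₀ lam
  unfold Smooth₂ limEt; fun_prop

lemma smooth_limAt : Smooth₂ (limAt β x₀ C₀ lam) := by
  have := contDiff_phi β x₀ C₀ lam
  unfold Smooth₂ limAt; fun_prop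

lemma smooth_limZ : Smooth₂ (limZ β x₀ C₀ lam) := by
  have := contDiff_phi β x₀ C₀ lam
  unfold Smooth₂ limZ; fun_prop

end coefficients

/-! ### Lower bound of the cell form for the actual coefficients. -/

lemma scale_le {r p q C K η : ℝ} (hr : 0 ≤ r) (hη : 0 ≤ η) (hC : C ≤ K) (h : |p - q| ≤ C * η) :
    |r * p - r * q| ≤ r * K * η := by
  rw [← mul_sub, abs_mul, abs_of_nonneg hr, mul_assoc]
  gcongr
  exact h.trans (by gcongr)

lemma scale_le_add {r p q q' C D K η : ℝ} (hr : 0 ≤ r) (hη : 0 ≤ η) (hC : C + D ≤ K)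
    (h : |p - q'| ≤ C * η) (h' : |q' - q| ≤ D * η) : |r * p - r * q| ≤ r * K * η :=
  scale_le hr hη hC ((abs_sub_le p q' q).trans (by rw [add_mul]; exact add_le_add h h'))

lemma scale_bound {r p q C K η : ℝ} (hr : 0 ≤ r) (hη1 : η ≤ 1) (hC0 : 0 ≤ C)
    (hC : 2 * C ≤ K) (h : |p - q| ≤ C * η) (hq : |q| ≤ C) : |r * p| ≤ r * K := by
  rw [abs_mul, abs_of_nonneg hr]
  gcongr
  have : |p| ≤ |p - q| + |q| := by simpa using abs_add_le (p - q) q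
  nlinarith

lemma phi_ge_one {β x₀ C₀ lam t x : ℝ} (hlam : 0 < lam) (h : 1 ≤ psi β x₀ C₀ t x) :
    1 ≤ phi β x₀ C₀ lam t x := Real.one_le_exp (by positivity)

lemma four_mul_sq_le_xi_sq {x₀ x : ℝ} (hx₀ : x₀ < 0) (hx : 0 ≤ x) :
    4 * x₀ ^ 2 ≤ (2 * (x - x₀)) ^ 2 := by nlinarith

-- Instance of `edge_quadratic_lower_bound` with Θ = λ²φ, τ = ψ_t, ξ = ψ_x and μ = (1-β)λφ, the
-- limits being taken at the left node. The bound φ ≥ 1, which comes from ψ ≥ 1, then removes φ from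
-- the constants.
set_option maxHeartbeats 1000000 in
lemma edgeForm_lower_bound {β x₀ C₀ lam T : ℝ} (hβ : β ∈ Ioo (0 : ℝ) 1) (hx₀ : x₀ < 0)
    (hψ : ∀ t ∈ Icc (-T) T, ∀ x ∈ Icc (0 : ℝ) 1, 1 ≤ psi β x₀ C₀ t x)
    (hlam : 0 < lam) (hl : lam * ((1 - β) * x₀ ^ 2) = 1) :
    ∃ K, 0 ≤ K ∧ ∀ s h t, 1 ≤ s → 0 < h → s * h ≤ 1 → t ∈ Icc (-T) T → ∀ j : ℕ,
      ((j : ℝ) + 1) * h ≤ 1 → ∀ v w : ℕ → ℝ,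
      (s * ((1 - β) * lam) - K * (s * (s * h) + 1)) * (w j ^ 2 + w (j + 1) ^ 2 + dPlus h v j ^ 2)
        + (s ^ 3 * (4 * lam ^ 2) - K * (s ^ 3 * (s * h) + s ^ 2)) * (v j ^ 2 + v (j + 1) ^ 2)
        - s * K * (w (j + 1) - w j) ^ 2 ≤
      edgeForm h (fun i => s * nA β x₀ C₀ lam s h t (i * h))
        (fun i => s * pt (nA β x₀ C₀ lam s h) t (i * h))
        (fun i => s ^ 2 * nB β x₀ C₀ lam s h t (i * h))
        (fun i => s ^ 2 * pt (nB β x₀ C₀ lam s h) t (i * h))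
        (fun i => nC β x₀ C₀ lam s h t (i * h))
        (fun i => pt (nC β x₀ C₀ lam s h) t (i * h))
        (fun i => s * nD β x₀ C₀ lam s h t (i * h))
        (fun i => s * pt (nD β x₀ C₀ lam s h) t (i * h))
        (fun i => s * nE β x₀ C₀ lam s h t (i * h))
        (fun i => s * pt (nE β x₀ C₀ lam s h) t (i * h)) v w j := by
  obtain ⟨KA, kA, HA⟩ := approx_nA β x₀ C₀ lam T
  obtain ⟨KC, kC, HC⟩ := approx_nC β x₀ C₀ lam T
  obtain ⟨KD, kD, HD⟩ := approx_nD β x₀ C₀ lam T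
  obtain ⟨KE, kE, HE⟩ := approx_nE β x₀ C₀ lam T
  obtain ⟨KCA, kCA, HCA⟩ := approx_nC_mul β x₀ C₀ lam T (approx_nA β x₀ C₀ lam T)
  obtain ⟨KCD, kCD, HCD⟩ := approx_nC_mul β x₀ C₀ lam T (approx_nD β x₀ C₀ lam T)
  obtain ⟨KCE, kCE, HCE⟩ := approx_nC_mul β x₀ C₀ lam T (approx_nE β x₀ C₀ lam T)
  obtain ⟨KZ, kZ, HZ⟩ := nZ_estimate β x₀ C₀ lam T
  obtain ⟨KBA, kBA, HBA⟩ := approx_nBA β x₀ C₀ lam T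
  obtain ⟨LD, lD, SD⟩ := (smooth_limD β x₀ C₀ lam).shift T
  obtain ⟨LE, lE, SE⟩ := (smooth_limEt β x₀ C₀ lam).shift T
  obtain ⟨LA, lA, SA⟩ := (smooth_limAt β x₀ C₀ lam).shift T
  obtain ⟨LZ, lZ, SZ⟩ := (smooth_limZ β x₀ C₀ lam).shift T
  -- One constant dominates all coefficient errors; the factor 2 is what `scale_bound` asks for, an
  -- error plus a limit. The factor 10 in the witness is the loss in `edge_quadratic_lower_bound`.
  set K := 2 * (KA + KC + KD + KE + KCA + KCD + KCE + KZ + KBA + LD + LE + LA + LZ)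
  refine ⟨10 * K, by positivity, fun s h t hs hh hsh ht j hj v w => ?_⟩
  have hs0 : 0 ≤ s := by linarith
  have hs3 : 0 ≤ s ^ 3 := by positivity
  have hη : 0 ≤ s * h := by positivity
  set x : ℝ := j * h with hxdef
  have hx1 : ((j + 1 : ℕ) : ℝ) * h = x + h := by push_cast; ring
  have hxh : x + h ≤ 1 := by rw [hxdef]; linarith
  have hx : x ∈ Icc (0 : ℝ) 1 := ⟨by positivity, by linarith⟩
  have hy : x + h ∈ Icc (0 : ℝ) 1 := ⟨by linarith [hx.1], hxh⟩
  have hΦ := phi_ge_one hlam (hψ t ht x hx)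
  obtain ⟨A1, A2, A3, A4, A5, A6, A7⟩ := HA s h t x hs hh hsh ht hx
  obtain ⟨A1', A2', A3', -⟩ := HA s h t _ hs hh hsh ht hy
  obtain ⟨D1, D2, D3, D4, D5, D6, D7⟩ := HD s h t x hs hh hsh ht hx
  obtain ⟨D1', D2', D3', -, D5', D6', D7'⟩ := HD s h t _ hs hh hsh ht hy
  obtain ⟨E1, E2, E3, E4, E5, E6, E7⟩ := HE s h t x hs hh hsh ht hx
  obtain ⟨E1', E2', E3', -⟩ := HE s h t _ hs hh hsh ht hy
  have C1 := (HC s h t x hs hh hsh ht hx).1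
  have C1' := (HC s h t _ hs hh hsh ht hy).1
  obtain ⟨-, CD2, CD3, CD4, CD5, CD6, CD7⟩ := HCD s h t x hs hh hsh ht hx
  obtain ⟨-, CD2', -⟩ := HCD s h t _ hs hh hsh ht hy
  obtain ⟨-, CE2, CE3, CE4, -⟩ := HCE s h t x hs hh hsh ht hx
  obtain ⟨-, CE2', CE3', -⟩ := HCE s h t _ hs hh hsh ht hy
  obtain ⟨-, -, -, CA4, -⟩ := HCA s h t x hs hh hsh ht hx
  obtain ⟨-, -, -, BA4, -, -, BA7⟩ := HBA s h t x hs hh hsh ht hx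
  have Z1 := HZ s h t x hs hh hsh ht hx
  have Z2 := HZ s h t _ hs hh hsh ht hy
  have shD := SD s h t x hs hh hsh ht hx hxh
  have shE := SE s h t x hs hh hsh ht hx hxh
  have shA := SA s h t x hs hh hsh ht hx hxh
  have shZ := SZ s h t x hs hh hsh ht hx hxh
  -- The estimate for ∂_t(ce) is expanded into c'e + ce', the form in which it enters `edgeForm`.
  rw [deriv_fun_mul C1 E1] at CE3
  rw [deriv_fun_mul C1' E1'] at CE3'
  have m0 : 8 * lam ^ 2 ≤ limZ β x₀ C₀ lam t x - limBAx β x₀ C₀ lam t x := by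
    rw [limZ_sub_limBAx]
    exact zero_order_lower_bound hβ hlam hl (four_mul_sq_le_xi_sq hx₀ hx.1) hΦ
  have hμ : 0 ≤ (1 - β) * lam := mul_nonneg (by linarith [hβ.2]) hlam.le
  have hμΦ : (1 - β) * lam ≤ (1 - β) * lam * phi β x₀ C₀ lam t x :=
    le_mul_of_one_le_right hμ hΦ
  have key := edge_quadratic_lower_bound (s := s) (h := h) (K := K)
    (μ := (1 - β) * lam * phi β x₀ C₀ lam t x) (m := 8 * lam ^ 2)
    (Θ := lam ^ 2 * phi β x₀ C₀ lam t x) (τ := -2 * β * t) (ξ := 2 * (x - x₀))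
    (ke := limEt β x₀ C₀ lam t x) (ka := limAx β x₀ C₀ lam t x) (kd := limD β x₀ C₀ lam t x)
    (kx := limAt β x₀ C₀ lam t x) (kz := limZ β x₀ C₀ lam t x) (kb := limBAx β x₀ C₀ lam t x)
    (wL := w j) (wR := w (j + 1)) (p := dPlus h v j) (vL := v j) (vR := v (j + 1))
    hs hh hsh (by positivity) (hμ.trans hμΦ) (by simp only [limD, limEt, limAx]; ring)
    (by simp only [limD, limEt, limAx]; ring) (by simp only [limAt]) m0
    (A7.trans (by linarith)) (BA7.trans (by linarith)) (by simp only [dPlus]; field_simp)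
    (scale_le hs0 hη (by linarith) D2) (scale_le_add hs0 hη (by linarith) D2' shD)
    (scale_le hs0 hη (by linarith) E3) (scale_le_add hs0 hη (by linarith) E3' shE)
    (scale_le hs0 hη (by linarith) (A4 hxh))
    (scale_le hs0 hη (by linarith) A3) (scale_le_add hs0 hη (by linarith) A3' shA)
    (scale_le hs0 hη (by linarith) (CE4 hxh))
    (scale_le hs0 hη (by linarith) CD2) (scale_le_add hs0 hη (by linarith) CD2' shD)
    (scale_le hs0 hη (by linarith) CE3) (scale_le_add hs0 hη (by linarith) CE3' shE)
    (scale_le hs0 hη (by linarith) (CA4 hxh))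
    (scale_bound hs0 hsh kD (by linarith) D3 D6) (scale_bound hs0 hsh kD (by linarith) D3' D6')
    (scale_bound hs0 hsh kCD (by linarith) (CD4 hxh) CD7)
    (scale_le hs3 hη (by linarith) Z1) (scale_le_add hs3 hη (by linarith) Z2 shZ)
    (scale_le hs3 hη (by linarith) (BA4 hxh))
  have n1 : s * ((1 - β) * lam) * (w j ^ 2 + w (j + 1) ^ 2 + dPlus h v j ^ 2)
      ≤ s * ((1 - β) * lam * phi β x₀ C₀ lam t x)
        * (w j ^ 2 + w (j + 1) ^ 2 + dPlus h v j ^ 2) := by gcongr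
  have n2 : 0 ≤ s * K * (w (j + 1) - w j) ^ 2 := by positivity
  have e : ∀ r : ℝ, r = edgeForm h (fun i => s * nA β x₀ C₀ lam s h t (i * h))
        (fun i => s * pt (nA β x₀ C₀ lam s h) t (i * h))
        (fun i => s ^ 2 * nB β x₀ C₀ lam s h t (i * h))
        (fun i => s ^ 2 * pt (nB β x₀ C₀ lam s h) t (i * h))
        (fun i => nC β x₀ C₀ lam s h t (i * h))
        (fun i => pt (nC β x₀ C₀ lam s h) t (i * h))
        (fun i => s * nD β x₀ C₀ lam s h t (i * h))
        (fun i => s * pt (nD β x₀ C₀ lam s h) t (i * h))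
        (fun i => s * nE β x₀ C₀ lam s h t (i * h))
        (fun i => s * pt (nE β x₀ C₀ lam s h) t (i * h)) v w j →
      (s * ((1 - β) * lam) - 10 * K * (s * (s * h) + 1))
          * (w j ^ 2 + w (j + 1) ^ 2 + dPlus h v j ^ 2)
        + (s ^ 3 * (4 * lam ^ 2) - 10 * K * (s ^ 3 * (s * h) + s ^ 2)) * (v j ^ 2 + v (j + 1) ^ 2)
        - s * (10 * K) * (w (j + 1) - w j) ^ 2 ≤ r → _ := fun r hr hle => hle.trans_eq hr
  refine e _ ?_ (le_trans ?_ key)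
  · simp only [edgeForm, dPlus, hx1, ← hxdef, pt]
    ring
  · clear_value K
    clear * - n1 n2
    linarith

/-! ### Cross-product and pointwise-in-time estimates. -/

lemma mesh_pos (N : ℕ) : 0 < mesh N := by unfold mesh; positivity

lemma mesh_mul (N : ℕ) : ((N : ℝ) + 1) * mesh N = 1 := by
  unfold mesh; field_simp

/-- The time derivative of `energy`. -/
noncomputable def weightedEnergyDot (β x₀ C₀ lam T s : ℝ) (N : ℕ) (v : ℕ → ℝ → ℝ) (t : ℝ) : ℝ :=
  energyDot N (mesh N) (fun i => s * nA β x₀ C₀ lam s (mesh N) t (i * mesh N))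
    (fun i => s * pt (nA β x₀ C₀ lam s (mesh N)) t (i * mesh N))
    (fun i => s ^ 2 * nB β x₀ C₀ lam s (mesh N) t (i * mesh N))
    (fun i => s ^ 2 * pt (nB β x₀ C₀ lam s (mesh N)) t (i * mesh N))
    (fun i => nC β x₀ C₀ lam s (mesh N) t (i * mesh N))
    (fun i => pt (nC β x₀ C₀ lam s (mesh N)) t (i * mesh N))
    (fun i => s * nD β x₀ C₀ lam s (mesh N) t (i * mesh N))
    (fun i => s * pt (nD β x₀ C₀ lam s (mesh N)) t (i * mesh N))
    (fun i => s * nE β x₀ C₀ lam s (mesh N) t (i * mesh N))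
    (fun i => s * pt (nE β x₀ C₀ lam s (mesh N)) t (i * mesh N))
    (fun i => v i t) (fun i => dt T (v i) t) (fun i => dtt T (v i) t)

lemma Ph1_eq (β x₀ C₀ lam T s h t : ℝ) (v : ℕ → ℝ → ℝ) (j : ℕ) :
    Ph1 T (psi β x₀ C₀) (phi β x₀ C₀ lam) lam s h v j t
      = dtt T (v j) t - nC β x₀ C₀ lam s h t (j * h) * lapl h (fun i => v i t) j
        + s ^ 2 * nB β x₀ C₀ lam s h t (j * h) * v j t := by
  simp only [Ph1, nC, nB]; ring

lemma Ph2_eq (β x₀ C₀ lam T s h t : ℝ) (v : ℕ → ℝ → ℝ) (j : ℕ) :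
    Ph2 T (psi β x₀ C₀) (phi β x₀ C₀ lam) lam s h v j t
      = -(s * nD β x₀ C₀ lam s h t (j * h) * v j t)
        - 2 * (s * nE β x₀ C₀ lam s h t (j * h)) * dt T (v j) t
        + 2 * (s * nA β x₀ C₀ lam s h t (j * h)) * dCent h (fun i => v i t) j := by
  simp only [Ph2, nD, nE, nA]; ring

/-- Because v and w vanish at both ends, summing over cells counts every nodal square twice. One
copy suffices, and the other is dropped using A, B ≥ 0. -/
lemma sum_edge_bound (N : ℕ) {h A B C : ℝ} (hh : 0 ≤ h) (hA : 0 ≤ A) (hB : 0 ≤ B)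
    {v w p q : ℕ → ℝ} (v0 : v 0 = 0) (vN : v (N + 1) = 0) (w0 : w 0 = 0) (wN : w (N + 1) = 0)
    (H : ∀ j ∈ Finset.Icc 0 N, A * (w j ^ 2 + w (j + 1) ^ 2 + p j ^ 2)
      + B * (v j ^ 2 + v (j + 1) ^ 2) - C * (w (j + 1) - w j) ^ 2 ≤ q j) :
    A * (h * ∑ j ∈ Finset.Icc 1 N, w j ^ 2) + A * (h * ∑ j ∈ Finset.Icc 0 N, p j ^ 2)
      + B * (h * ∑ j ∈ Finset.Icc 1 N, v j ^ 2)
      - C * (h * ∑ j ∈ Finset.Icc 0 N, (w (j + 1) - w j) ^ 2)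
      ≤ h * ∑ j ∈ Finset.Icc 0 N, q j := by
  have e1 := sum_node_eq_edge N (fun j => w j ^ 2)
  have e2 := sum_node_eq_edge N (fun j => v j ^ 2)
  simp only [v0, vN, w0, wN] at e1 e2
  have n1 : 0 ≤ ∑ j ∈ Finset.Icc 1 N, w j ^ 2 := Finset.sum_nonneg fun _ _ => sq_nonneg _
  have n2 : 0 ≤ ∑ j ∈ Finset.Icc 1 N, v j ^ 2 := Finset.sum_nonneg fun _ _ => sq_nonneg _
  have s := Finset.sum_le_sum H
  simp only [Finset.sum_add_distrib, Finset.sum_sub_distrib, ← Finset.mul_sum] at s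
  simp only [← Finset.sum_div, Finset.sum_add_distrib] at e1 e2
  have hh1 : A * (∑ j ∈ Finset.Icc 1 N, w j ^ 2) + A * (∑ j ∈ Finset.Icc 0 N, p j ^ 2)
      + B * (∑ j ∈ Finset.Icc 1 N, v j ^ 2)
      - C * (∑ j ∈ Finset.Icc 0 N, (w (j + 1) - w j) ^ 2)
      ≤ ∑ j ∈ Finset.Icc 0 N, q j := by
    have f1 := mul_nonneg hA n1
    have f2 := mul_nonneg hB n2
    have g1 : A * (∑ j ∈ Finset.Icc 0 N, w j ^ 2 + ∑ j ∈ Finset.Icc 0 N, w (j + 1) ^ 2)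
      = 2 * (A * ∑ j ∈ Finset.Icc 1 N, w j ^ 2) := by rw [e1]; ring
    have g2 : B * (∑ j ∈ Finset.Icc 0 N, v j ^ 2 + ∑ j ∈ Finset.Icc 0 N, v (j + 1) ^ 2)
      = 2 * (B * ∑ j ∈ Finset.Icc 1 N, v j ^ 2) := by rw [e2]; ring
    linarith
  have := mul_le_mul_of_nonneg_left hh1 hh
  linarith

lemma cross_product_lower_bound {β x₀ C₀ lam T : ℝ} (hβ : β ∈ Ioo (0 : ℝ) 1) (hx₀ : x₀ < 0)
    (hψ : ∀ t ∈ Icc (-T) T, ∀ x ∈ Icc (0 : ℝ) 1, 1 ≤ psi β x₀ C₀ t x)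
    (hlam : 0 < lam) (hl : lam * ((1 - β) * x₀ ^ 2) = 1) :
    ∃ s₀ > 0, ∃ ε₀ > 0, ∃ κ > 0, ∃ K ≥ 0, 1 ≤ s₀ ∧ ε₀ ≤ 1 ∧ ∀ N : ℕ,
      ∀ s ∈ Ioo s₀ (ε₀ / mesh N), ∀ v : ℕ → ℝ → ℝ, ∀ t ∈ Icc (-T) T,
      v 0 t = 0 → v (N + 1) t = 0 → dt T (v 0) t = 0 → dt T (v (N + 1)) t = 0 →
      κ * (s * intOpen N (fun j => |dt T (v j) t| ^ 2)
        + s * intLeft N (fun j => |dPlus (mesh N) (fun i => v i t) j| ^ 2)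
        + s ^ 3 * intOpen N (fun j => |v j t| ^ 2))
        + weightedEnergyDot β x₀ C₀ lam T s N v t
      ≤ intOpen N (fun j => Ph1 T (psi β x₀ C₀) (phi β x₀ C₀ lam) lam s (mesh N) v j t
          * Ph2 T (psi β x₀ C₀) (phi β x₀ C₀ lam) lam s (mesh N) v j t)
        + K * s * |dMinus (mesh N) (fun i => v i t) (N + 1)| ^ 2
        + K * s * intLeft N (fun j => |mesh N * dPlus (mesh N) (fun i => dt T (v i) t) j| ^ 2) := by
  obtain ⟨K, hK, HK⟩ := edgeForm_lower_bound hβ hx₀ hψ hlam hl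
  obtain ⟨C, hC, HC⟩ := approx_nC_mul β x₀ C₀ lam T (approx_nA β x₀ C₀ lam T)
  set μ := (1 - β) * lam
  have hμ : 0 < μ := mul_pos (by linarith [hβ.2]) hlam
  set L := K + 1
  set D := C + 1
  have hL : 0 < L := by positivity
  have hD : 0 < D := by positivity
  have hx0' : 0 < -x₀ := by linarith
  -- The first-order errors K·s·sh and K are each at most sμ/4, and the zero-order errors K·s³·sh
  -- and K·s² each at most s³λ²: half of the main terms remains, whence κ. The last entry of ε₀
  -- fixes the sign of the boundary term at x = 0. Taking L = K + 1 and D = C + 1 avoids division by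
  -- zero.
  refine ⟨max 1 (max (4 * L / μ) (L / lam ^ 2)), by positivity,
    min 1 (min (min (μ / (4 * L)) (lam ^ 2 / L)) (lam * (2 * (-x₀)) / D)), by positivity,
    min (μ / 2) (2 * lam ^ 2), by positivity, K + 2 * C, by positivity, le_max_left _ _,
    min_le_left _ _, fun N s hs v t ht v0 vN w0 wN => ?_⟩
  set h := mesh N with hh
  have hpos : 0 < h := mesh_pos N
  obtain ⟨hs1, hs2⟩ := hs
  rw [lt_div_iff₀ hpos] at hs2
  simp only [max_lt_iff, lt_min_iff] at hs1 hs2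
  obtain ⟨s1, s2, s3⟩ := hs1
  obtain ⟨e1, ⟨e2, e3⟩, e4⟩ := hs2
  have hs0 : 0 < s := by linarith
  rw [div_lt_iff₀ hμ] at s2
  rw [div_lt_iff₀ (by positivity)] at s3
  rw [lt_div_iff₀ (by positivity)] at e2
  rw [lt_div_iff₀ hL] at e3
  rw [lt_div_iff₀ hD] at e4
  have hη : 0 < s * h := by positivity
  have hA : s * μ / 2 ≤ s * μ - K * (s * (s * h) + 1) := by
    have i1 : s * (s * h * (4 * L)) ≤ s * μ := mul_le_mul_of_nonneg_left e2.le hs0.le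
    have i2 : K * (s * (s * h) + 1) ≤ L * (s * (s * h) + 1) := by gcongr; simp [L]
    nlinarith
  have hB : s ^ 3 * (2 * lam ^ 2) ≤ s ^ 3 * (4 * lam ^ 2) - K * (s ^ 3 * (s * h) + s ^ 2) := by
    have i1 : s ^ 3 * (s * h * L) ≤ s ^ 3 * lam ^ 2 := by gcongr
    have i3 : s ^ 2 * L ≤ s ^ 2 * (s * lam ^ 2) := by gcongr
    have i2 : K * (s ^ 3 * (s * h) + s ^ 2) ≤ L * (s ^ 3 * (s * h) + s ^ 2) := by
      gcongr; simp [L]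
    nlinarith
  have ident := cross_product_identity N hpos.ne'
    (fun i => s * nA β x₀ C₀ lam s h t (i * h))
    (fun i => s * pt (nA β x₀ C₀ lam s h) t (i * h))
    (fun i => s ^ 2 * nB β x₀ C₀ lam s h t (i * h))
    (fun i => s ^ 2 * pt (nB β x₀ C₀ lam s h) t (i * h))
    (fun i => nC β x₀ C₀ lam s h t (i * h))
    (fun i => pt (nC β x₀ C₀ lam s h) t (i * h))
    (fun i => s * nD β x₀ C₀ lam s h t (i * h))
    (fun i => s * pt (nD β x₀ C₀ lam s h) t (i * h))
    (fun i => s * nE β x₀ C₀ lam s h t (i * h))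
    (fun i => s * pt (nE β x₀ C₀ lam s h) t (i * h))
    (fun i => v i t) (fun i => dt T (v i) t) (fun i => dtt T (v i) t) v0 vN w0 wN
  have hprod : h * ∑ j ∈ Finset.Icc 1 N, (dtt T (v j) t
        - nC β x₀ C₀ lam s h t (j * h) * lapl h (fun i => v i t) j
        + s ^ 2 * nB β x₀ C₀ lam s h t (j * h) * v j t)
        * (-(s * nD β x₀ C₀ lam s h t (j * h) * v j t)
          - 2 * (s * nE β x₀ C₀ lam s h t (j * h)) * dt T (v j) t
          + 2 * (s * nA β x₀ C₀ lam s h t (j * h)) * dCent h (fun i => v i t) j)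
      = intOpen N (fun j => Ph1 T (psi β x₀ C₀) (phi β x₀ C₀ lam) lam s h v j t
          * Ph2 T (psi β x₀ C₀) (phi β x₀ C₀ lam) lam s h v j t) := by
    simp only [intOpen, Ph1_eq, Ph2_eq, ← hh]
  have hedge := sum_edge_bound N (h := h) (A := s * μ - K * (s * (s * h) + 1))
    (B := s ^ 3 * (4 * lam ^ 2) - K * (s ^ 3 * (s * h) + s ^ 2)) (C := s * K)
    (v := fun i => v i t) (w := fun i => dt T (v i) t) (p := dPlus h (fun i => v i t))
    hpos.le (le_trans (by positivity) hA) (le_trans (by positivity) hB) v0 vN w0 wN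
    (fun j hj => HK s h t s1.le hpos e1.le ht j (by
      have : (j : ℝ) ≤ N := by exact_mod_cast (Finset.mem_Icc.1 hj).2
      exact (mul_le_mul_of_nonneg_right (by linarith) hpos.le).trans_eq (mesh_mul N)) (fun i => v i t) (fun i => dt T (v i) t))
  have b0 := HC s h t 0 s1.le hpos e1.le ht (by norm_num)
  have b1 := HC s h t 1 s1.le hpos e1.le ht (by norm_num)
  have hΦ0 := phi_ge_one hlam (hψ t ht 0 (by norm_num))
  -- The limit of ca/s at x = 0 is 2λφ|x₀| ≥ 2λ|x₀|, using x₀ < 0, and it exceeds the error C·sh.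
  have bpos : 0 ≤ nC β x₀ C₀ lam s h t 0 * (s * nA β x₀ C₀ lam s h t 0) := by
    have i1 := (abs_le.1 b0.2.1).1
    have i2 : lam * (2 * -x₀) ≤ lam * phi β x₀ C₀ lam t 0 * (2 * (0 - x₀)) := by
      rw [zero_sub]
      exact mul_le_mul_of_nonneg_right (le_mul_of_one_le_right hlam.le hΦ0) (by linarith)
    have i3 : C * (s * h) ≤ s * h * D := by simp only [D]; linarith
    have i4 : 0 ≤ nC β x₀ C₀ lam s h t 0 * nA β x₀ C₀ lam s h t 0 := by linarith
    calc 0 ≤ s * (nC β x₀ C₀ lam s h t 0 * nA β x₀ C₀ lam s h t 0) := by positivity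
      _ = _ := by ring
  -- At x = 1 only an upper bound is needed: this term has the wrong sign and becomes the
  -- observation.
  have bone : nC β x₀ C₀ lam s h t 1 * (s * nA β x₀ C₀ lam s h t 1) ≤ s * (2 * C) := by
    have := scale_bound (K := 2 * C) hs0.le e1.le hC le_rfl b1.2.1 b1.2.2.2.2.1
    calc _ = s * (nC β x₀ C₀ lam s h t 1 * nA β x₀ C₀ lam s h t 1) := by ring
      _ ≤ _ := (le_abs_self _).trans this
  have hN1 : ((N + 1 : ℕ) : ℝ) * h = 1 := by push_cast; exact mesh_mul N
  have h00 : ((0 : ℕ) : ℝ) * h = 0 := by simp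
  simp only [hN1, h00] at ident
  rw [hprod] at ident
  have dm : dMinus h (fun i => v i t) (N + 1) = dPlus h (fun i => v i t) N := by
    simp [dMinus, dPlus]
  have dw : intLeft N (fun j => |h * dPlus h (fun i => dt T (v i) t) j| ^ 2)
      = h * ∑ j ∈ Finset.Icc 0 N, (dt T (v (j + 1)) t - dt T (v j) t) ^ 2 := by
    simp only [intLeft, ← hh]
    congr 1
    refine Finset.sum_congr rfl fun j _ => ?_
    rw [sq_abs, dPlus, mul_div_cancel₀ _ hpos.ne']
  rw [dm, dw]
  simp only [intOpen, intLeft, sq_abs, ← hh] at ident hedge ⊢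
  rw [weightedEnergyDot]
  set W := h * ∑ j ∈ Finset.Icc 1 N, dt T (v j) t ^ 2
  set V := h * ∑ j ∈ Finset.Icc 1 N, v j t ^ 2
  set P := h * ∑ j ∈ Finset.Icc 0 N, dPlus h (fun i => v i t) j ^ 2
  set Z := h * ∑ j ∈ Finset.Icc 0 N, (dt T (v (j + 1)) t - dt T (v j) t) ^ 2
  have nW : 0 ≤ W := mul_nonneg hpos.le (Finset.sum_nonneg fun _ _ => sq_nonneg _)
  have nV : 0 ≤ V := mul_nonneg hpos.le (Finset.sum_nonneg fun _ _ => sq_nonneg _)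
  have nP : 0 ≤ P := mul_nonneg hpos.le (Finset.sum_nonneg fun _ _ => sq_nonneg _)
  have nZ : 0 ≤ Z := mul_nonneg hpos.le (Finset.sum_nonneg fun _ _ => sq_nonneg _)
  have m1 : min (μ / 2) (2 * lam ^ 2) * (s * W)
      ≤ (s * μ - K * (s * (s * h) + 1)) * W := by
    calc _ ≤ μ / 2 * (s * W) := by gcongr; exact min_le_left _ _
      _ = s * μ / 2 * W := by ring
      _ ≤ _ := by gcongr
  have m2 : min (μ / 2) (2 * lam ^ 2) * (s * P)
      ≤ (s * μ - K * (s * (s * h) + 1)) * P := by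
    calc _ ≤ μ / 2 * (s * P) := by gcongr; exact min_le_left _ _
      _ = s * μ / 2 * P := by ring
      _ ≤ _ := by gcongr
  have m3 : min (μ / 2) (2 * lam ^ 2) * (s ^ 3 * V)
      ≤ (s ^ 3 * (4 * lam ^ 2) - K * (s ^ 3 * (s * h) + s ^ 2)) * V := by
    calc _ ≤ 2 * lam ^ 2 * (s ^ 3 * V) := by gcongr; exact min_le_right _ _
      _ = s ^ 3 * (2 * lam ^ 2) * V := by ring
      _ ≤ _ := by gcongr
  have m4 := mul_le_mul_of_nonneg_right bone (sq_nonneg (dPlus h (fun i => v i t) N))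
  have m5 := mul_nonneg bpos (sq_nonneg (dPlus h (fun i => v i t) 0))
  have m6 : 0 ≤ K * s * dPlus h (fun i => v i t) N ^ 2 := by positivity
  have m7 : 0 ≤ 2 * C * s * Z := by positivity
  rw [ident]
  linarith

/-- The zeroth-order remainder coefficient of `P_h - P_{h,1} - P_{h,2}`. -/
noncomputable def nR (β x₀ C₀ lam s h t x : ℝ) : ℝ :=
  lam * (-2 * β * phi β x₀ C₀ lam t x - A4 (psi β x₀ C₀) (phi β x₀ C₀ lam) s h t x)

lemma nR_bounded (β x₀ C₀ lam T : ℝ) : ∃ K, 0 ≤ K ∧ ∀ s h t x, 1 ≤ s → 0 < h → s * h ≤ 1 →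
    t ∈ Icc (-T) T → x ∈ Icc (0 : ℝ) 1 → |nR β x₀ C₀ lam s h t x| ≤ K := by
  obtain ⟨C, hC, H⟩ := (((approx_phi β x₀ C₀ lam T).const_mul (-2 * β)).sub
    (approx_A4 β x₀ C₀ lam T)).const_mul lam
  refine ⟨1 * (2 * C), by positivity, fun s h t x hs hh hsh ht hx => ?_⟩
  have := H s h t x hs hh hsh ht hx
  simpa [nR] using scale_bound (K := 2 * C) zero_le_one hsh hC le_rfl this.2.1 this.2.2.2.2.1

/-- Expansion of |P₁v + P₂v|² = |P_h v + sRv|². The splitting of P_h v is an assumption at the given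
t, since for v in H² it is established only at almost every time. -/
lemma pointwise_estimate {β x₀ C₀ lam T : ℝ} (hβ : β ∈ Ioo (0 : ℝ) 1) (hx₀ : x₀ < 0)
    (hψ : ∀ t ∈ Icc (-T) T, ∀ x ∈ Icc (0 : ℝ) 1, 1 ≤ psi β x₀ C₀ t x)
    (hlam : 0 < lam) (hl : lam * ((1 - β) * x₀ ^ 2) = 1) :
    ∃ s₀ > 0, ∃ ε₀ > 0, ∃ M > 0, ∃ r : ℝ, ∀ N : ℕ,
      ∀ s ∈ Ioo s₀ (ε₀ / mesh N), ∀ v : ℕ → ℝ → ℝ, ∀ t ∈ Icc (-T) T,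
      v 0 t = 0 → v (N + 1) t = 0 → dt T (v 0) t = 0 → dt T (v (N + 1)) t = 0 →
      (∀ j ∈ Finset.Icc 1 N, Ph T (phi β x₀ C₀ lam) s (mesh N) v j t
        = Ph1 T (psi β x₀ C₀) (phi β x₀ C₀ lam) lam s (mesh N) v j t
          + Ph2 T (psi β x₀ C₀) (phi β x₀ C₀ lam) lam s (mesh N) v j t
          - s * nR β x₀ C₀ lam s (mesh N) t (j * mesh N) * v j t) →
      s * intOpen N (fun j => |dt T (v j) t| ^ 2)
        + s * intLeft N (fun j => |dPlus (mesh N) (fun i => v i t) j| ^ 2)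
        + s ^ 3 * intOpen N (fun j => |v j t| ^ 2)
        + intOpen N (fun j =>
            |Ph1 T (psi β x₀ C₀) (phi β x₀ C₀ lam) lam s (mesh N) v j t| ^ 2)
        + intOpen N (fun j =>
            |Ph2 T (psi β x₀ C₀) (phi β x₀ C₀ lam) lam s (mesh N) v j t| ^ 2)
        + r * weightedEnergyDot β x₀ C₀ lam T s N v t
      ≤ M * intOpen N (fun j => |Ph T (phi β x₀ C₀ lam) s (mesh N) v j t| ^ 2)
        + M * s * |dMinus (mesh N) (fun i => v i t) (N + 1)| ^ 2
        + M * s * intLeft N (fun j => |mesh N * dPlus (mesh N) (fun i => dt T (v i) t) j| ^ 2) := by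
  obtain ⟨s₁, hs₁, ε₁, hε₁, κ, hκ, K, hK, hs₁1, hε1, H⟩ :=
    cross_product_lower_bound (T := T) hβ hx₀ hψ hlam hl
  obtain ⟨R, hR, HR⟩ := nR_bounded β x₀ C₀ lam T
  set k := min κ 1
  have hk0 : 0 < k := lt_min hκ one_pos
  -- Twice the cross-product bound yields 2κ of the weighted norms. One κ absorbs 2R²s²|v|² as soon
  -- as sκ > 2R², and the other remains. Dividing by k = min(κ, 1) normalises the left-hand side.
  refine ⟨max s₁ (2 * R ^ 2 / κ), by positivity, ε₁, hε₁, (2 + 2 * K) / k, by positivity, 2 / k,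
    fun N s hs v t ht v0 vN w0 wN hPh => ?_⟩
  have hs1 : s₁ < s := (le_max_left _ _).trans_lt hs.1
  have hs2 : 2 * R ^ 2 < s * κ := (div_lt_iff₀ hκ).1 ((le_max_right _ _).trans_lt hs.1)
  have cross := H N s ⟨hs1, hs.2⟩ v t ht v0 vN w0 wN
  have hpos : 0 < mesh N := mesh_pos N
  have hs0 : 0 < s := hs₁.trans hs1
  have hsh : s * mesh N ≤ 1 := by
    have := hs.2
    rw [lt_div_iff₀ hpos] at this
    linarith
  have hsum : intOpen N (fun j => |Ph1 T (psi β x₀ C₀) (phi β x₀ C₀ lam) lam s (mesh N) v j t| ^ 2)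
      + intOpen N (fun j => |Ph2 T (psi β x₀ C₀) (phi β x₀ C₀ lam) lam s (mesh N) v j t| ^ 2)
      + 2 * intOpen N (fun j => Ph1 T (psi β x₀ C₀) (phi β x₀ C₀ lam) lam s (mesh N) v j t
          * Ph2 T (psi β x₀ C₀) (phi β x₀ C₀ lam) lam s (mesh N) v j t)
      ≤ 2 * intOpen N (fun j => |Ph T (phi β x₀ C₀ lam) s (mesh N) v j t| ^ 2)
        + 2 * R ^ 2 * s ^ 2 * intOpen N (fun j => |v j t| ^ 2) := by
    have pw : ∀ j ∈ Finset.Icc 1 N,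
        |Ph1 T (psi β x₀ C₀) (phi β x₀ C₀ lam) lam s (mesh N) v j t| ^ 2
        + |Ph2 T (psi β x₀ C₀) (phi β x₀ C₀ lam) lam s (mesh N) v j t| ^ 2
        + 2 * (Ph1 T (psi β x₀ C₀) (phi β x₀ C₀ lam) lam s (mesh N) v j t
          * Ph2 T (psi β x₀ C₀) (phi β x₀ C₀ lam) lam s (mesh N) v j t)
        ≤ 2 * |Ph T (phi β x₀ C₀ lam) s (mesh N) v j t| ^ 2
          + 2 * R ^ 2 * s ^ 2 * |v j t| ^ 2 := by
      intro j hj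
      have hx : (j : ℝ) * mesh N ∈ Icc (0 : ℝ) 1 := by
        refine ⟨by positivity, ?_⟩
        have : (j : ℝ) ≤ N := by exact_mod_cast (Finset.mem_Icc.1 hj).2
        exact (mul_le_mul_of_nonneg_right (by linarith) hpos.le).trans_eq (mesh_mul N)
      have r1 := HR s (mesh N) t _ (hs₁1.trans hs1.le) hpos hsh ht hx
      have r2 : nR β x₀ C₀ lam s (mesh N) t (j * mesh N) ^ 2 ≤ R ^ 2 := by
        rw [← sq_abs]; gcongr
      have r3 : nR β x₀ C₀ lam s (mesh N) t (j * mesh N) ^ 2 * (s ^ 2 * v j t ^ 2)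
          ≤ R ^ 2 * (s ^ 2 * v j t ^ 2) := by gcongr
      have e := hPh j hj
      simp only [sq_abs]
      set a := Ph1 T (psi β x₀ C₀) (phi β x₀ C₀ lam) lam s (mesh N) v j t
      set b := Ph2 T (psi β x₀ C₀) (phi β x₀ C₀ lam) lam s (mesh N) v j t
      set p := Ph T (phi β x₀ C₀ lam) s (mesh N) v j t
      set q := nR β x₀ C₀ lam s (mesh N) t (j * mesh N)
      have e' : a + b = p + s * q * v j t := by linarith
      have e2 : a ^ 2 + b ^ 2 + 2 * (a * b) = (p + s * q * v j t) ^ 2 := by rw [← e']; ring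
      rw [e2]
      linarith [sq_nonneg (p - s * q * v j t)]
    have := mul_le_mul_of_nonneg_left (Finset.sum_le_sum pw) hpos.le
    simp only [Finset.sum_add_distrib, ← Finset.mul_sum] at this
    simp only [intOpen]
    linarith
  set W := intOpen N (fun j => |dt T (v j) t| ^ 2)
  set P := intLeft N (fun j => |dPlus (mesh N) (fun i => v i t) j| ^ 2)
  set V := intOpen N (fun j => |v j t| ^ 2)
  set S1 := intOpen N (fun j =>
    |Ph1 T (psi β x₀ C₀) (phi β x₀ C₀ lam) lam s (mesh N) v j t| ^ 2)
  set S2 := intOpen N (fun j =>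
    |Ph2 T (psi β x₀ C₀) (phi β x₀ C₀ lam) lam s (mesh N) v j t| ^ 2)
  set S := intOpen N (fun j => |Ph T (phi β x₀ C₀ lam) s (mesh N) v j t| ^ 2)
  set S12 := intOpen N (fun j => Ph1 T (psi β x₀ C₀) (phi β x₀ C₀ lam) lam s (mesh N) v j t
          * Ph2 T (psi β x₀ C₀) (phi β x₀ C₀ lam) lam s (mesh N) v j t)
  set Z := intLeft N (fun j => |mesh N * dPlus (mesh N) (fun i => dt T (v i) t) j| ^ 2)
  set B := |dMinus (mesh N) (fun i => v i t) (N + 1)| ^ 2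
  set Ed := weightedEnergyDot β x₀ C₀ lam T s N v t
  have nnO : ∀ f : ℕ → ℝ, 0 ≤ intOpen N (fun j => |f j| ^ 2) := fun f =>
    mul_nonneg hpos.le (Finset.sum_nonneg fun _ _ => by positivity)
  have nnL : ∀ f : ℕ → ℝ, 0 ≤ intLeft N (fun j => |f j| ^ 2) := fun f =>
    mul_nonneg hpos.le (Finset.sum_nonneg fun _ _ => by positivity)
  have nW : 0 ≤ W := nnO _
  have nP : 0 ≤ P := nnL _
  have nV : 0 ≤ V := nnO _
  have nS1 : 0 ≤ S1 := nnO _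
  have nS2 : 0 ≤ S2 := nnO _
  have nS : 0 ≤ S := nnO _
  have nZ : 0 ≤ Z := nnL _
  have nB : 0 ≤ B := by positivity
  have absorb : 2 * R ^ 2 * s ^ 2 * V ≤ κ * (s ^ 3 * V) := by
    calc 2 * R ^ 2 * s ^ 2 * V ≤ (s * κ) * s ^ 2 * V := by gcongr
      _ = _ := by ring
  have hG : 0 ≤ s * W + s * P + s ^ 3 * V := by positivity
  have g1 : k * (s * W + s * P + s ^ 3 * V) ≤ κ * (s * W + s * P + s ^ 3 * V) := by
    gcongr; exact min_le_left _ _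
  have g2 : k * (S1 + S2) ≤ 1 * (S1 + S2) := by gcongr; exact min_le_right _ _
  have g3 : κ * (s ^ 3 * V) ≤ κ * (s * W + s * P + s ^ 3 * V) := by
    gcongr; nlinarith [mul_nonneg hs0.le nW, mul_nonneg hs0.le nP]
  have g4 : 0 ≤ K * S := by positivity
  have g5 : 0 ≤ s * B := by positivity
  have g6 : 0 ≤ s * Z := by positivity
  have main : k * (s * W + s * P + s ^ 3 * V + S1 + S2) + 2 * Ed
      ≤ (2 + 2 * K) * (S + s * B + s * Z) := by linarith
  have : s * W + s * P + s ^ 3 * V + S1 + S2 + 2 / k * Ed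
      ≤ (2 + 2 * K) / k * (S + s * B + s * Z) := by
    have e : (2 + 2 * K) / k * (S + s * B + s * Z) = (2 + 2 * K) * (S + s * B + s * Z) / k := by
      ring
    rw [e, le_div_iff₀ hk0]
    calc _ = k * (s * W + s * P + s ^ 3 * V + S1 + S2) + 2 * Ed := by field_simp
      _ ≤ _ := main
  linarith

/-! ### Conjugation of the discrete Laplacian. -/

section conjugation

variable {β x₀ C₀ lam : ℝ}

/-- The quotient `ρ(t, x + σ h) / ρ(t, x)`, as a function of `σ`. -/
noncomputable def rhoRatio (β x₀ C₀ lam s h t x σ : ℝ) : ℝ :=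
  Real.exp (-(s * (phi β x₀ C₀ lam t (x + σ * h) - phi β x₀ C₀ lam t x)))

lemma hasDerivAt_rhoRatio (s h t x σ : ℝ) :
    HasDerivAt (rhoRatio β x₀ C₀ lam s h t x)
      (-(s * lam * (2 * (x + σ * h - x₀)) * phi β x₀ C₀ lam t (x + σ * h)) * h
        * rhoRatio β x₀ C₀ lam s h t x σ) σ := by
  have h1 : HasDerivAt (fun σ => x + σ * h) h σ := by
    simpa using ((hasDerivAt_id σ).mul_const h).const_add x
  have h2 := (hasDerivAt_phi_snd β x₀ C₀ lam t (x + σ * h)).comp σ h1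
  have h3 := (((h2.sub_const (phi β x₀ C₀ lam t x)).const_mul s).neg).exp
  refine h3.congr_deriv ?_
  simp only [rhoRatio, Function.comp_def, Pi.neg_apply]
  ring

lemma hasDerivAt_logSlope (s h t x σ : ℝ) :
    HasDerivAt (fun σ => -(s * lam * (2 * (x + σ * h - x₀)) * phi β x₀ C₀ lam t (x + σ * h)))
      (-(s * lam * (2 * phi β x₀ C₀ lam t (x + σ * h)
        + lam * (2 * (x + σ * h - x₀)) ^ 2 * phi β x₀ C₀ lam t (x + σ * h))) * h) σ := by
  have h1 : HasDerivAt (fun σ => x + σ * h) h σ := by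
    simpa using ((hasDerivAt_id σ).mul_const h).const_add x
  have h2 := (hasDerivAt_phi_snd β x₀ C₀ lam t (x + σ * h)).comp σ h1
  have h4 : HasDerivAt (fun σ => s * lam * (2 * (x + σ * h - x₀))) (s * lam * (2 * h)) σ :=
    (((h1.sub_const x₀).const_mul 2).const_mul (s * lam))
  refine ((h4.mul h2).neg).congr_deriv ?_
  simp only [Function.comp_def]
  ring

lemma continuous_phi_shift (t x h : ℝ) :
    Continuous fun σ => phi β x₀ C₀ lam t (x + σ * h) := by
  unfold phi psi
  fun_prop

lemma continuous_rhoRatio (s h t x : ℝ) : Continuous (rhoRatio β x₀ C₀ lam s h t x) :=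
  Real.continuous_exp.comp
    ((continuous_const.mul ((continuous_phi_shift t x h).sub continuous_const)).neg)

/-- Fundamental theorem of calculus in σ: the integrand of A₁ is, up to a constant, the σ-derivative
of the weight ratio. -/
lemma rhoRatio_sub (s h t x : ℝ) :
    rhoRatio β x₀ C₀ lam s h t x 1 - rhoRatio β x₀ C₀ lam s h t x (-1)
      = -(2 * h * s * lam * A1 (psi β x₀ C₀) (phi β x₀ C₀ lam) s h t x) := by
  have hc := continuous_phi_shift (β := β) (x₀ := x₀) (C₀ := C₀) (lam := lam) t x h
  have hr := continuous_rhoRatio (β := β) (x₀ := x₀) (C₀ := C₀) (lam := lam) s h t x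
  rw [← intervalIntegral.integral_eq_sub_of_hasDerivAt
    (fun σ _ => hasDerivAt_rhoRatio s h t x σ) (Continuous.intervalIntegrable (by fun_prop) _ _),
    A1_eq, kernelAvg, ← intervalIntegral.integral_const_mul, ← intervalIntegral.integral_neg]
  congr 1
  funext σ
  simp only [shiftWeight, rhoRatio]
  ring

/-- Taylor's formula with integral remainder at σ = 0: the second difference of the ratio is its
second σ-derivative integrated against the tent 1 - |σ|. This derivative is h² times the combination
of integrands that defines A₀. -/
lemma rhoRatio_add {h : ℝ} (hh : h ≠ 0) (s t x : ℝ) :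
    rhoRatio β x₀ C₀ lam s h t x 1 + rhoRatio β x₀ C₀ lam s h t x (-1)
      = 2 + 2 * A0 (psi β x₀ C₀) (phi β x₀ C₀ lam) lam s h t x := by
  have hc := continuous_phi_shift (β := β) (x₀ := x₀) (C₀ := C₀) (lam := lam) t x h
  have hr := continuous_rhoRatio (β := β) (x₀ := x₀) (C₀ := C₀) (lam := lam) s h t x
  set G : ℝ → ℝ := fun σ => -(s * lam * (2 * (x + σ * h - x₀)) * phi β x₀ C₀ lam t (x + σ * h))
    with hG
  set R := rhoRatio β x₀ C₀ lam s h t x with hR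
  set f : ℝ → ℝ := fun σ => (s ^ 2 * lam ^ 2 * (phi β x₀ C₀ lam t (x + σ * h) ^ 2
    * (2 * (x + σ * h - x₀)) ^ 2) - s * lam ^ 2 * (phi β x₀ C₀ lam t (x + σ * h)
    * (2 * (x + σ * h - x₀)) ^ 2) - s * lam * (phi β x₀ C₀ lam t (x + σ * h) * 2)) * R σ with hf
  have hfc : Continuous f := by fun_prop
  have dG : ∀ σ, HasDerivAt (fun σ => G σ * R σ / h) (f σ) σ := fun σ =>
    (((hasDerivAt_logSlope s h t x σ).mul (hasDerivAt_rhoRatio s h t x σ)).div_const h).congr_deriv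
      (by simp only [hf, hR]; field_simp; ring)
  have dR : ∀ σ, HasDerivAt (fun σ => R σ / h ^ 2) (G σ * R σ / h) σ := fun σ =>
    ((hasDerivAt_rhoRatio s h t x σ).div_const (h ^ 2)).congr_deriv
      (by simp only [hG, hR]; field_simp)
  -- Since G·R/h = R'/h² and f = R''/h², these are the primitives given by integrating (1 ∓ σ)R''/h²
  -- by parts.
  have d2 : ∀ σ, HasDerivAt (fun σ => (1 - σ) * (G σ * R σ / h) + R σ / h ^ 2)
      ((1 - σ) * f σ) σ := fun σ =>
    ((((hasDerivAt_id σ).const_sub 1).mul (dG σ)).add (dR σ)).congr_deriv (by simp)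
  have d1 : ∀ σ, HasDerivAt (fun σ => (1 + σ) * (G σ * R σ / h) - R σ / h ^ 2)
      ((1 + σ) * f σ) σ := fun σ =>
    ((((hasDerivAt_id σ).const_add 1).mul (dG σ)).sub (dR σ)).congr_deriv (by simp)
  have key := integral_tent_mul hfc d1 d2
  have hR0 : R 0 = 1 := by simp [hR, rhoRatio]
  have hint : ∀ p : ℝ → ℝ, Continuous p →
      IntervalIntegrable (fun σ => (1 - |σ|) * (p σ * R σ)) volume (-1) 1 := fun p hp =>
    Continuous.intervalIntegrable (by fun_prop) _ _
  have split : ∫ σ in (-1 : ℝ)..1, (1 - |σ|) * f σ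
      = s ^ 2 * lam ^ 2 * A2 (psi β x₀ C₀) (phi β x₀ C₀ lam) s h t x
        - s * lam ^ 2 * A3 (psi β x₀ C₀) (phi β x₀ C₀ lam) s h t x
        - s * lam * A4 (psi β x₀ C₀) (phi β x₀ C₀ lam) s h t x := by
    rw [A2_eq, A3_eq, A4_eq]
    simp only [kernelAvg, shiftWeight]
    rw [← intervalIntegral.integral_const_mul, ← intervalIntegral.integral_const_mul,
      ← intervalIntegral.integral_const_mul]
    rw [← intervalIntegral.integral_sub, ← intervalIntegral.integral_sub]
    · congr 1; funext σ; simp only [hf, hR, rhoRatio]; ring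
    · exact ((hint _ (by fun_prop)).const_mul _).sub ((hint _ (by fun_prop)).const_mul _)
    · exact (hint _ (by fun_prop)).const_mul _
    · exact (hint _ (by fun_prop)).const_mul _
    · exact (hint _ (by fun_prop)).const_mul _
  rw [split] at key
  rw [A0, key]
  simp only [hR0]
  field_simp
  ring

/-- The ratios to the two neighbours are 1 + A₀ ∓ hsλA₁. The even part acts as (1 + A₀)Δ_h plus
multiplication by 2A₀/h², the odd part as -2sλA₁∂_h, with no error. -/
lemma lapl_conj {h : ℝ} (hh : h ≠ 0) (s t : ℝ) (v : ℕ → ℝ) {j : ℕ} (hj : 1 ≤ j) :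
    1 / rho (phi β x₀ C₀ lam) s t (j * h)
        * lapl h (fun i => rho (phi β x₀ C₀ lam) s t (i * h) * v i) j
      = (1 + A0 (psi β x₀ C₀) (phi β x₀ C₀ lam) lam s h t (j * h)) * lapl h v j
        - 2 * s * lam * A1 (psi β x₀ C₀) (phi β x₀ C₀ lam) s h t (j * h) * dCent h v j
        + (s ^ 2 * lam ^ 2 * A2 (psi β x₀ C₀) (phi β x₀ C₀ lam) s h t (j * h)
          - s * lam ^ 2 * A3 (psi β x₀ C₀) (phi β x₀ C₀ lam) s h t (j * h)
          - s * lam * A4 (psi β x₀ C₀) (phi β x₀ C₀ lam) s h t (j * h)) * v j := by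
  set x : ℝ := j * h with hx
  have hp : ((j + 1 : ℕ) : ℝ) * h = x + 1 * h := by push_cast; ring
  have hm : ((j - 1 : ℕ) : ℝ) * h = x + (-1) * h := by
    rw [Nat.cast_sub hj]; push_cast; ring
  have hρ : rho (phi β x₀ C₀ lam) s t x ≠ 0 := (Real.exp_pos _).ne'
  have a0 : s ^ 2 * lam ^ 2 * A2 (psi β x₀ C₀) (phi β x₀ C₀ lam) s h t x
          - s * lam ^ 2 * A3 (psi β x₀ C₀) (phi β x₀ C₀ lam) s h t x
          - s * lam * A4 (psi β x₀ C₀) (phi β x₀ C₀ lam) s h t x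
      = 2 * A0 (psi β x₀ C₀) (phi β x₀ C₀ lam) lam s h t x / h ^ 2 := by
    rw [A0]; field_simp
  rw [a0]
  have e1 := rhoRatio_add (β := β) (x₀ := x₀) (C₀ := C₀) (lam := lam) hh s t x
  have e2 := rhoRatio_sub (β := β) (x₀ := x₀) (C₀ := C₀) (lam := lam) s h t x
  have rp : rho (phi β x₀ C₀ lam) s t (x + 1 * h)
      = rho (phi β x₀ C₀ lam) s t x * rhoRatio β x₀ C₀ lam s h t x 1 := by
    rw [rhoRatio, ← rho_div_rho, mul_div_cancel₀ _ hρ]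
  have rm : rho (phi β x₀ C₀ lam) s t (x + (-1) * h)
      = rho (phi β x₀ C₀ lam) s t x * rhoRatio β x₀ C₀ lam s h t x (-1) := by
    rw [rhoRatio, ← rho_div_rho, mul_div_cancel₀ _ hρ]
  have ep : rhoRatio β x₀ C₀ lam s h t x 1
      = 1 + A0 (psi β x₀ C₀) (phi β x₀ C₀ lam) lam s h t x
        - h * s * lam * A1 (psi β x₀ C₀) (phi β x₀ C₀ lam) s h t x := by linarith
  have em : rhoRatio β x₀ C₀ lam s h t x (-1)
      = 1 + A0 (psi β x₀ C₀) (phi β x₀ C₀ lam) lam s h t x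
        + h * s * lam * A1 (psi β x₀ C₀) (phi β x₀ C₀ lam) s h t x := by linarith
  simp only [lapl, dCent, hp, hm, ← hx, rp, rm, ep, em]
  field_simp
  ring

end conjugation

/-! ### Conjugation in time and the splitting of P_h. -/

section time

variable {T : ℝ}

lemma uniqueDiffWithinAt_Icc (hT : 0 < T) {t : ℝ} (ht : t ∈ Icc (-T) T) :
    UniqueDiffWithinAt ℝ (Icc (-T) T) t := uniqueDiffOn_Icc (by linarith) t ht

/-- Stated through the logarithmic derivative θ of the weight, so that ρ factors out. The first
derivative is needed at every point of the interval, the second only at t. -/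
lemma dtt_weight_mul (hT : 0 < T) {ρ θ u : ℝ → ℝ} {θ' t : ℝ} (ht : t ∈ Icc (-T) T)
    (hρ : ∀ τ, HasDerivAt ρ (θ τ * ρ τ) τ) (hθ : HasDerivAt θ θ' t)
    (hu : DifferentiableOn ℝ u (Icc (-T) T))
    (hw : DifferentiableWithinAt ℝ (dt T u) (Icc (-T) T) t) :
    dtt T (fun τ => ρ τ * u τ) t
      = ρ t * ((θ' + θ t ^ 2) * u t + 2 * θ t * dt T u t + dtt T u t) := by
  have hd : ∀ τ ∈ Icc (-T) T, HasDerivWithinAt u (dt T u τ) (Icc (-T) T) τ := fun τ hτ =>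
    (hu τ hτ).hasDerivWithinAt
  have h1 : ∀ τ ∈ Icc (-T) T, dt T (fun τ => ρ τ * u τ) τ
      = θ τ * ρ τ * u τ + ρ τ * dt T u τ := fun τ hτ =>
    ((hρ τ).hasDerivWithinAt.mul (hd τ hτ)).derivWithin (uniqueDiffWithinAt_Icc hT hτ)
  have h2 : HasDerivWithinAt (dt T u) (dtt T u t) (Icc (-T) T) t := hw.hasDerivWithinAt
  have h3 := (((hθ.hasDerivWithinAt (s := Icc (-T) T)).mul (hρ t).hasDerivWithinAt).mul
    (hd t ht)).add ((hρ t).hasDerivWithinAt.mul h2)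
  have h4 := h3.congr_of_mem (f₁ := dt T (fun τ => ρ τ * u τ)) (fun τ hτ => h1 τ hτ) ht
  have h5 : dtt T (fun τ => ρ τ * u τ) t = _ := h4.derivWithin (uniqueDiffWithinAt_Icc hT ht)
  rw [h5]
  simp only [Pi.mul_apply]
  ring

lemma hasDerivAt_rho (β x₀ C₀ lam s x τ : ℝ) :
    HasDerivAt (fun τ => rho (phi β x₀ C₀ lam) s τ x)
      (-(s * (lam * (-2 * β * τ) * phi β x₀ C₀ lam τ x))
        * rho (phi β x₀ C₀ lam) s τ x) τ := by
  refine (((hasDerivAt_phi_fst β x₀ C₀ lam τ x).const_mul s).neg.exp).congr_deriv ?_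
  simp only [rho, Pi.neg_apply]
  ring

lemma hasDerivAt_rho_rate (β x₀ C₀ lam s x t : ℝ) :
    HasDerivAt (fun τ => -(s * (lam * (-2 * β * τ) * phi β x₀ C₀ lam τ x)))
      (-(s * lam * (-2 * β * phi β x₀ C₀ lam t x
        + lam * (-2 * β * t) ^ 2 * phi β x₀ C₀ lam t x))) t := by
  have h1 : HasDerivAt (fun τ => lam * (-2 * β * τ)) (lam * (-2 * β)) t := by
    simpa using ((hasDerivAt_id t).const_mul (-2 * β)).const_mul lam
  refine (((h1.mul (hasDerivAt_phi_fst β x₀ C₀ lam t x)).const_mul s).neg).congr_deriv ?_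
  ring

lemma Ph_eq (β x₀ C₀ lam : ℝ) (hT : 0 < T) {h : ℝ} (hh : h ≠ 0) (s : ℝ) {t : ℝ}
    (ht : t ∈ Icc (-T) T) (v : ℕ → ℝ → ℝ) {j : ℕ} (hj : 1 ≤ j)
    (hu : DifferentiableOn ℝ (v j) (Icc (-T) T))
    (hw : DifferentiableWithinAt ℝ (dt T (v j)) (Icc (-T) T) t) :
    Ph T (phi β x₀ C₀ lam) s h v j t
      = Ph1 T (psi β x₀ C₀) (phi β x₀ C₀ lam) lam s h v j t
        + Ph2 T (psi β x₀ C₀) (phi β x₀ C₀ lam) lam s h v j t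
        - s * nR β x₀ C₀ lam s h t (j * h) * v j t := by
  have hρ : rho (phi β x₀ C₀ lam) s t (j * h) ≠ 0 := (Real.exp_pos _).ne'
  rw [Ph, mul_sub, lapl_conj hh s t (fun i => v i t) hj,
    dtt_weight_mul hT ht (fun τ => hasDerivAt_rho β x₀ C₀ lam s (j * h) τ)
      (hasDerivAt_rho_rate β x₀ C₀ lam s (j * h) t) hu hw, ← mul_assoc, one_div,
    inv_mul_cancel₀ hρ, one_mul]
  simp only [Ph1, Ph2, nR, pt_psi, sq_abs]
  ring

end time

/-! ### The boundary-in-time functional and its absolute continuity. -/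

/-- The boundary-in-time functional produced by integrating `P_{h,1} v · P_{h,2} v` by parts. -/
noncomputable def energy (N : ℕ) (h : ℝ) (a b c d e v w : ℕ → ℝ → ℝ) (t : ℝ) : ℝ :=
  h * ∑ j ∈ Finset.Icc 1 N,
      (-(d j t * (v j t * w j t)) - e j t * (w j t * w j t)
        + 2 * (a j t * (w j t * dCent h (fun i => v i t) j))
        - b j t * e j t * (v j t * v j t))
    - h * ∑ j ∈ Finset.Icc 0 N,
      (c j t * e j t + c (j + 1) t * e (j + 1) t) / 2
        * (dPlus h (fun i => v i t) j * dPlus h (fun i => v i t) j)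

lemma hasDerivAt_energy {N : ℕ} {h t : ℝ} {a b c d e v w : ℕ → ℝ → ℝ}
    {a' b' c' d' e' z : ℕ → ℝ}
    (ha : ∀ j ≤ N + 1, HasDerivAt (a j) (a' j) t) (hb : ∀ j ≤ N + 1, HasDerivAt (b j) (b' j) t)
    (hc : ∀ j ≤ N + 1, HasDerivAt (c j) (c' j) t) (hd : ∀ j ≤ N + 1, HasDerivAt (d j) (d' j) t)
    (he : ∀ j ≤ N + 1, HasDerivAt (e j) (e' j) t)
    (hv : ∀ j ≤ N + 1, HasDerivAt (v j) (w j t) t)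
    (hw : ∀ j ≤ N + 1, HasDerivAt (w j) (z j) t) :
    HasDerivAt (energy N h a b c d e v w)
      (energyDot N h (fun j => a j t) a' (fun j => b j t) b' (fun j => c j t) c'
        (fun j => d j t) d' (fun j => e j t) e' (fun j => v j t) (fun j => w j t) z) t := by
  have hp : ∀ j ≤ N, HasDerivAt (fun t => dPlus h (fun i => v i t) j)
      (dPlus h (fun i => w i t) j) t := fun j hj =>
    ((hv (j + 1) (by omega)).sub (hv j (by omega))).div_const h
  have hq : ∀ j ≤ N, HasDerivAt (fun t => dCent h (fun i => v i t) j)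
      (dCent h (fun i => w i t) j) t := fun j hj =>
    ((hv (j + 1) (by omega)).sub (hv (j - 1) (by omega))).div_const (2 * h)
  refine ((HasDerivAt.fun_sum fun j hj => ?_).const_mul h).sub
    ((HasDerivAt.fun_sum fun j hj => ?_).const_mul h)
  · have hj := (Finset.mem_Icc.1 hj).2
    have h1 := hv j (by omega)
    have h2 := hw j (by omega)
    exact ((((hd j (by omega)).mul (h1.mul h2)).neg.sub ((he j (by omega)).mul (h2.mul h2))).add
      (((ha j (by omega)).mul (h2.mul (hq j hj))).const_mul 2)).sub
      (((hb j (by omega)).mul (he j (by omega))).mul (h1.mul h1))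
  · have hj := (Finset.mem_Icc.1 hj).2
    have h1 := hp j hj
    exact (((((hc j (by omega)).mul (he j (by omega))).add
      ((hc (j + 1) (by omega)).mul (he (j + 1) (by omega))))).div_const 2).mul (h1.mul h1)

lemma absolutelyContinuous_fun_sum {ι : Type*} {S : Finset ι} {f : ι → ℝ → ℝ} {a b : ℝ}
    (h : ∀ i ∈ S, AbsolutelyContinuousOnInterval (f i) a b) :
    AbsolutelyContinuousOnInterval (fun t => ∑ i ∈ S, f i t) a b := by
  classical
  induction S using Finset.induction_on with
  | empty =>
    simp only [Finset.sum_empty]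
    exact (LipschitzWith.const (0 : ℝ)).lipschitzOnWith.absolutelyContinuousOnInterval
  | insert i S hi ih =>
    simp only [Finset.sum_insert hi]
    exact (h i (Finset.mem_insert_self i S)).fun_add
      (ih fun k hk => h k (Finset.mem_insert_of_mem hk))

lemma AbsolutelyContinuousOnInterval.div_const' {f : ℝ → ℝ} {a b : ℝ}
    (hf : AbsolutelyContinuousOnInterval f a b) (c : ℝ) :
    AbsolutelyContinuousOnInterval (fun t => f t / c) a b := by
  simpa only [div_eq_inv_mul] using hf.const_mul c⁻¹

lemma absolutelyContinuous_energy {N : ℕ} {h t₀ t₁ : ℝ} {a b c d e v w : ℕ → ℝ → ℝ}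
    (ha : ∀ j ≤ N + 1, AbsolutelyContinuousOnInterval (a j) t₀ t₁)
    (hb : ∀ j ≤ N + 1, AbsolutelyContinuousOnInterval (b j) t₀ t₁)
    (hc : ∀ j ≤ N + 1, AbsolutelyContinuousOnInterval (c j) t₀ t₁)
    (hd : ∀ j ≤ N + 1, AbsolutelyContinuousOnInterval (d j) t₀ t₁)
    (he : ∀ j ≤ N + 1, AbsolutelyContinuousOnInterval (e j) t₀ t₁)
    (hv : ∀ j ≤ N + 1, AbsolutelyContinuousOnInterval (v j) t₀ t₁)
    (hw : ∀ j ≤ N + 1, AbsolutelyContinuousOnInterval (w j) t₀ t₁) :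
    AbsolutelyContinuousOnInterval (energy N h a b c d e v w) t₀ t₁ := by
  have hp : ∀ j ≤ N, AbsolutelyContinuousOnInterval (fun t => dPlus h (fun i => v i t) j) t₀ t₁ :=
    fun j hj => AbsolutelyContinuousOnInterval.div_const'
      ((hv (j + 1) (by omega)).fun_sub (hv j (by omega))) h
  have hq : ∀ j ≤ N, AbsolutelyContinuousOnInterval (fun t => dCent h (fun i => v i t) j) t₀ t₁ :=
    fun j hj => AbsolutelyContinuousOnInterval.div_const'
      ((hv (j + 1) (by omega)).fun_sub (hv (j - 1) (by omega))) (2 * h)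
  refine ((absolutelyContinuous_fun_sum fun j hj => ?_).const_mul h).fun_sub
    ((absolutelyContinuous_fun_sum fun j hj => ?_).const_mul h)
  · have hj := (Finset.mem_Icc.1 hj).2
    have h1 := hv j (by omega)
    have h2 := hw j (by omega)
    exact ((((hd j (by omega)).fun_mul (h1.fun_mul h2)).fun_neg.fun_sub
      ((he j (by omega)).fun_mul (h2.fun_mul h2))).fun_add
      (((ha j (by omega)).fun_mul (h2.fun_mul (hq j hj))).const_mul 2)).fun_sub
      (((hb j (by omega)).fun_mul (he j (by omega))).fun_mul (h1.fun_mul h1))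
  · have hj := (Finset.mem_Icc.1 hj).2
    have h1 := hp j hj
    exact (AbsolutelyContinuousOnInterval.div_const' (((hc j (by omega)).fun_mul
      (he j (by omega))).fun_add
      ((hc (j + 1) (by omega)).fun_mul (he (j + 1) (by omega)))) 2).fun_mul (h1.fun_mul h1)

lemma energy_eq_zero {N : ℕ} {h t : ℝ} {a b c d e v w : ℕ → ℝ → ℝ}
    (hv : ∀ j ≤ N + 1, v j t = 0) (hw : ∀ j ≤ N + 1, w j t = 0) :
    energy N h a b c d e v w t = 0 := by
  have h1 : ∀ j ∈ Finset.Icc 0 N, dPlus h (fun i => v i t) j = 0 := fun j hj => by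
    have := (Finset.mem_Icc.1 hj).2
    simp [dPlus, hv (j + 1) (by omega), hv j (by omega)]
  unfold energy
  rw [Finset.sum_eq_zero, Finset.sum_eq_zero]
  · simp
  · intro j hj; simp [h1 j hj]
  · intro j hj
    have := (Finset.mem_Icc.1 hj).2
    simp [hv j (by omega), hw j (by omega)]

/-- The time derivative is bounded by limit plus error, at most 2C, so the coefficient is Lipschitz
in t. -/
lemma Approx.absolutelyContinuous {T : ℝ} {f : ℝ → ℝ → ℝ → ℝ → ℝ} {g gt gx : ℝ → ℝ → ℝ}
    (H : Approx T f g gt gx) {s h x : ℝ} (hs : 1 ≤ s) (hh : 0 < h) (hsh : s * h ≤ 1)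
    (hx : x ∈ Icc (0 : ℝ) 1) (hT : 0 < T) :
    AbsolutelyContinuousOnInterval (fun τ => f s h τ x) (-T) T := by
  obtain ⟨C, hC, H⟩ := H
  have : LipschitzOnWith (2 * C).toNNReal (fun τ => f s h τ x) (Icc (-T) T) := by
    refine (convex_Icc _ _).lipschitzOnWith_of_nnnorm_deriv_le
      (fun t ht => (H s h t x hs hh hsh ht hx).1) fun t ht => ?_
    obtain ⟨-, -, h1, -, -, h2, -⟩ := H s h t x hs hh hsh ht hx
    rw [← NNReal.coe_le_coe, coe_nnnorm, Real.norm_eq_abs, Real.coe_toNNReal _ (by positivity)]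
    have : |deriv (fun τ => f s h τ x) t| ≤ |deriv (fun τ => f s h τ x) t - gt t x| + |gt t x| := by
      simpa using abs_add_le (deriv (fun τ => f s h τ x) t - gt t x) (gt t x)
    nlinarith
  rw [← uIcc_of_le (by linarith : -T ≤ T)] at this
  exact this.absolutelyContinuousOnInterval

lemma IsH2.absolutelyContinuous {T : ℝ} (hT : 0 < T) {u : ℝ → ℝ} (hu : IsH2 T u) :
    AbsolutelyContinuousOnInterval u (-T) T := by
  obtain ⟨C, hC⟩ := hu.2.1.exists_bound
  rw [uIcc_of_le (by linarith : -T ≤ T)] at hC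
  have hC0 : 0 ≤ C := (norm_nonneg _).trans (hC 0 ⟨by linarith, hT.le⟩)
  have : LipschitzOnWith C.toNNReal u (Icc (-T) T) :=
    (convex_Icc _ _).lipschitzOnWith_of_nnnorm_derivWithin_le hu.1 fun t ht => by
      rw [← NNReal.coe_le_coe, coe_nnnorm, Real.coe_toNNReal _ hC0]
      exact hC t ht
  rw [← uIcc_of_le (by linarith : -T ≤ T)] at this
  exact this.absolutelyContinuousOnInterval

lemma IsH2.hasDerivAt {T : ℝ} {u : ℝ → ℝ} (hu : IsH2 T u) {t : ℝ} (ht : t ∈ Ioo (-T) T) :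
    HasDerivAt u (dt T u t) t :=
  (hu.1 t (Ioo_subset_Icc_self ht)).hasDerivWithinAt.hasDerivAt (Icc_mem_nhds ht.1 ht.2)

lemma IsH2.ae_hasDerivAt_dt {T : ℝ} {u : ℝ → ℝ} (hT : 0 < T) (hu : IsH2 T u) :
    ∀ᵐ t, t ∈ Ioo (-T) T → HasDerivAt (dt T u) (dtt T u t) t := by
  filter_upwards [hu.2.1.ae_differentiableAt] with t h ht
  have hd := h (by rw [uIcc_of_le (by linarith)]; exact Ioo_subset_Icc_self ht)
  have : dtt T u t = deriv (dt T u) t := derivWithin_of_mem_nhds (Icc_mem_nhds ht.1 ht.2)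
  rw [this]
  exact hd.hasDerivAt

/-- The functional is absolutely continuous and vanishes at ±T with v and v_t. Its derivative is the
integrand only almost everywhere, because v_tt is merely L². -/
lemma integral_weightedEnergyDot (β x₀ C₀ lam : ℝ) {T : ℝ} (hT : 0 < T) {N : ℕ} {s : ℝ}
    (hs : 1 ≤ s) (hsh : s * mesh N ≤ 1) {v : ℕ → ℝ → ℝ} (hv : ∀ j, IsH2 T (v j))
    (hbd : ∀ j, v j (-T) = 0 ∧ v j T = 0 ∧ dt T (v j) (-T) = 0 ∧ dt T (v j) T = 0) :
    IntervalIntegrable (weightedEnergyDot β x₀ C₀ lam T s N v) volume (-T) T ∧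
      ∫ t in (-T)..T, weightedEnergyDot β x₀ C₀ lam T s N v t = 0 := by
  have hpos := mesh_pos N
  have hx : ∀ j ≤ N + 1, (j : ℝ) * mesh N ∈ Icc (0 : ℝ) 1 := fun j hj => by
    refine ⟨by positivity, ?_⟩
    have : (j : ℝ) ≤ N + 1 := by exact_mod_cast hj
    exact (mul_le_mul_of_nonneg_right this hpos.le).trans_eq (mesh_mul N)
  set E := energy N (mesh N) (fun i t => s * nA β x₀ C₀ lam s (mesh N) t (i * mesh N))
    (fun i t => s ^ 2 * nB β x₀ C₀ lam s (mesh N) t (i * mesh N))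
    (fun i t => nC β x₀ C₀ lam s (mesh N) t (i * mesh N))
    (fun i t => s * nD β x₀ C₀ lam s (mesh N) t (i * mesh N))
    (fun i t => s * nE β x₀ C₀ lam s (mesh N) t (i * mesh N)) v (fun i => dt T (v i)) with hE
  have hAC : AbsolutelyContinuousOnInterval E (-T) T :=
    absolutelyContinuous_energy
      (fun j hj => ((approx_nA β x₀ C₀ lam T).absolutelyContinuous hs hpos hsh (hx j hj)
        hT).const_mul s)
      (fun j hj => ((approx_nB β x₀ C₀ lam T).absolutelyContinuous hs hpos hsh (hx j hj)
        hT).const_mul (s ^ 2))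
      (fun j hj => (approx_nC β x₀ C₀ lam T).absolutelyContinuous hs hpos hsh (hx j hj) hT)
      (fun j hj => ((approx_nD β x₀ C₀ lam T).absolutelyContinuous hs hpos hsh (hx j hj)
        hT).const_mul s)
      (fun j hj => ((approx_nE β x₀ C₀ lam T).absolutelyContinuous hs hpos hsh (hx j hj)
        hT).const_mul s)
      (fun j _ => (hv j).absolutelyContinuous hT) (fun j _ => (hv j).2.1)
  have hdiff : ∀ {f : ℝ → ℝ → ℝ → ℝ → ℝ} {g gt gx : ℝ → ℝ → ℝ}, Approx T f g gt gx →
      ∀ t ∈ Ioo (-T) T, ∀ j ≤ N + 1, HasDerivAt (fun τ => f s (mesh N) τ (j * mesh N))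
        (pt (f s (mesh N)) t (j * mesh N)) t := by
    rintro f g gt gx ⟨C, hC, H⟩ t ht j hj
    exact (H s (mesh N) t _ hs hpos hsh (Ioo_subset_Icc_self ht) (hx j hj)).1.hasDerivAt
  have hae : ∀ᵐ t, t ∈ Ioo (-T) T →
      HasDerivAt E (weightedEnergyDot β x₀ C₀ lam T s N v t) t := by
    have := ae_all_iff.2 fun j => (hv j).ae_hasDerivAt_dt hT
    filter_upwards [this] with t h ht
    exact hasDerivAt_energy
      (fun j hj => (hdiff (approx_nA β x₀ C₀ lam T) t ht j hj).const_mul s)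
      (fun j hj => (hdiff (approx_nB β x₀ C₀ lam T) t ht j hj).const_mul (s ^ 2))
      (fun j hj => hdiff (approx_nC β x₀ C₀ lam T) t ht j hj)
      (fun j hj => (hdiff (approx_nD β x₀ C₀ lam T) t ht j hj).const_mul s)
      (fun j hj => (hdiff (approx_nE β x₀ C₀ lam T) t ht j hj).const_mul s)
      (fun j _ => (hv j).hasDerivAt ht) (fun j _ => h j ht)
  have hae' : ∀ᵐ t, t ∈ uIoc (-T) T → deriv E t = weightedEnergyDot β x₀ C₀ lam T s N v t := by
    have hne : ∀ᵐ t : ℝ, t ≠ T := by simp [ae_iff, measure_singleton]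
    filter_upwards [hae, hne] with t h h1 ht
    rw [uIoc_of_le (by linarith)] at ht
    exact (h ⟨ht.1, lt_of_le_of_ne ht.2 h1⟩).deriv
  constructor
  · refine hAC.intervalIntegrable_deriv.congr_ae ?_
    rw [Filter.EventuallyEq, ae_restrict_iff' measurableSet_uIoc]
    exact hae'
  · rw [← intervalIntegral.integral_congr_ae hae', hAC.integral_deriv_eq_sub, hE,
      energy_eq_zero (fun j _ => (hbd j).2.1) (fun j _ => (hbd j).2.2.2),
      energy_eq_zero (fun j _ => (hbd j).1) (fun j _ => (hbd j).2.2.1), sub_zero]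

/-! ### Integrability and integration in time. -/

lemma intervalIntegrable_of_continuousOn {T : ℝ} (hT : 0 < T) {f : ℝ → ℝ}
    (hf : ContinuousOn f (Icc (-T) T)) : IntervalIntegrable f volume (-T) T := by
  rw [← uIcc_of_le (by linarith : -T ≤ T)] at hf
  exact hf.intervalIntegrable

lemma memLp_two_of_continuousOn {a b : ℝ} {f : ℝ → ℝ} (hf : ContinuousOn f (Icc a b)) :
    MemLp f 2 (volume.restrict (Ioo a b)) := by
  obtain ⟨C, hC⟩ := isCompact_Icc.exists_bound_of_continuousOn hf
  refine MemLp.of_bound ((hf.mono Ioo_subset_Icc_self).aestronglyMeasurable measurableSet_Ioo) C ?_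
  filter_upwards [ae_restrict_mem measurableSet_Ioo] with x hx using hC x (Ioo_subset_Icc_self hx)

lemma intervalIntegrable_sq_of_memLp {T : ℝ} (hT : 0 < T) {f : ℝ → ℝ}
    (hf : MemLp f 2 (volume.restrict (Ioo (-T) T))) :
    IntervalIntegrable (fun t => |f t| ^ 2) volume (-T) T := by
  rw [intervalIntegrable_iff_integrableOn_Ioo_of_le (by linarith)]
  simpa only [sq_abs, IntegrableOn] using hf.integrable_sq

lemma intervalIntegrable_intOpen {T : ℝ} {N : ℕ} {f : ℕ → ℝ → ℝ}
    (hf : ∀ j ∈ Finset.Icc 1 N, IntervalIntegrable (f j) volume (-T) T) :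
    IntervalIntegrable (fun t => intOpen N (fun j => f j t)) volume (-T) T := by
  have h : IntervalIntegrable (∑ j ∈ Finset.Icc 1 N, f j) volume (-T) T :=
    IntervalIntegrable.sum _ hf
  simpa only [intOpen, Finset.sum_apply] using h.const_mul (mesh N)

lemma intervalIntegrable_intLeft {T : ℝ} {N : ℕ} {f : ℕ → ℝ → ℝ}
    (hf : ∀ j ∈ Finset.Icc 0 N, IntervalIntegrable (f j) volume (-T) T) :
    IntervalIntegrable (fun t => intLeft N (fun j => f j t)) volume (-T) T := by
  have h : IntervalIntegrable (∑ j ∈ Finset.Icc 0 N, f j) volume (-T) T :=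
    IntervalIntegrable.sum _ hf
  simpa only [intLeft, Finset.sum_apply] using h.const_mul (mesh N)

lemma approx_nR (β x₀ C₀ lam T : ℝ) : ∃ g gt gx, Approx T (nR β x₀ C₀ lam) g gt gx :=
  ⟨_, _, _, (((approx_phi β x₀ C₀ lam T).const_mul (-2 * β)).sub
    (approx_A4 β x₀ C₀ lam T)).const_mul lam⟩

lemma dt_zero (T t : ℝ) : dt T (fun _ => 0) t = 0 := by simp [dt]

lemma isH2_zero (T : ℝ) : IsH2 T (fun _ => 0) := by
  have e : dt T (fun _ => 0) = fun _ => 0 := funext (dt_zero T)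
  have e2 : dtt T (fun _ => 0) = fun _ => 0 := by
    funext t; unfold dtt; rw [e, dt_zero]
  refine ⟨differentiableOn_const _, ?_, ?_⟩
  · rw [e]; exact (LipschitzWith.const (0 : ℝ)).lipschitzOnWith.absolutelyContinuousOnInterval
  · rw [e2]; exact MemLp.zero

/-- The term r·E may have any sign: it is carried through the pointwise inequality and disappears on
integration. -/
lemma integral_combination_le {T : ℝ} (hT : 0 < T) {f₁ f₂ f₃ f₄ f₅ E g₁ g₂ g₃ : ℝ → ℝ}
    (h₁ : IntervalIntegrable f₁ volume (-T) T) (h₂ : IntervalIntegrable f₂ volume (-T) T)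
    (h₃ : IntervalIntegrable f₃ volume (-T) T) (h₄ : IntervalIntegrable f₄ volume (-T) T)
    (h₅ : IntervalIntegrable f₅ volume (-T) T) (hE : IntervalIntegrable E volume (-T) T)
    (k₁ : IntervalIntegrable g₁ volume (-T) T) (k₂ : IntervalIntegrable g₂ volume (-T) T)
    (k₃ : IntervalIntegrable g₃ volume (-T) T) (hE0 : ∫ t in (-T)..T, E t = 0)
    {a b c p q m : ℝ} (r : ℝ)
    (h : ∀ᵐ t, t ∈ Icc (-T) T → a * f₁ t + b * f₂ t + c * f₃ t + f₄ t + f₅ t + r * E t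
      ≤ m * g₁ t + p * g₂ t + q * g₃ t) :
    a * (∫ t in (-T)..T, f₁ t) + b * (∫ t in (-T)..T, f₂ t) + c * (∫ t in (-T)..T, f₃ t)
      + (∫ t in (-T)..T, f₄ t) + (∫ t in (-T)..T, f₅ t)
      ≤ m * (∫ t in (-T)..T, g₁ t) + p * (∫ t in (-T)..T, g₂ t)
        + q * (∫ t in (-T)..T, g₃ t) := by
  have l1 : IntervalIntegrable (fun t => a * f₁ t + b * f₂ t) volume (-T) T :=
    (h₁.const_mul a).add (h₂.const_mul b)
  have l2 : IntervalIntegrable (fun t => a * f₁ t + b * f₂ t + c * f₃ t) volume (-T) T :=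
    l1.add (h₃.const_mul c)
  have l3 : IntervalIntegrable (fun t => a * f₁ t + b * f₂ t + c * f₃ t + f₄ t) volume (-T) T :=
    l2.add h₄
  have l4 : IntervalIntegrable (fun t => a * f₁ t + b * f₂ t + c * f₃ t + f₄ t + f₅ t)
      volume (-T) T := l3.add h₅
  have l5 : IntervalIntegrable (fun t => a * f₁ t + b * f₂ t + c * f₃ t + f₄ t + f₅ t + r * E t)
      volume (-T) T := l4.add (hE.const_mul r)
  have r1 : IntervalIntegrable (fun t => m * g₁ t + p * g₂ t) volume (-T) T :=
    (k₁.const_mul m).add (k₂.const_mul p)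
  have r2 : IntervalIntegrable (fun t => m * g₁ t + p * g₂ t + q * g₃ t) volume (-T) T :=
    r1.add (k₃.const_mul q)
  have := intervalIntegral.integral_mono_ae_restrict (by linarith) l5 r2
    ((ae_restrict_iff' measurableSet_Icc).2 h)
  rw [intervalIntegral.integral_add l4 (hE.const_mul r), intervalIntegral.integral_add l3 h₅,
    intervalIntegral.integral_add l2 h₄, intervalIntegral.integral_add l1 (h₃.const_mul c),
    intervalIntegral.integral_add (h₁.const_mul a) (h₂.const_mul b),
    intervalIntegral.integral_add r1 (k₃.const_mul q),
    intervalIntegral.integral_add (k₁.const_mul m) (k₂.const_mul p)] at this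
  simpa only [intervalIntegral.integral_const_mul, hE0, mul_zero, add_zero] using this

/-- The estimate for functions vanishing identically at the boundary nodes. -/
lemma carleman_of_zero_boundary {T β x₀ C₀ lam : ℝ} (hT : 0 < T) (hβ : β ∈ Ioo (0 : ℝ) 1)
    (hx₀ : x₀ < 0)
    (hψ : ∀ t ∈ Icc (-T) T, ∀ x ∈ Icc (0 : ℝ) 1, 1 ≤ psi β x₀ C₀ t x)
    (hlam : 0 < lam) (hl : lam * ((1 - β) * x₀ ^ 2) = 1) :
    ∃ s₀ > 0, ∃ ε₀ > 0, ∃ M > 0, ∀ N : ℕ, ∀ s ∈ Ioo s₀ (ε₀ / mesh N), ∀ v : ℕ → ℝ → ℝ,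
      (∀ j, IsH2 T (v j)) → (v 0 = fun _ => 0) → (v (N + 1) = fun _ => 0) →
      (∀ j, v j (-T) = 0 ∧ v j T = 0 ∧ dt T (v j) (-T) = 0 ∧ dt T (v j) T = 0) →
      s * (∫ t in (-T)..T, intOpen N (fun j => |dt T (v j) t| ^ 2))
          + s * (∫ t in (-T)..T, intLeft N (fun j => |dPlus (mesh N) (fun i => v i t) j| ^ 2))
          + s ^ 3 * (∫ t in (-T)..T, intOpen N (fun j => |v j t| ^ 2))
          + (∫ t in (-T)..T, intOpen N (fun j =>
              |Ph1 T (psi β x₀ C₀) (phi β x₀ C₀ lam) lam s (mesh N) v j t| ^ 2))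
          + (∫ t in (-T)..T, intOpen N (fun j =>
              |Ph2 T (psi β x₀ C₀) (phi β x₀ C₀ lam) lam s (mesh N) v j t| ^ 2))
        ≤ M * (∫ t in (-T)..T, intOpen N (fun j =>
              |Ph T (phi β x₀ C₀ lam) s (mesh N) v j t| ^ 2))
          + M * s * (∫ t in (-T)..T, |dMinus (mesh N) (fun i => v i t) (N + 1)| ^ 2)
          + M * s * (∫ t in (-T)..T, intLeft N (fun j =>
              |mesh N * dPlus (mesh N) (fun i => dt T (v i) t) j| ^ 2)) := by
  obtain ⟨s₁, hs₁, ε₁, hε₁, M, hM, r, H⟩ := pointwise_estimate (T := T) hβ hx₀ hψ hlam hl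
  refine ⟨max s₁ 1, by positivity, min ε₁ 1, by positivity, M, hM,
    fun N s hs v hv v0 vN hbd => ?_⟩
  have hpos := mesh_pos N
  have hs1 : 1 ≤ s := (le_max_right _ _).trans hs.1.le
  have hs2 := (lt_div_iff₀ hpos).1 hs.2
  have hsh : s * mesh N ≤ 1 := hs2.le.trans (min_le_right _ _)
  have hsI : s ∈ Ioo s₁ (ε₁ / mesh N) :=
    ⟨(le_max_left _ _).trans_lt hs.1, (lt_div_iff₀ hpos).2 (hs2.trans_le (min_le_left _ _))⟩
  have hle : -T ≤ T := by linarith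
  obtain ⟨hEi, hE0⟩ := integral_weightedEnergyDot β x₀ C₀ lam hT hs1 hsh hv hbd
  have hcv : ∀ j, ContinuousOn (v j) (Icc (-T) T) := fun j => (hv j).1.continuousOn
  have hcw : ∀ j, ContinuousOn (dt T (v j)) (Icc (-T) T) := fun j => by
    have := (hv j).2.1.continuousOn
    rwa [uIcc_of_le hle] at this
  have hcoef : ∀ {f : ℝ → ℝ → ℝ → ℝ → ℝ} {g gt gx : ℝ → ℝ → ℝ}, Approx T f g gt gx →
      ∀ j ∈ Finset.Icc 1 N, ContinuousOn (fun t => f s (mesh N) t (j * mesh N)) (Icc (-T) T) := by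
    intro f g gt gx hf j hj
    have hx : (j : ℝ) * mesh N ∈ Icc (0 : ℝ) 1 := by
      refine ⟨by positivity, ?_⟩
      have : (j : ℝ) ≤ N := by exact_mod_cast (Finset.mem_Icc.1 hj).2
      exact (mul_le_mul_of_nonneg_right (by linarith) hpos.le).trans_eq (mesh_mul N)
    have := (hf.absolutelyContinuous hs1 hpos hsh hx hT).continuousOn
    rwa [uIcc_of_le hle] at this
  have hcp : ∀ j, ContinuousOn (fun t => dPlus (mesh N) (fun i => v i t) j) (Icc (-T) T) :=
    fun j => ((hcv (j + 1)).sub (hcv j)).div_const _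
  have hcq : ∀ j, ContinuousOn (fun t => dPlus (mesh N) (fun i => dt T (v i) t) j) (Icc (-T) T) :=
    fun j => ((hcw (j + 1)).sub (hcw j)).div_const _
  have hcl : ∀ j, ContinuousOn (fun t => lapl (mesh N) (fun i => v i t) j) (Icc (-T) T) :=
    fun j => (((hcv (j + 1)).sub (continuousOn_const.mul (hcv j))).add (hcv (j - 1))).div_const _
  have hcc : ∀ j, ContinuousOn (fun t => dCent (mesh N) (fun i => v i t) j) (Icc (-T) T) :=
    fun j => ((hcv (j + 1)).sub (hcv (j - 1))).div_const _
  have hcsq : ∀ {f : ℝ → ℝ}, ContinuousOn f (Icc (-T) T) →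
      IntervalIntegrable (fun t => |f t| ^ 2) volume (-T) T := fun hf =>
    intervalIntegrable_of_continuousOn hT (hf.abs.pow 2)
  have hP1 : ∀ j ∈ Finset.Icc 1 N, MemLp
      (Ph1 T (psi β x₀ C₀) (phi β x₀ C₀ lam) lam s (mesh N) v j) 2
      (volume.restrict (Ioo (-T) T)) := fun j hj => by
    have h1 := memLp_two_of_continuousOn ((hcoef (approx_nC β x₀ C₀ lam T) j hj).mul (hcl j))
    have h2 := memLp_two_of_continuousOn (((continuousOn_const (c := s ^ 2)).mul
      (hcoef (approx_nB β x₀ C₀ lam T) j hj)).mul (hcv j))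
    exact (((hv j).2.2.sub h1).add h2).ae_eq
      (Filter.Eventually.of_forall fun t => (Ph1_eq β x₀ C₀ lam T s (mesh N) t v j).symm)
  have hP2 : ∀ j ∈ Finset.Icc 1 N, ContinuousOn
      (Ph2 T (psi β x₀ C₀) (phi β x₀ C₀ lam) lam s (mesh N) v j) (Icc (-T) T) := fun j hj => by
    have h1 := ((continuousOn_const (c := s)).mul
      (hcoef (approx_nD β x₀ C₀ lam T) j hj)).mul (hcv j)
    have h2 := (continuousOn_const (c := (2 : ℝ))).mul ((continuousOn_const (c := s)).mul
      (hcoef (approx_nE β x₀ C₀ lam T) j hj)) |>.mul (hcw j)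
    have h3 := (continuousOn_const (c := (2 : ℝ))).mul ((continuousOn_const (c := s)).mul
      (hcoef (approx_nA β x₀ C₀ lam T) j hj)) |>.mul (hcc j)
    exact ((h1.neg.sub h2).add h3).congr fun t _ => Ph2_eq β x₀ C₀ lam T s (mesh N) t v j
  have hae : ∀ᵐ t, t ∈ Ioo (-T) T → ∀ j ∈ Finset.Icc 1 N,
      Ph T (phi β x₀ C₀ lam) s (mesh N) v j t
        = Ph1 T (psi β x₀ C₀) (phi β x₀ C₀ lam) lam s (mesh N) v j t
          + Ph2 T (psi β x₀ C₀) (phi β x₀ C₀ lam) lam s (mesh N) v j t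
          - s * nR β x₀ C₀ lam s (mesh N) t (j * mesh N) * v j t := by
    filter_upwards [ae_all_iff.2 fun j => (hv j).ae_hasDerivAt_dt hT] with t h ht j hj
    exact Ph_eq β x₀ C₀ lam hT hpos.ne' s (Ioo_subset_Icc_self ht) v (Finset.mem_Icc.1 hj).1
      (hv j).1 (h j ht).differentiableAt.differentiableWithinAt
  -- Square integrability of P_h v comes from the almost-everywhere splitting, whose right-hand side
  -- consists of an L² function and continuous ones.
  have hP : ∀ j ∈ Finset.Icc 1 N, MemLp (Ph T (phi β x₀ C₀ lam) s (mesh N) v j) 2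
      (volume.restrict (Ioo (-T) T)) := fun j hj => by
    obtain ⟨g, gt, gx, hR⟩ := approx_nR β x₀ C₀ lam T
    have h1 := memLp_two_of_continuousOn (((continuousOn_const (c := s)).mul
      (hcoef hR j hj)).mul (hcv j))
    refine (((hP1 j hj).add (memLp_two_of_continuousOn (hP2 j hj))).sub h1).ae_eq ?_
    rw [Filter.EventuallyEq, ae_restrict_iff' measurableSet_Ioo]
    filter_upwards [hae] with t h ht using (h ht j hj).symm
  have iW := intervalIntegrable_intOpen (N := N) fun j _ => hcsq (hcw j)
  have iP := intervalIntegrable_intLeft (N := N) fun j _ => hcsq (hcp j)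
  have iV := intervalIntegrable_intOpen (N := N) fun j _ => hcsq (hcv j)
  have i1 := intervalIntegrable_intOpen fun j hj => intervalIntegrable_sq_of_memLp hT (hP1 j hj)
  have i2 := intervalIntegrable_intOpen fun j hj => hcsq (hP2 j hj)
  have i3 := intervalIntegrable_intOpen fun j hj => intervalIntegrable_sq_of_memLp hT (hP j hj)
  have iZ := intervalIntegrable_intLeft (N := N) fun j _ =>
    hcsq ((continuousOn_const (c := mesh N)).mul (hcq j))
  have iB : IntervalIntegrable (fun t => |dMinus (mesh N) (fun i => v i t) (N + 1)| ^ 2)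
      volume (-T) T := hcsq (((hcv (N + 1)).sub (hcv N)).div_const _)
  refine integral_combination_le hT iW iP iV i1 i2 hEi i3 iB iZ hE0 r ?_
  · have hne : ∀ᵐ t : ℝ, t ≠ T ∧ t ≠ -T := by
      have h1 : ∀ᵐ t : ℝ, t ≠ T := by simp [ae_iff, measure_singleton]
      have h2 : ∀ᵐ t : ℝ, t ≠ -T := by simp [ae_iff, measure_singleton]
      filter_upwards [h1, h2] with t a b using ⟨a, b⟩
    filter_upwards [hae, hne] with t h hn ht
    exact H N s hsI v t ht (by simp [v0]) (by simp [vN]) (by rw [v0, dt_zero])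
      (by rw [vN, dt_zero])
      (h ⟨lt_of_le_of_ne ht.1 (Ne.symm hn.2), lt_of_le_of_ne ht.2 hn.1⟩)

/-! ### Reduction to vanishing boundary components, and conclusion. -/

/-- Extension by zero of the interior components. -/
noncomputable def interiorPart (N : ℕ) (v : ℕ → ℝ → ℝ) (j : ℕ) : ℝ → ℝ :=
  if j ∈ Finset.Icc 1 N then v j else fun _ => 0

lemma interiorPart_of_mem {N : ℕ} {v : ℕ → ℝ → ℝ} {j : ℕ} (hj : j ∈ Finset.Icc 1 N) :
    interiorPart N v j = v j := if_pos hj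

lemma interiorPart_of_notMem {N : ℕ} {v : ℕ → ℝ → ℝ} {j : ℕ} (hj : j ∉ Finset.Icc 1 N) :
    interiorPart N v j = fun _ => 0 := if_neg hj

/-- The end components are known to vanish only on the open interval, and those beyond N + 1 are
arbitrary. Replacing all of them by zero makes every component H² and leaves the values at the nodes
0, …, N + 1 unchanged inside (-T, T). -/
lemma interiorPart_eqOn {T : ℝ} {N : ℕ} {v : ℕ → ℝ → ℝ}
    (hb : ∀ t ∈ Ioo (-T) T, v 0 t = 0 ∧ v (N + 1) t = 0) {j : ℕ} (hj : j ≤ N + 1) :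
    EqOn (interiorPart N v j) (v j) (Ioo (-T) T) := by
  intro t ht
  by_cases h : j ∈ Finset.Icc 1 N
  · rw [interiorPart_of_mem h]
  · rw [interiorPart_of_notMem h]
    rw [Finset.mem_Icc] at h
    obtain rfl | rfl : j = 0 ∨ j = N + 1 := by omega
    · exact (hb t ht).1.symm
    · exact (hb t ht).2.symm

lemma dt_congr_of_eqOn {T : ℝ} {u w : ℝ → ℝ} (h : EqOn u w (Ioo (-T) T)) {t : ℝ}
    (ht : t ∈ Ioo (-T) T) : dt T u t = dt T w t :=
  ((h.eventuallyEq_of_mem (isOpen_Ioo.mem_nhds ht)).filter_mono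
    nhdsWithin_le_nhds).derivWithin_eq (h ht)

end DiscreteCarleman

open DiscreteCarleman in
theorem lemma2p9 (T β x₀ C₀ : ℝ) (hT : 0 < T) (hβ : β ∈ Set.Ioo (0 : ℝ) 1) (hx₀ : x₀ < 0)
    (hC₀ : 0 < C₀)
    (hψ : ∀ t ∈ Set.Icc (-T) T, ∀ x ∈ Set.Icc (0 : ℝ) 1, 1 ≤ psi β x₀ C₀ t x) :
    ∃ lam > 0, ∃ s₀ > 0, ∃ ε₀ > 0, ∃ M₀ > 0,
      ∀ N : ℕ, ∀ s ∈ Set.Ioo s₀ (ε₀ / mesh N), ∀ v : ℕ → ℝ → ℝ,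
        (∀ j ∈ Finset.Icc 1 N, IsH2 T (v j)) →
        (∀ t ∈ Set.Ioo (-T) T, v 0 t = 0 ∧ v (N + 1) t = 0) →
        (∀ j ∈ Finset.Icc 1 N,
          v j (-T) = 0 ∧ v j T = 0 ∧ dt T (v j) (-T) = 0 ∧ dt T (v j) T = 0) →
        s * (∫ t in (-T)..T, intOpen N (fun j => |dt T (v j) t| ^ 2))
          + s * (∫ t in (-T)..T, intLeft N (fun j => |dPlus (mesh N) (fun i => v i t) j| ^ 2))
          + s ^ 3 * (∫ t in (-T)..T, intOpen N (fun j => |v j t| ^ 2))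
          + (∫ t in (-T)..T, intOpen N (fun j =>
              |Ph1 T (psi β x₀ C₀) (phi β x₀ C₀ lam) lam s (mesh N) v j t| ^ 2))
          + (∫ t in (-T)..T, intOpen N (fun j =>
              |Ph2 T (psi β x₀ C₀) (phi β x₀ C₀ lam) lam s (mesh N) v j t| ^ 2))
        ≤ M₀ * (∫ t in (-T)..T, intOpen N (fun j =>
              |Ph T (phi β x₀ C₀ lam) s (mesh N) v j t| ^ 2))
          + M₀ * s * (∫ t in (-T)..T, |dMinus (mesh N) (fun i => v i t) (N + 1)| ^ 2)
          + M₀ * s * (∫ t in (-T)..T, intLeft N (fun j =>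
              |mesh N * dPlus (mesh N) (fun i => dt T (v i) t) j| ^ 2)) := by
  have hX : 0 < (1 - β) * x₀ ^ 2 := mul_pos (by linarith [hβ.2]) (sq_pos_of_neg hx₀)
  -- The normalisation under which the zero-order polynomial is bounded below by 8.
  set lam := 1 / ((1 - β) * x₀ ^ 2)
  have hlam : 0 < lam := by positivity
  obtain ⟨s₀, hs₀, ε₀, hε₀, M, hM, H⟩ := carleman_of_zero_boundary hT hβ hx₀ hψ hlam
    (one_div_mul_cancel hX.ne')
  refine ⟨lam, hlam, s₀, hs₀, ε₀, hε₀, M, hM, fun N s hs v hv hb hbd => ?_⟩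
  have n0 : (0 : ℕ) ∉ Finset.Icc 1 N := by simp
  have nN : N + 1 ∉ Finset.Icc 1 N := by simp
  have key := H N s hs (interiorPart N v)
    (fun j => by
      by_cases h : j ∈ Finset.Icc 1 N
      · rw [interiorPart_of_mem h]; exact hv j h
      · rw [interiorPart_of_notMem h]; exact isH2_zero T)
    (interiorPart_of_notMem n0) (interiorPart_of_notMem nN)
    (fun j => by
      by_cases h : j ∈ Finset.Icc 1 N
      · rw [interiorPart_of_mem h]; exact hbd j h
      · rw [interiorPart_of_notMem h]; simp [dt_zero])
  have hval : ∀ t ∈ Set.Ioo (-T) T, ∀ j ≤ N + 1, interiorPart N v j t = v j t :=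
    fun t ht j hj => interiorPart_eqOn hb hj ht
  have hdt : ∀ t ∈ Set.Ioo (-T) T, ∀ j ≤ N + 1, dt T (interiorPart N v j) t = dt T (v j) t :=
    fun t ht j hj => dt_congr_of_eqOn (interiorPart_eqOn hb hj) ht
  -- Endpoints are null, so agreement of v and its interior part on the open interval is enough for
  -- every integral.
  have congrI : ∀ f g : ℝ → ℝ, (∀ t ∈ Set.Ioo (-T) T, f t = g t) →
      ∫ t in (-T)..T, f t = ∫ t in (-T)..T, g t := fun f g h =>
    intervalIntegral.integral_congr_uIoo fun t ht => h t (by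
      rwa [Set.uIoo_of_le (by linarith)] at ht)
  have congrO : ∀ f g : ℕ → ℝ → ℝ, (∀ t ∈ Set.Ioo (-T) T, ∀ j ∈ Finset.Icc 1 N, f j t = g j t) →
      ∫ t in (-T)..T, intOpen N (fun j => |f j t| ^ 2)
        = ∫ t in (-T)..T, intOpen N (fun j => |g j t| ^ 2) := fun f g h =>
    congrI _ _ fun t ht => by
      simp only [intOpen]
      rw [Finset.sum_congr rfl fun j hj => by rw [h t ht j hj]]
  have congrL : ∀ f g : ℕ → ℝ → ℝ, (∀ t ∈ Set.Ioo (-T) T, ∀ j ≤ N, f j t = g j t) →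
      ∫ t in (-T)..T, intLeft N (fun j => |f j t| ^ 2)
        = ∫ t in (-T)..T, intLeft N (fun j => |g j t| ^ 2) := fun f g h =>
    congrI _ _ fun t ht => by
      simp only [intLeft]
      rw [Finset.sum_congr rfl fun j hj => by rw [h t ht j (Finset.mem_Icc.1 hj).2]]
  have hlapl : ∀ t ∈ Set.Ioo (-T) T, ∀ j ∈ Finset.Icc 1 N, ∀ c : ℕ → ℝ,
      lapl (mesh N) (fun i => c i * interiorPart N v i t) j
        = lapl (mesh N) (fun i => c i * v i t) j := fun t ht j hj c => by
    have := (Finset.mem_Icc.1 hj).2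
    simp only [lapl, hval t ht j (by omega), hval t ht (j + 1) (by omega),
      hval t ht (j - 1) (by omega)]
  have hlapl' : ∀ t ∈ Set.Ioo (-T) T, ∀ j ∈ Finset.Icc 1 N,
      lapl (mesh N) (fun i => interiorPart N v i t) j
        = lapl (mesh N) (fun i => v i t) j := fun t ht j hj => by
    simpa only [one_mul] using hlapl t ht j hj fun _ => 1
  have hcent : ∀ t ∈ Set.Ioo (-T) T, ∀ j ∈ Finset.Icc 1 N,
      dCent (mesh N) (fun i => interiorPart N v i t) j
        = dCent (mesh N) (fun i => v i t) j := fun t ht j hj => by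
    have := (Finset.mem_Icc.1 hj).2
    simp only [dCent, hval t ht (j + 1) (by omega), hval t ht (j - 1) (by omega)]
  rw [congrO (fun j => dt T (interiorPart N v j)) (fun j => dt T (v j)) fun t ht j hj => hdt t ht j
      ((Finset.mem_Icc.1 hj).2.trans N.le_succ),
    congrL (fun j t => dPlus (mesh N) (fun i => interiorPart N v i t) j)
      (fun j t => dPlus (mesh N) (fun i => v i t) j) fun t ht j hj => by
      simp only [dPlus, hval t ht j (by omega), hval t ht (j + 1) (by omega)],
    congrO (interiorPart N v) v fun t ht j hj => hval t ht j ((Finset.mem_Icc.1 hj).2.trans N.le_succ),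
    congrO (fun j => Ph1 T (psi β x₀ C₀) (phi β x₀ C₀ lam) lam s (mesh N) (interiorPart N v) j)
      (fun j => Ph1 T (psi β x₀ C₀) (phi β x₀ C₀ lam) lam s (mesh N) v j)
      fun t ht j hj => by
        simp only [Ph1, hlapl' t ht j hj, interiorPart_of_mem hj],
    congrO (fun j => Ph2 T (psi β x₀ C₀) (phi β x₀ C₀ lam) lam s (mesh N) (interiorPart N v) j)
      (fun j => Ph2 T (psi β x₀ C₀) (phi β x₀ C₀ lam) lam s (mesh N) v j)
      fun t ht j hj => by
        simp only [Ph2, hcent t ht j hj, interiorPart_of_mem hj],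
    congrO (fun j => Ph T (phi β x₀ C₀ lam) s (mesh N) (interiorPart N v) j)
      (fun j => Ph T (phi β x₀ C₀ lam) s (mesh N) v j)
      fun t ht j hj => by
        simp only [Ph, hlapl t ht j hj, interiorPart_of_mem hj],
    congrI (fun t => |dMinus (mesh N) (fun i => interiorPart N v i t) (N + 1)| ^ 2)
      (fun t => |dMinus (mesh N) (fun i => v i t) (N + 1)| ^ 2) fun t ht => by
      simp only [dMinus, Nat.add_sub_cancel, hval t ht N (by omega), hval t ht (N + 1) le_rfl],
    congrL (fun j t => mesh N * dPlus (mesh N) (fun i => dt T (interiorPart N v i) t) j)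
      (fun j t => mesh N * dPlus (mesh N) (fun i => dt T (v i) t) j) fun t ht j hj => by
      simp only [dPlus, hdt t ht j (by omega), hdt t ht (j + 1) (by omega)]] at key
  exact key
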